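/- **An $O(n^3)$ dynamic program for the maximum weight convex polytope problem in the plane.** Given $n$ distinct points of $\mathbb R^2$ with arbitrary real weights, the weight of a polytope (the convex hull of a finite, possibly empty, set of points of $\mathbb R^2$) is the sum of the weights of the input points it contains; the task is to find a polytope of maximum weight. *Notation.* Let $p_1,\dots,p_n$ be the points, with weights $w(p_t)$, sorted by strictly increasing $x$-coordinate, and let $u\times_2 v=u_xv_y-u_yv_x$. For $a<b<d$ the path $p_a\to p_b\to p_d$ is *concave* if $(p_d-p_a)\times_2(p_b-p_a)\ge 0$ and *convex* if $(p_d-p_a)\times_2(p_b-p_a)\le 0$. A path with edges going from left to right is concave (convex) if all its triples of consecutive vertices are. For $i<j$ let $w(p_i,p_j)$ be the sum of the weights of all $p_t$ with $i<t<j$ lying below or on the segment $p_ip_j$, and $w_-(p_i,p_j)$ the same sum over the points strictly below it (the two agree if no three points are collinear). The weight $w(\mathcal C)$ of a path is the sum of $w(\cdot,\cdot)$ over its edges plus the weights of its vertices; the sub-weight $w^-(\mathcal V)$ is the sum of $w_-(\cdot,\cdot)$ over its edges. For $i<j\le k$ let $C[i,j,k]$ be the maximum weight of a concave path from $p_i$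 to $p_k$ with first edge $p_i\to p_j$, and $V[i,j,k]$ the minimum sub-weight of a convex path from $p_i$ to $p_k$ with first edge $p_i\to p_j$ ($\max\emptyset=-\infty$, $\min\emptyset=+\infty$). Let $M[i,k]$ be the maximum weight of a polygon (possibly degenerate) with vertices among the $p_t$, leftmost vertex $p_i$ and rightmost vertex $p_k$. **(A) Running time.** There are a single program for the real RAM (exact real arithmetic $+,-,\times,/$ and comparisons; integer words of $O(\log n)$ bits; random access arrays; unit cost per operation) and a constant $K$ such that, on every input of $n$ distinct weighted points (collinear points and equal $x$-coordinates are allowed), the program halts within $K(n+1)^3$ steps and outputs the maximum weight of a polytope together with a list of input points whose convex hull is a polytope of that weight. At that time its memory also holds the list of the points sorted from left to right and all entries $C[i,j,k]$ and $V[i,j,k]$ of the two tables. Here left-to-right order and the tables refer to rotated (and uniformly scaled) axes, computed by the program, in which no two points have the same $x$-coordinate; if the $x$-coordinates of the input are already distinct, the original axes are used. **(B) Decomposition.** Let $i<k$. Every polygon with vertices among the $p_t$, leftmost vertex $p_i$ and rightmost vertex $p_k$ is the region on or below a concave path $\mathcal C$ and on or above a convex path $\mathcal V$, both from $p_i$ to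 $p_k$, and the vertices of $\mathcal C$ and $\mathcal V$ together are exactly the vertices of the polygon. Conversely, for every concave path $\mathcal C$ and convex path $\mathcal V$ from $p_i$ to $p_k$, the convex hull of their vertices is the region on or below $\mathcal C$ and on or above $\mathcal V$, and its weight is $w(\mathcal C)-w^-(\mathcal V)$. Consequently $M[k,k]=w(p_k)$, and for $i<k$ $$M[i,k]=\max_{i<j\le k}C[i,j,k]-\min_{i<j\le k}V[i,j,k].$$ The maximum weight of a polytope is $\max\bigl(0,\max_{i\le k}M[i,k]\bigr)$, and it is $\max_{i\le k}M[i,k]$ if some point has positive weight. **(C) Recurrences.** For $i<k$: $C[i,k,k]=w(p_i,p_k)+w(p_i)+w(p_k)$ and $V[i,k,k]=w_-(p_i,p_k)$. For $i<j<k$: $C[i,j,k]=-\infty$ if $(p_k-p_i)\times_2(p_j-p_i)<0$, $V[i,j,k]=+\infty$ if $(p_k-p_i)\times_2(p_j-p_i)>0$, and in all cases $$C[i,j,k]=\max_{j'}\{w(p_i,p_j)+w(p_i)+C[j,j',k]: j<j'\le k,\ p_i\to p_j\to p_{j'}\text{ concave}\},$$ $$V[i,j,k]=\min_{j'}\{w_-(p_i,p_j)+V[j,j',k]: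 j<j'\le k,\ p_i\to p_j\to p_{j'}\text{ convex}\}.$$ **(D) Monotone pointer.** Fix $j$. Let $L_j$ and $R_j$ list the points to the left and to the right of $p_j$ in clockwise order around $p_j$ (ties in any order). For $i<j$ let $fc(i,j)$ be the first position in $R_j$ of a point $p_{j'}$ with $p_i\to p_j\to p_{j'}$ concave (the end of the list if there is none). Then the points $p_{j'}$ of $R_j$ with $p_i\to p_j\to p_{j'}$ concave are exactly those at position $fc(i,j)$ or later; for $j<k$, $$C[i,j,k]=w(p_i,p_j)+w(p_i)+D[fc(i,j),k],$$ where $D[a,k]$ is the maximum of $C[j,j'',k]$ over the $p_{j''}$ with $j''\le k$ at position $a$ or later in $R_j$; and $fc(i,j)$ is nondecreasing as $p_i$ runs through $L_j$. The same holds for $V$ with counterclockwise order, convex paths, minima, and $w_-(p_i,p_j)$ in place of $w(p_i,p_j)+w(p_i)$. -/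

import Mathlib

/-! ## Polytopes in the plane and their weights -/

namespace MWCP

/-- A (convex) polytope in the plane: the convex hull of finitely many points. -/
def IsPolytope (P : Set (ℝ × ℝ)) : Prop :=
  ∃ A : Finset (ℝ × ℝ), P = convexHull ℝ (A : Set (ℝ × ℝ))

open Classical in
/-- The weight of `P`: the sum of the weights of the points `p t` that lie in `P`. -/
noncomputable def weight {n : ℕ} (p : Fin n → ℝ × ℝ) (w : Fin n → ℝ) (P : Set (ℝ × ℝ)) : ℝ :=
  ∑ t ∈ Finset.univ.filter (fun t => p t ∈ P), w t

/-- The polygon spanned by the points with index in `A`. -/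
def hull {n : ℕ} (p : Fin n → ℝ × ℝ) (A : Set (Fin n)) : Set (ℝ × ℝ) :=
  convexHull ℝ (p '' A)

/-- The two-dimensional cross product. -/
def cross (u v : ℝ × ℝ) : ℝ := u.1 * v.2 - u.2 * v.1

/-! ## Paths through points sorted from left to right -/

section Paths

variable {n : ℕ} (q : Fin n → ℝ × ℝ) (w : Fin n → ℝ)

/-- `c` lists the indices of the vertices of a path from `q i` to `q k` all of whose edges go from
left to right. -/
def IsPath (i k : Fin n) (c : List (Fin n)) : Prop :=
  c.head? = some i ∧ c.getLast? = some k ∧ c.IsChain (· < ·)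

/-- `q a → q b → q d` is concave (three collinear points count as concave). -/
def ConcaveTriple (a b d : Fin n) : Prop := 0 ≤ cross (q d - q a) (q b - q a)

/-- `q a → q b → q d` is convex (three collinear points count as convex). -/
def ConvexTriple (a b d : Fin n) : Prop := cross (q d - q a) (q b - q a) ≤ 0

/-- Every three consecutive vertices of the path form a concave path. -/
def IsConcave : List (Fin n) → Prop
  | a :: b :: d :: l => ConcaveTriple q a b d ∧ IsConcave (b :: d :: l)
  | _ => True

/-- Every three consecutive vertices of the path form a convex path. -/
def IsConvex : List (Fin n) → Prop
  | a :: b :: d :: l => ConvexTriple q a b d ∧ IsConvex (b :: d :: l)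
  | _ => True

open Classical in
/-- Weight of the edge `q i → q j` of an upper path: the total weight of the points strictly between
`q i` and `q j` in the left-to-right order that lie below or on the segment. -/
noncomputable def upperEdge (i j : Fin n) : ℝ :=
  ∑ t ∈ (Finset.Ioo i j).filter (fun t => 0 ≤ cross (q t - q i) (q j - q i)), w t

open Classical in
/-- Weight of the edge `q i → q j` of a lower path: the total weight of the points strictly between
`q i` and `q j` in the left-to-right order that lie strictly below the segment. It equals `upperEdge`
if no three points are collinear. -/
noncomputable def lowerEdge (i j : Fin n) : ℝ :=
  ∑ t ∈ (Finset.Ioo i j).filter (fun t => 0 < cross (q t - q i) (q j - q i)), w t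

/-- The sum of `f` over the edges of a path. -/
def edgeSum (f : Fin n → Fin n → ℝ) : List (Fin n) → ℝ
  | a :: b :: l => f a b + edgeSum f (b :: l)
  | _ => 0

/-- The weight of an upper path: its edges and its vertices. -/
noncomputable def pathWeight (c : List (Fin n)) : ℝ := edgeSum (upperEdge q w) c + (c.map w).sum

/-- The sub-weight of a lower path: its edges only. -/
noncomputable def pathSubweight (c : List (Fin n)) : ℝ := edgeSum (lowerEdge q w) c

/-- `z` lies on or below the path `c`. -/
def Under (c : List (Fin n)) (z : ℝ × ℝ) : Prop :=
  ∃ u v, [u, v] <:+: c ∧ (q u).1 ≤ z.1 ∧ z.1 ≤ (q v).1 ∧ 0 ≤ cross (z - q u) (q v - q u)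

/-- `z` lies on or above the path `c`. -/
def Above (c : List (Fin n)) (z : ℝ × ℝ) : Prop :=
  ∃ u v, [u, v] <:+: c ∧ (q u).1 ≤ z.1 ∧ z.1 ≤ (q v).1 ∧ cross (z - q u) (q v - q u) ≤ 0

/-! ## The tables -/

/-- `C[i,j,k]`: the maximum weight of a concave path from `q i` to `q k` whose first edge is
`q i → q j` (`⊥ = -∞` if there is none). -/
noncomputable def tableC (i j k : Fin n) : EReal :=
  sSup {x | ∃ l, IsPath i k (i :: j :: l) ∧ IsConcave q (i :: j :: l) ∧
    x = (pathWeight q w (i :: j :: l) : ℝ)}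

/-- `V[i,j,k]`: the minimum sub-weight of a convex path from `q i` to `q k` whose first edge is
`q i → q j` (`⊤ = +∞` if there is none). -/
noncomputable def tableV (i j k : Fin n) : EReal :=
  sInf {x | ∃ l, IsPath i k (i :: j :: l) ∧ IsConvex q (i :: j :: l) ∧
    x = (pathSubweight q w (i :: j :: l) : ℝ)}

/-- The vertex `q i` is the leftmost and `q k` the rightmost point with index in `A`. -/
def Spans (i k : Fin n) (A : Finset (Fin n)) : Prop := i ∈ A ∧ k ∈ A ∧ A ⊆ Finset.Icc i k

/-- `M[i,k]`: the maximum weight of a polygon, with vertices among the points, whose leftmost vertex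
is `q i` and whose rightmost vertex is `q k`. -/
noncomputable def tableM (i k : Fin n) : EReal :=
  sSup {x | ∃ A : Finset (Fin n), Spans i k A ∧ x = (weight q w (hull q A) : ℝ)}

/-! ## Angularly sorted lists and the first compatible position -/

/-- `l` lists, each once, the indices in `I`, so that the points appear in clockwise order around
`q j`. Used for the points on one side of the vertical line through `q j`. -/
def ClockwiseList (j : Fin n) (I : Set (Fin n)) (l : List (Fin n)) : Prop :=
  l.Nodup ∧ (∀ t, t ∈ l ↔ t ∈ I) ∧ l.Pairwise (fun u v => 0 ≤ cross (q v - q j) (q u - q j))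

open Classical in
/-- The position in `R` of the first `j'` with `q i → q j → q j'` concave (`R.length` if there is
none). -/
noncomputable def fcConcave (i j : Fin n) (R : List (Fin n)) : ℕ :=
  R.findIdx (fun j' => decide (ConcaveTriple q i j j'))

open Classical in
/-- The position in `R` of the first `j'` with `q i → q j → q j'` convex (`R.length` if there is
none). -/
noncomputable def fcConvex (i j : Fin n) (R : List (Fin n)) : ℕ :=
  R.findIdx (fun j' => decide (ConvexTriple q i j j'))

/-- The maximum of `C[j,j'',k]` over the `j'' ≤ k` that appear in `R` at position `a` or later. -/
noncomputable def suffixMaxC (R : List (Fin n)) (j : Fin n) (a : ℕ) (k : Fin n) : EReal :=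
  ⨆ j'' ∈ {t | t ∈ R.drop a ∧ t ≤ k}, tableC q w j j'' k

/-- The minimum of `V[j,j'',k]` over the `j'' ≤ k` that appear in `R` at position `a` or later. -/
noncomputable def suffixMinV (R : List (Fin n)) (j : Fin n) (a : ℕ) (k : Fin n) : EReal :=
  ⨅ j'' ∈ {t | t ∈ R.drop a ∧ t ≤ k}, tableV q w j j'' k

end Paths

/-! ## A real random access machine

Programs are written in a while-language over scalar variables and random access arrays. There are
two kinds of data: natural numbers of bounded size (words), used for indices and counters, and exact
real numbers. Words are never obtained from reals by rounding; the only access to reals is by field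
operations and comparisons. Every operation, memory access, assignment and branch costs one step. -/

/-- Contents of the memory: scalar variables and arrays, for words and for reals. -/
@[ext]
structure State where
  ivar : ℕ → ℕ
  rvar : ℕ → ℝ
  iarr : ℕ → ℕ → ℕ
  rarr : ℕ → ℕ → ℝ

/-- Word expressions; `sub` is truncated subtraction. -/
inductive IExp where
  | const (m : ℕ)
  | var (x : ℕ)
  | get (a : ℕ) (e : IExp)
  | add (e f : IExp)
  | sub (e f : IExp)
  | mul (e f : IExp)

/-- Real expressions. -/
inductive RExp where
  | const (m : ℤ)
  | var (x : ℕ)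
  | get (a : ℕ) (e : IExp)
  | add (e f : RExp)
  | sub (e f : RExp)
  | mul (e f : RExp)
  | div (e f : RExp)

/-- Tests. -/
inductive BExp where
  | ilt (e f : IExp)
  | ieq (e f : IExp)
  | rlt (e f : RExp)
  | req (e f : RExp)
  | neg (b : BExp)
  | conj (b c : BExp)

def IExp.eval (s : State) : IExp → ℕ
  | .const m => m
  | .var x => s.ivar x
  | .get a e => s.iarr a (e.eval s)
  | .add e f => e.eval s + f.eval s
  | .sub e f => e.eval s - f.eval s
  | .mul e f => e.eval s * f.eval s

/-- All words that occur when the expression is evaluated are at most `W`. -/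
def IExp.Safe (W : ℕ) (s : State) : IExp → Prop
  | .const m => m ≤ W
  | .var x => s.ivar x ≤ W
  | .get a e => e.Safe W s ∧ s.iarr a (e.eval s) ≤ W
  | .add e f => e.Safe W s ∧ f.Safe W s ∧ e.eval s + f.eval s ≤ W
  | .sub e f => e.Safe W s ∧ f.Safe W s
  | .mul e f => e.Safe W s ∧ f.Safe W s ∧ e.eval s * f.eval s ≤ W

def IExp.cost : IExp → ℕ
  | .const _ => 1
  | .var _ => 1
  | .get _ e => e.cost + 1
  | .add e f => e.cost + f.cost + 1
  | .sub e f => e.cost + f.cost + 1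
  | .mul e f => e.cost + f.cost + 1

noncomputable def RExp.eval (s : State) : RExp → ℝ
  | .const m => (m : ℝ)
  | .var x => s.rvar x
  | .get a e => s.rarr a (e.eval s)
  | .add e f => e.eval s + f.eval s
  | .sub e f => e.eval s - f.eval s
  | .mul e f => e.eval s * f.eval s
  | .div e f => e.eval s / f.eval s

/-- All words that occur are at most `W`, and no division by zero occurs. -/
def RExp.Safe (W : ℕ) (s : State) : RExp → Prop
  | .const _ => True
  | .var _ => True
  | .get _ e => e.Safe W s
  | .add e f => e.Safe W s ∧ f.Safe W s
  | .sub e f => e.Safe W s ∧ f.Safe W s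
  | .mul e f => e.Safe W s ∧ f.Safe W s
  | .div e f => e.Safe W s ∧ f.Safe W s ∧ f.eval s ≠ 0

def RExp.cost : RExp → ℕ
  | .const _ => 1
  | .var _ => 1
  | .get _ e => e.cost + 1
  | .add e f => e.cost + f.cost + 1
  | .sub e f => e.cost + f.cost + 1
  | .mul e f => e.cost + f.cost + 1
  | .div e f => e.cost + f.cost + 1

def BExp.Holds (s : State) : BExp → Prop
  | .ilt e f => e.eval s < f.eval s
  | .ieq e f => e.eval s = f.eval s
  | .rlt e f => e.eval s < f.eval s
  | .req e f => e.eval s = f.eval s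
  | .neg b => ¬ b.Holds s
  | .conj b c => b.Holds s ∧ c.Holds s

def BExp.Safe (W : ℕ) (s : State) : BExp → Prop
  | .ilt e f => e.Safe W s ∧ f.Safe W s
  | .ieq e f => e.Safe W s ∧ f.Safe W s
  | .rlt e f => e.Safe W s ∧ f.Safe W s
  | .req e f => e.Safe W s ∧ f.Safe W s
  | .neg b => b.Safe W s
  | .conj b c => b.Safe W s ∧ c.Safe W s

def BExp.cost : BExp → ℕ
  | .ilt e f => e.cost + f.cost + 1
  | .ieq e f => e.cost + f.cost + 1
  | .rlt e f => e.cost + f.cost + 1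
  | .req e f => e.cost + f.cost + 1
  | .neg b => b.cost + 1
  | .conj b c => b.cost + c.cost + 1

/-- Programs. -/
inductive Prog where
  | skip
  | setI (x : ℕ) (e : IExp)
  | setR (x : ℕ) (e : RExp)
  | putI (a : ℕ) (idx e : IExp)
  | putR (a : ℕ) (idx : IExp) (e : RExp)
  | seq (c d : Prog)
  | cond (b : BExp) (c d : Prog)
  | loop (b : BExp) (c : Prog)

def State.setI (s : State) (x m : ℕ) : State := { s with ivar := Function.update s.ivar x m }

def State.setR (s : State) (x : ℕ) (r : ℝ) : State := { s with rvar := Function.update s.rvar x r }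

def State.putI (s : State) (a idx m : ℕ) : State :=
  { s with iarr := Function.update s.iarr a (Function.update (s.iarr a) idx m) }

def State.putR (s : State) (a idx : ℕ) (r : ℝ) : State :=
  { s with rarr := Function.update s.rarr a (Function.update (s.rarr a) idx r) }

/-- `Exec W c s t s'`: with words of size at most `W`, the program `c` started in memory `s` halts
after exactly `t` steps with memory `s'`, without word overflow and without division by zero. -/
inductive Exec (W : ℕ) : Prog → State → ℕ → State → Prop
  | skip (s : State) : Exec W .skip s 1 s
  | setI (s : State) (x : ℕ) (e : IExp) : e.Safe W s →
      Exec W (.setI x e) s (e.cost + 1) (s.setI x (e.eval s))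
  | setR (s : State) (x : ℕ) (e : RExp) : e.Safe W s →
      Exec W (.setR x e) s (e.cost + 1) (s.setR x (e.eval s))
  | putI (s : State) (a : ℕ) (idx e : IExp) : idx.Safe W s → e.Safe W s →
      Exec W (.putI a idx e) s (idx.cost + e.cost + 1) (s.putI a (idx.eval s) (e.eval s))
  | putR (s : State) (a : ℕ) (idx : IExp) (e : RExp) : idx.Safe W s → e.Safe W s →
      Exec W (.putR a idx e) s (idx.cost + e.cost + 1) (s.putR a (idx.eval s) (e.eval s))
  | seq (s s₁ s₂ : State) (c d : Prog) (t₁ t₂ : ℕ) : Exec W c s t₁ s₁ → Exec W d s₁ t₂ s₂ →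
      Exec W (.seq c d) s (t₁ + t₂) s₂
  | condTrue (s s₁ : State) (b : BExp) (c d : Prog) (t : ℕ) : b.Safe W s → b.Holds s →
      Exec W c s t s₁ → Exec W (.cond b c d) s (b.cost + 1 + t) s₁
  | condFalse (s s₁ : State) (b : BExp) (c d : Prog) (t : ℕ) : b.Safe W s → ¬ b.Holds s →
      Exec W d s t s₁ → Exec W (.cond b c d) s (b.cost + 1 + t) s₁
  | loopTrue (s s₁ s₂ : State) (b : BExp) (c : Prog) (t₁ t₂ : ℕ) : b.Safe W s → b.Holds s →
      Exec W c s t₁ s₁ → Exec W (.loop b c) s₁ t₂ s₂ →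
      Exec W (.loop b c) s (b.cost + 1 + t₁ + t₂) s₂
  | loopFalse (s : State) (b : BExp) (c : Prog) : b.Safe W s → ¬ b.Holds s →
      Exec W (.loop b c) s (b.cost + 1) s

/-! ## Input and output -/

/-- An array that starts with the entries of `f` and is zero afterwards. -/
noncomputable def toArray {n : ℕ} (f : Fin n → ℝ) (t : ℕ) : ℝ := if h : t < n then f ⟨t, h⟩ else 0

/-- The initial memory: word variable `0` holds `n`, and the real arrays `0`, `1`, `2` hold the
`x`-coordinates, the `y`-coordinates and the weights of the points. All the rest is zero. -/
noncomputable def input {n : ℕ} (p : Fin n → ℝ × ℝ) (w : Fin n → ℝ) : State where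
  ivar x := if x = 0 then n else 0
  rvar _ := 0
  iarr _ _ := 0
  rarr a := if a = 0 then toArray (fun t => (p t).1) else if a = 1 then toArray (fun t => (p t).2)
    else if a = 2 then toArray w else fun _ => 0

/-- The final memory `s` solves the problem. Real variable `0` holds the maximum weight of a polytope.
Word variable `1` holds a number `m`, and the first `m` entries of the word array `0` are indices of
input points whose convex hull is a polytope of maximum weight. -/
def SolvesMWCP {n : ℕ} (p : Fin n → ℝ × ℝ) (w : Fin n → ℝ) (s : State) : Prop :=
  (∀ t < s.ivar 1, s.iarr 0 t < n) ∧
  weight p w (hull p {i | ∃ t < s.ivar 1, s.iarr 0 t = i}) = s.rvar 0 ∧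
  ∀ P, IsPolytope P → weight p w P ≤ s.rvar 0

/-- The coordinates of `z` after rotating the axes (and scaling both by the same factor) so that
the new first axis points in the direction `(a, b)`. -/
def rotate (a b : ℝ) (z : ℝ × ℝ) : ℝ × ℝ := (a * z.1 + b * z.2, a * z.2 - b * z.1)

/-- The final memory `s` holds the tables. The real variables `1` and `2` hold the direction of the
new first axis, which is the old one if the `x`-coordinates of the input are distinct. The word array
`1` holds the indices of the points sorted from left to right with respect to the new axes; no two of
them have the same new first coordinate. The entry `C[i,j,k]` of the sorted points is stored at
address `(i * n + j) * n + k`: the real array `3` holds its value and the word array `2` a flag that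
is `1` for a finite entry and `0` for `-∞`. The entries `V[i,j,k]` are stored likewise in the arrays
`4` and `3`, with flag `0` for `+∞`. -/
def HoldsTables {n : ℕ} (p : Fin n → ℝ × ℝ) (w : Fin n → ℝ) (s : State) : Prop :=
  (s.rvar 1, s.rvar 2) ≠ (0, 0) ∧
  ((∀ i j, i ≠ j → (p i).1 ≠ (p j).1) → (s.rvar 1, s.rvar 2) = (1, 0)) ∧
  ∃ σ : Equiv.Perm (Fin n),
    (∀ t : Fin n, s.iarr 1 t = σ t) ∧
    StrictMono (fun t => (rotate (s.rvar 1) (s.rvar 2) (p (σ t))).1) ∧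
    ∀ i j k : Fin n, i < j → j ≤ k →
      ((s.iarr 2 ((i * n + j) * n + k) = 1 ∧
          tableC (fun t => rotate (s.rvar 1) (s.rvar 2) (p (σ t))) (fun t => w (σ t)) i j k
            = (s.rarr 3 ((i * n + j) * n + k) : ℝ)) ∨
        (s.iarr 2 ((i * n + j) * n + k) = 0 ∧
          tableC (fun t => rotate (s.rvar 1) (s.rvar 2) (p (σ t))) (fun t => w (σ t)) i j k = ⊥)) ∧
      ((s.iarr 3 ((i * n + j) * n + k) = 1 ∧
          tableV (fun t => rotate (s.rvar 1) (s.rvar 2) (p (σ t))) (fun t => w (σ t)) i j k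
            = (s.rarr 4 ((i * n + j) * n + k) : ℝ)) ∨
        (s.iarr 3 ((i * n + j) * n + k) = 0 ∧
          tableV (fun t => rotate (s.rvar 1) (s.rvar 2) (p (σ t))) (fun t => w (σ t)) i j k = ⊤))

end MWCP

namespace MWCP

/-! ## Edges and slopes of paths -/

section Geometry

variable {n : ℕ} {q : Fin n → ℝ × ℝ} {w : Fin n → ℝ}

/-! Geometry. For vectors pointing to the right, `0 ≤ cross u v` says that the slope of `u` is at
most the slope of `v`, so concavity of a triple compares two consecutive slopes. Along a concave
path the slopes decrease; hence every vertex lies on or below the line through every edge, and the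
region under the path is an intersection of half-planes with a vertical strip
(`IsConcave.under_iff`). A concave path never goes below the chord of its ends and a convex one
never above it. Therefore any concave path and any convex path with the same ends bound a polygon
(`hull_eq_region`), and a point of the strip strictly below the convex path is automatically under
the concave one. Counting points under the first path and subtracting those strictly below the
second gives the weight of the polygon (`weight_hull_eq`). Conversely, gift wrapping with ties
resolved towards the farthest point yields upper and lower hulls with strict turns, whose vertices
are the extreme points (`exists_decomposition`). Since the two paths can be chosen independently,
the maximum over polygons splits into a maximum minus a minimum (`tableM_eq`). An arbitrary polytope
may be replaced by the hull of the input points it contains (`weight_eq_zero_or`).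

Tables. Removing the first edge of a path gives a recurrence for the sets of attainable values
(`mem_pathValues_iff`); these sets are finite, so extrema are attained. Convex paths become concave
after a reflection in the first axis and minima become maxima after negation, so one theory and one
program serve both tables. Around a point, clockwise order on the right side is order by decreasing
slope, so the points compatible with an incoming edge form a suffix (`concaveTriple_iff_mem_drop`);
as the incoming edge turns clockwise its slope falls and the suffix shrinks (`fcConcave_mono`).

Running time. The program is written in a language whose loops all run over `0, …, n - 1`. The time
is then bounded by a polynomial whose degree is the nesting depth. A stored word exceeds the words
already present by at most one, so words are bounded by the input size plus the time, and addresses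
by a polynomial in that (`SProg.exec_of_depth_le`). Correctness is shown for the functional
semantics `SProg.run`, by loop invariants together with the frame property that untouched memory is
unchanged. The recurrence alone would cost a fourth power; for fixed `j` and `k` one pass computes
all suffix maxima and a second pass fills the entries for all `i`, which leaves depth three. Depth
three also leaves room for finding each first compatible position by a separate linear count and for
sorting by counting predecessors, so the monotonicity of the pointer is a statement about the lists
that the program does not rely on. Optimal paths are recovered from the tables by looking for an
entry where the recurrence holds with equality. -/

theorem cross_sub_swap (a b d : ℝ × ℝ) : cross (d - a) (b - a) = cross (d - b) (b - a) := by
  simp only [cross, Prod.fst_sub, Prod.snd_sub]; ring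

/-- Transitivity of the comparison of slopes, in division-free form. -/
theorem cross_trans {u v z : ℝ × ℝ} (hu : 0 < u.1) (hv : 0 < v.1) (hz : 0 < z.1)
    (h₁ : 0 ≤ cross u v) (h₂ : 0 ≤ cross v z) : 0 ≤ cross u z := by
  have h : v.1 * cross u z = u.1 * cross v z + z.1 * cross u v := by simp only [cross]; ring
  have : 0 ≤ v.1 * cross u z := by rw [h]; positivity
  exact nonneg_of_mul_nonneg_right this hv

/-- Edges are encoded as infixes of length two; this equivalence lets statements about edges follow
the recursion on the list. -/
theorem edge_cons_cons {α : Type*} {u v a b : α} {l : List α} :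
    [u, v] <:+: a :: b :: l ↔ (u = a ∧ v = b) ∨ [u, v] <:+: b :: l := by
  rw [List.infix_cons_iff]
  simp

theorem not_edge_singleton {α : Type*} {u v a : α} : ¬ [u, v] <:+: [a] := by
  intro h
  simpa using h.length_le

theorem edge_mem {α : Type*} {u v : α} {l : List α} (h : [u, v] <:+: l) : u ∈ l ∧ v ∈ l :=
  ⟨h.subset (by simp), h.subset (by simp)⟩

theorem edge_lt {u v : Fin n} {c : List (Fin n)} (hc : c.IsChain (· < ·))
    (h : [u, v] <:+: c) : u < v := by
  have := hc.infix h
  simpa using this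

/-- No vertex of a path lies strictly between the ends of an edge. -/
theorem edge_not_between {u v t : Fin n} {c : List (Fin n)} (hc : c.IsChain (· < ·))
    (h : [u, v] <:+: c) (ht : t ∈ c) : t ≤ u ∨ v ≤ t := by
  have hp := List.isChain_iff_pairwise.1 hc
  obtain ⟨l₁, l₂, rfl⟩ := h
  simp only [List.mem_append, List.mem_cons, List.not_mem_nil, or_false] at ht
  rw [List.pairwise_append, List.pairwise_append] at hp
  rcases ht with (ht | rfl | rfl) | ht
  · exact Or.inl (hp.1.2.2 t ht u (by simp)).le
  · exact Or.inl le_rfl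
  · exact Or.inr le_rfl
  · exact Or.inr (hp.2.2 v (by simp) t ht).le

theorem IsPath.mem_le {i k t : Fin n} {c : List (Fin n)} (hc : IsPath i k c) (ht : t ∈ c) :
    i ≤ t ∧ t ≤ k := by
  obtain ⟨h₁, h₂, h₃⟩ := hc
  have hp := List.isChain_iff_pairwise.1 h₃
  constructor
  · cases c with
    | nil => simp at ht
    | cons a l =>
      simp only [List.head?_cons, Option.some.injEq] at h₁
      subst h₁
      rcases List.mem_cons.1 ht with rfl | h
      · exact le_rfl
      · exact (List.rel_of_pairwise_cons hp h).le
  · obtain ⟨l, rfl⟩ := List.getLast?_eq_some_iff.1 h₂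
    rcases List.mem_append.1 ht with h | h
    · exact ((List.pairwise_append.1 hp).2.2 t h k (by simp)).le
    · simp at h; exact h.le

theorem IsPath.left_mem {i k : Fin n} {c : List (Fin n)} (hc : IsPath i k c) : i ∈ c :=
  List.mem_of_head? hc.1

theorem IsPath.right_mem {i k : Fin n} {c : List (Fin n)} (hc : IsPath i k c) : k ∈ c :=
  List.mem_of_getLast? hc.2.1

theorem IsPath.tail {i k a b : Fin n} {l : List (Fin n)} (hc : IsPath i k (a :: b :: l)) :
    IsPath b k (b :: l) :=
  ⟨rfl, by simpa [List.getLast?_cons_cons] using hc.2.1, hc.2.2.tail⟩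

theorem IsPath.head_eq {i k a : Fin n} {l : List (Fin n)} (hc : IsPath i k (a :: l)) : a = i := by
  simpa using hc.1

theorem IsPath.cons {i j k : Fin n} {l : List (Fin n)} (hij : i < j) (hc : IsPath j k (j :: l)) :
    IsPath i k (i :: j :: l) :=
  ⟨rfl, by simpa [List.getLast?_cons_cons] using hc.2.1, List.IsChain.cons_cons hij hc.2.2⟩

theorem IsPath.exists_cons_cons {i k : Fin n} {c : List (Fin n)} (hik : i < k)
    (hc : IsPath i k c) : ∃ j l, c = i :: j :: l := by
  match c, hc with
  | [], hc => simp [IsPath] at hc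
  | [a], hc =>
    obtain ⟨h₁, h₂, -⟩ := hc
    simp at h₁ h₂
    omega
  | a :: b :: l, hc => exact ⟨b, l, by rw [hc.head_eq]⟩

/-- Every point in the range of a path lies over an edge. -/
theorem IsPath.exists_edge (hx : StrictMono fun t => (q t).1) {x : ℝ} :
    ∀ {c : List (Fin n)} {i k : Fin n}, i < k → IsPath i k c → (q i).1 ≤ x → x ≤ (q k).1 →
      ∃ u v, [u, v] <:+: c ∧ (q u).1 ≤ x ∧ x ≤ (q v).1
  | [], i, k, _, hc, _, _ => by simp [IsPath] at hc
  | [a], i, k, hik, hc, _, _ => by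
    obtain ⟨j, l, h⟩ := hc.exists_cons_cons hik
    simp at h
  | a :: b :: l, i, k, hik, hc, h₁, h₂ => by
    obtain rfl := hc.head_eq
    rcases le_total x (q b).1 with h | h
    · exact ⟨a, b, edge_cons_cons.2 (Or.inl ⟨rfl, rfl⟩), h₁, h⟩
    · rcases (hc.tail.mem_le hc.tail.left_mem).2.lt_or_eq with hbk | rfl
      · obtain ⟨u, v, huv, h₃, h₄⟩ := IsPath.exists_edge hx hbk hc.tail h h₂
        exact ⟨u, v, edge_cons_cons.2 (Or.inr huv), h₃, h₄⟩
      · exact ⟨a, b, edge_cons_cons.2 (Or.inl ⟨rfl, rfl⟩), h₁, h₂⟩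

theorem concaveTriple_iff {a b d : Fin n} :
    ConcaveTriple q a b d ↔ 0 ≤ cross (q d - q b) (q b - q a) := by
  rw [ConcaveTriple, cross_sub_swap]

theorem IsConcave.tail {a b : Fin n} {l : List (Fin n)} (h : IsConcave q (a :: b :: l)) :
    IsConcave q (b :: l) := by
  cases l with
  | nil => trivial
  | cons d l => exact h.2

/-- The slopes of a concave path decrease. -/
theorem IsConcave.cross_edge_first (hx : StrictMono fun t => (q t).1) {u v : Fin n} :
    ∀ {l : List (Fin n)} {a b : Fin n}, (a :: b :: l).IsChain (· < ·) → IsConcave q (a :: b :: l) →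
      [u, v] <:+: b :: l → 0 ≤ cross (q v - q u) (q b - q a)
  | [], _, _, _, _, h => (not_edge_singleton h).elim
  | d :: l, a, b, hl, hc, h => by
    have hab : a < b := by simpa using hl.rel
    have hbd : b < d := by simpa using hl.tail.rel
    have h₁ : 0 ≤ cross (q d - q b) (q b - q a) := concaveTriple_iff.1 hc.1
    rcases edge_cons_cons.1 h with ⟨rfl, rfl⟩ | h'
    · exact h₁
    · exact cross_trans (by simpa using hx (edge_lt hl.tail.tail h')) (by simpa using hx hbd)
        (by simpa using hx hab) (cross_edge_first hx hl.tail hc.tail h') h₁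

/-- The vector from `b` to `t` is a sum of later edges, each of slope at most that of the first
edge, and `cross` is additive. -/
theorem IsConcave.cross_vertex_first (hx : StrictMono fun t => (q t).1) {t : Fin n} :
    ∀ {l : List (Fin n)} {a b : Fin n}, (a :: b :: l).IsChain (· < ·) → IsConcave q (a :: b :: l) →
      t ∈ l → 0 ≤ cross (q t - q b) (q b - q a)
  | d :: l, a, b, hl, hc, h => by
    have hab : a < b := by simpa using hl.rel
    have hbd : b < d := by simpa using hl.tail.rel
    have h₁ : 0 ≤ cross (q d - q b) (q b - q a) := concaveTriple_iff.1 hc.1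
    rcases List.mem_cons.1 h with rfl | h'
    · exact h₁
    · have hdt : d < t :=
        List.rel_of_pairwise_cons (List.isChain_iff_pairwise.1 hl.tail.tail) h'
      have h₂ := cross_trans (by simpa using hx hdt) (by simpa using hx hbd)
        (by simpa using hx hab) (cross_vertex_first hx hl.tail hc.tail h') h₁
      have : cross (q t - q b) (q b - q a)
          = cross (q t - q d) (q b - q a) + cross (q d - q b) (q b - q a) := by
        simp only [cross, Prod.fst_sub, Prod.snd_sub]; ring
      rw [this]; exact add_nonneg h₂ h₁

/-- Every vertex of a concave path lies below the line through each edge. -/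
theorem IsConcave.cross_vertex (hx : StrictMono fun t => (q t).1) {u v t : Fin n} :
    ∀ {c : List (Fin n)}, c.IsChain (· < ·) → IsConcave q c → [u, v] <:+: c → t ∈ c →
      0 ≤ cross (q t - q u) (q v - q u)
  | [], _, _, h, _ => by simp at h
  | [a], _, _, h, _ => (not_edge_singleton h).elim
  | a :: b :: l, hl, hc, h, ht => by
    rcases edge_cons_cons.1 h with ⟨rfl, rfl⟩ | h'
    · rcases List.mem_cons.1 ht with rfl | ht
      · simp [cross]
      · rw [cross_sub_swap]
        rcases List.mem_cons.1 ht with rfl | ht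
        · simp [cross]
        · exact hc.cross_vertex_first hx hl ht
    · rcases List.mem_cons.1 ht with rfl | ht
      -- The vertex precedes the edge: its position relative to the line differs from that of `b` by
      -- the cross product of the edge with the first edge, which is nonnegative since slopes
      -- decrease.
      · have h₁ := IsConcave.cross_vertex hx hl.tail hc.tail h' (t := b) (by simp)
        have h₂ := hc.cross_edge_first hx hl h'
        have : cross (q t - q u) (q v - q u)
            = cross (q b - q u) (q v - q u) + cross (q v - q u) (q b - q t) := by
          simp only [cross, Prod.fst_sub, Prod.snd_sub]; ring
        rw [this]; exact add_nonneg h₁ h₂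
      · exact IsConcave.cross_vertex hx hl.tail hc.tail h' ht

/-- A point below a segment whose ends lie below a line lies below the line. -/
theorem cross_nonneg_of_under {a b u v z : ℝ × ℝ} (huv : u.1 < v.1) (hab : a.1 < b.1)
    (hu : 0 ≤ cross (u - a) (b - a)) (hv : 0 ≤ cross (v - a) (b - a))
    (h₁ : u.1 ≤ z.1) (h₂ : z.1 ≤ v.1) (hz : 0 ≤ cross (z - u) (v - u)) :
    0 ≤ cross (z - a) (b - a) := by
  -- The first two summands interpolate between the ends of the segment; the third is the vertical
  -- gap between `z` and the segment.
  have h : (v.1 - u.1) * cross (z - a) (b - a) = (v.1 - z.1) * cross (u - a) (b - a)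
      + (z.1 - u.1) * cross (v - a) (b - a) + (b.1 - a.1) * cross (z - u) (v - u) := by
    simp only [cross, Prod.fst_sub, Prod.snd_sub]; ring
  have h₃ : 0 ≤ (v.1 - u.1) * cross (z - a) (b - a) := by
    rw [h]
    have := mul_nonneg (sub_nonneg.2 h₂) hu
    have := mul_nonneg (sub_nonneg.2 h₁) hv
    have := mul_nonneg (sub_nonneg.2 hab.le) hz
    linarith
  exact nonneg_of_mul_nonneg_right h₃ (sub_pos.2 huv)

/-- Being under one edge is the same as being under the lines of all edges, because the ends of that
edge lie below all these lines. The existential definition of `Under` thereby becomes an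
intersection of half-planes. -/
theorem IsConcave.under_iff (hx : StrictMono fun t => (q t).1) {i k : Fin n} {c : List (Fin n)}
    (hik : i < k) (hp : IsPath i k c) (hc : IsConcave q c) (z : ℝ × ℝ) :
    Under q c z ↔ (q i).1 ≤ z.1 ∧ z.1 ≤ (q k).1 ∧
      ∀ u v, [u, v] <:+: c → 0 ≤ cross (z - q u) (q v - q u) := by
  constructor
  · rintro ⟨u, v, h, h₁, h₂, h₃⟩
    have hu := hp.mem_le (edge_mem h).1
    have hv := hp.mem_le (edge_mem h).2
    refine ⟨(hx.monotone hu.1).trans h₁, h₂.trans (hx.monotone hv.2), fun a b hab => ?_⟩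
    exact cross_nonneg_of_under (hx (edge_lt hp.2.2 h)) (hx (edge_lt hp.2.2 hab))
      (hc.cross_vertex hx hp.2.2 hab (edge_mem h).1) (hc.cross_vertex hx hp.2.2 hab (edge_mem h).2)
      h₁ h₂ h₃
  · rintro ⟨h₁, h₂, h₃⟩
    obtain ⟨u, v, h, h₄, h₅⟩ := hp.exists_edge hx hik h₁ h₂
    exact ⟨u, v, h, h₄, h₅, h₃ u v h⟩

/-! ## Reflection in the first axis -/

/-- Reflection in the first axis. -/
def flip (z : ℝ × ℝ) : ℝ × ℝ := (z.1, -z.2)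

@[simp] theorem flip_fst (z : ℝ × ℝ) : (flip z).1 = z.1 := rfl
@[simp] theorem flip_snd (z : ℝ × ℝ) : (flip z).2 = -z.2 := rfl

/-- Reflection reverses orientation; every statement about convex paths is drawn from its concave
counterpart through this sign change. -/
theorem cross_flip (a b d e : ℝ × ℝ) :
    cross (flip a - flip b) (flip d - flip e) = - cross (a - b) (d - e) := by
  simp only [cross, flip, Prod.fst_sub, Prod.snd_sub]; ring

theorem convexTriple_iff_flip {a b d : Fin n} :
    ConvexTriple q a b d ↔ ConcaveTriple (fun t => flip (q t)) a b d := by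
  rw [ConvexTriple, ConcaveTriple, cross_flip, neg_nonneg]

theorem isConvex_iff_flip : ∀ {c : List (Fin n)},
    IsConvex q c ↔ IsConcave (fun t => flip (q t)) c
  | [] => Iff.rfl
  | [_] => Iff.rfl
  | [_, _] => Iff.rfl
  | a :: b :: d :: l => by
    rw [IsConvex, IsConcave, convexTriple_iff_flip, isConvex_iff_flip]

theorem above_iff_flip {c : List (Fin n)} {z : ℝ × ℝ} :
    Above q c z ↔ Under (fun t => flip (q t)) c (flip z) := by
  simp only [Above, Under, cross_flip, neg_nonneg, flip_fst]

theorem IsConvex.above_iff (hx : StrictMono fun t => (q t).1) {i k : Fin n} {c : List (Fin n)}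
    (hik : i < k) (hp : IsPath i k c) (hc : IsConvex q c) (z : ℝ × ℝ) :
    Above q c z ↔ (q i).1 ≤ z.1 ∧ z.1 ≤ (q k).1 ∧
      ∀ u v, [u, v] <:+: c → cross (z - q u) (q v - q u) ≤ 0 := by
  rw [above_iff_flip, (isConvex_iff_flip.1 hc).under_iff (q := fun t => flip (q t)) hx hik hp]
  simp only [cross_flip, neg_nonneg, flip_fst]

/-! ## The region between a concave and a convex path -/

/-- The vertices of a concave path lie on or above the chord. -/
theorem IsConcave.cross_chord (hx : StrictMono fun t => (q t).1) {t : Fin n} :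
    ∀ {c : List (Fin n)} {i k : Fin n}, IsPath i k c → IsConcave q c → t ∈ c →
      cross (q t - q i) (q k - q i) ≤ 0
  | [], _, _, _, _, h => by simp at h
  | [a], i, k, hp, _, h => by
    simp at h
    subst h
    rw [hp.head_eq]
    simp [cross]
  | a :: b :: l, i, k, hp, hc, ht => by
    obtain rfl := hp.head_eq
    rcases List.mem_cons.1 ht with rfl | ht
    · simp [cross]
    have hab : a < b := by simpa using hp.2.2.rel
    have hbt := (hp.tail.mem_le ht)
    have hk := hc.cross_vertex hx hp.2.2 (edge_cons_cons.2 (Or.inl ⟨rfl, rfl⟩)) hp.right_mem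
    have h₁ := IsConcave.cross_chord hx hp.tail hc.tail ht
    rw [cross_sub_swap] at hk
    rcases (hbt.1.trans hbt.2).lt_or_eq with hbk | rfl
    -- Passing from the chord of `b`, `k` to the chord of `a`, `k` changes the height over the chord
    -- by a multiple of the turn at `b`, weighted by the distance from `t` to `k`.
    · have h : ((q k).1 - (q b).1) * cross (q t - q a) (q k - q a)
          = ((q k).1 - (q a).1) * cross (q t - q b) (q k - q b)
            - ((q k).1 - (q t).1) * cross (q k - q b) (q b - q a) := by
        simp only [cross, Prod.fst_sub, Prod.snd_sub]; ring
      have h₂ : ((q k).1 - (q b).1) * cross (q t - q a) (q k - q a) ≤ 0 := by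
        rw [h]
        have := mul_nonneg (sub_nonneg.2 (hx.monotone hbt.2)) hk
        have := mul_nonpos_of_nonneg_of_nonpos (sub_nonneg.2 (hx.monotone (hab.trans hbk).le)) h₁
        linarith
      exact nonpos_of_mul_nonpos_right h₂ (by simpa using hx hbk)
    · obtain rfl : b = t := le_antisymm hbt.1 hbt.2
      simp only [cross]; linarith

theorem IsConvex.cross_chord (hx : StrictMono fun t => (q t).1) {t : Fin n} {c : List (Fin n)}
    {i k : Fin n} (hp : IsPath i k c) (hc : IsConvex q c) (ht : t ∈ c) :
    0 ≤ cross (q t - q i) (q k - q i) := by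
  have := (isConvex_iff_flip.1 hc).cross_chord (q := fun t => flip (q t)) hx hp ht
  simpa only [cross_flip, neg_nonpos] using this

/-- What lies on or below the chord lies under a concave path. -/
theorem IsConcave.under_of_chord (hx : StrictMono fun t => (q t).1) {c : List (Fin n)}
    {i k : Fin n} (hik : i < k) (hp : IsPath i k c) (hc : IsConcave q c) {z : ℝ × ℝ}
    (h₁ : (q i).1 ≤ z.1) (h₂ : z.1 ≤ (q k).1) (h : 0 ≤ cross (z - q i) (q k - q i)) :
    Under q c z := by
  rw [hc.under_iff hx hik hp]
  exact ⟨h₁, h₂, fun u v huv => cross_nonneg_of_under (hx hik) (hx (edge_lt hp.2.2 huv))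
    (hc.cross_vertex hx hp.2.2 huv hp.left_mem) (hc.cross_vertex hx hp.2.2 huv hp.right_mem)
    h₁ h₂ h⟩

theorem IsConvex.above_of_chord (hx : StrictMono fun t => (q t).1) {c : List (Fin n)}
    {i k : Fin n} (hik : i < k) (hp : IsPath i k c) (hc : IsConvex q c) {z : ℝ × ℝ}
    (h₁ : (q i).1 ≤ z.1) (h₂ : z.1 ≤ (q k).1) (h : cross (z - q i) (q k - q i) ≤ 0) :
    Above q c z := by
  rw [above_iff_flip]
  exact (isConvex_iff_flip.1 hc).under_of_chord (q := fun t => flip (q t)) hx hik hp h₁ h₂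
    (by rwa [cross_flip, neg_nonneg])

/-- A point strictly below a convex path lies below the chord. -/
theorem IsConvex.cross_chord_of_not_above (hx : StrictMono fun t => (q t).1) {c : List (Fin n)}
    {i k : Fin n} (hik : i < k) (hp : IsPath i k c) (hc : IsConvex q c) {z : ℝ × ℝ}
    (h₁ : (q i).1 ≤ z.1) (h₂ : z.1 ≤ (q k).1) (h : ¬ Above q c z) :
    0 ≤ cross (z - q i) (q k - q i) := by
  by_contra h'
  exact h (hc.above_of_chord hx hik hp h₁ h₂ (not_le.1 h').le)

theorem IsConcave.convex_under (hx : StrictMono fun t => (q t).1) {c : List (Fin n)}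
    {i k : Fin n} (hik : i < k) (hp : IsPath i k c) (hc : IsConcave q c) :
    Convex ℝ {z | Under q c z} := by
  simp only [hc.under_iff hx hik hp, Set.ofPred_and, Set.ofPred_forall]
  have key : ∀ f : ℝ × ℝ → ℝ, ∀ r, IsLinearMap ℝ f → Convex ℝ {z | r ≤ f z} :=
    fun f r hf => convex_halfSpace_ge hf r
  refine ((key (fun z => z.1) _ ⟨fun _ _ => rfl, fun _ _ => rfl⟩).inter
    (convex_halfSpace_le (f := fun z : ℝ × ℝ => z.1) ⟨fun _ _ => rfl, fun _ _ => rfl⟩ _)).inter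
      ?_ |> fun h => by simpa only [Set.inter_assoc] using h
  refine convex_iInter fun u => convex_iInter fun v => convex_iInter fun _ => ?_
  -- The condition is affine in `z`; moving the constant to the other side makes it a half-space of
  -- a linear functional.
  have := key (fun z => cross z (q v - q u)) (cross (q u) (q v - q u))
    ⟨fun a b => by simp only [cross, Prod.fst_add, Prod.snd_add]; ring,
      fun a b => by simp only [cross, Prod.smul_fst, Prod.smul_snd, smul_eq_mul]; ring⟩
  have e : {z : ℝ × ℝ | 0 ≤ cross (z - q u) (q v - q u)}
      = {z | cross (q u) (q v - q u) ≤ cross z (q v - q u)} := by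
    ext z
    simp only [cross, Prod.fst_sub, Prod.snd_sub, Set.mem_ofPred_eq]
    constructor <;> intro h <;> linarith
  rwa [e]

theorem IsConvex.convex_above (hx : StrictMono fun t => (q t).1) {c : List (Fin n)}
    {i k : Fin n} (hik : i < k) (hp : IsPath i k c) (hc : IsConvex q c) :
    Convex ℝ {z | Above q c z} := by
  have := (isConvex_iff_flip.1 hc).convex_under (q := fun t => flip (q t)) hx hik hp
  have h := this.is_linear_preimage (f := flip)
    ⟨fun a b => by ext <;> simp; ring, fun r a => by ext <;> simp⟩
  exact (Set.ext fun z => above_iff_flip.symm : _ = {z | Above q c z}) ▸ h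

/-- The point of a segment over a given abscissa. -/
theorem exists_mem_segment {u v : ℝ × ℝ} {x : ℝ} (huv : u.1 < v.1) (h₁ : u.1 ≤ x)
    (h₂ : x ≤ v.1) : ∃ y, (x, y) ∈ segment ℝ u v ∧ ∀ y', cross ((x, y') - u) (v - u)
      = (v.1 - u.1) * (y - y') := by
  have h := sub_pos.2 huv
  refine ⟨u.2 + (x - u.1) / (v.1 - u.1) * (v.2 - u.2), ?_, fun y' => ?_⟩
  · rw [segment_eq_image']
    refine ⟨(x - u.1) / (v.1 - u.1), ⟨div_nonneg (by linarith) h.le, ?_⟩, ?_⟩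
    · rw [div_le_one h]; linarith
    · ext
      · simp; field_simp; ring
      · simp
  · simp only [cross, Prod.fst_sub, Prod.snd_sub]
    field_simp
    ring

theorem mem_vertical_segment {x y a b : ℝ} (h₁ : a ≤ y) (h₂ : y ≤ b) :
    (x, y) ∈ segment ℝ ((x, a) : ℝ × ℝ) (x, b) := by
  rcases (h₁.trans h₂).eq_or_lt with rfl | hab
  · obtain rfl := le_antisymm h₁ h₂
    simp
  · rw [segment_eq_image']
    have := sub_pos.2 hab
    refine ⟨(y - a) / (b - a), ⟨div_nonneg (by linarith) this.le, ?_⟩, ?_⟩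
    · rw [div_le_one this]; linarith
    · ext
      · simp
      · simp; field_simp; ring

/-- A vertex whose abscissa lies over an edge must be one of the two ends of that edge, since the
path runs from left to right. -/
theorem under_of_mem (hx : StrictMono fun t => (q t).1) {c : List (Fin n)} {i k t : Fin n}
    (hik : i < k) (hp : IsPath i k c) (ht : t ∈ c) : Under q c (q t) := by
  obtain ⟨u, v, h, h₁, h₂⟩ := hp.exists_edge hx hik (hx.monotone (hp.mem_le ht).1)
    (hx.monotone (hp.mem_le ht).2)
  refine ⟨u, v, h, h₁, h₂, ?_⟩
  rcases edge_not_between hp.2.2 h ht with h' | h'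
  · obtain rfl := le_antisymm h' (hx.le_iff_le.1 h₁)
    simp [cross]
  · obtain rfl := le_antisymm h' (hx.le_iff_le.1 h₂)
    simp only [cross]; linarith

theorem above_of_mem (hx : StrictMono fun t => (q t).1) {c : List (Fin n)} {i k t : Fin n}
    (hik : i < k) (hp : IsPath i k c) (ht : t ∈ c) : Above q c (q t) :=
  above_iff_flip.2 (under_of_mem (q := fun t => flip (q t)) hx hik hp ht)

/-- The region is convex, and the chord separates the two paths, so the vertices of each path
satisfy the condition for the other one. Conversely, the vertical line through a point of the region
meets an edge of each path; both meeting points are in the hull and the given point lies between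
them. -/
theorem hull_eq_region (hx : StrictMono fun t => (q t).1) {i k : Fin n} {c v : List (Fin n)}
    (hik : i < k) (hp : IsPath i k c) (hc : IsConcave q c) (hp' : IsPath i k v)
    (hv : IsConvex q v) :
    hull q {t | t ∈ c ∨ t ∈ v} = {z | Under q c z ∧ Above q v z} := by
  apply Set.Subset.antisymm
  · refine convexHull_min ?_ ((hc.convex_under hx hik hp).inter (hv.convex_above hx hik hp'))
    rintro _ ⟨t, ht | ht, rfl⟩
    · have := hp.mem_le ht
      exact ⟨under_of_mem hx hik hp ht, hv.above_of_chord hx hik hp' (hx.monotone this.1)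
        (hx.monotone this.2) (hc.cross_chord hx hp ht)⟩
    · have := hp'.mem_le ht
      exact ⟨hc.under_of_chord hx hik hp (hx.monotone this.1)
        (hx.monotone this.2) (hv.cross_chord hx hp' ht), above_of_mem hx hik hp' ht⟩
  · rintro ⟨x, y⟩ ⟨⟨u, u', hu, h₁, h₂, h₃⟩, ⟨a, a', ha, h₄, h₅, h₆⟩⟩
    have huu := hx (edge_lt hp.2.2 hu)
    have haa := hx (edge_lt hp'.2.2 ha)
    obtain ⟨y₁, hy₁, e₁⟩ := exists_mem_segment huu h₁ h₂
    obtain ⟨y₂, hy₂, e₂⟩ := exists_mem_segment haa h₄ h₅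
    rw [e₁] at h₃
    rw [e₂] at h₆
    have l₁ : y ≤ y₁ := sub_nonneg.1 (nonneg_of_mul_nonneg_right h₃ (sub_pos.2 huu))
    have l₂ : y₂ ≤ y := sub_nonpos.1 (nonpos_of_mul_nonpos_right h₆ (sub_pos.2 haa))
    have hcv := convex_convexHull ℝ (q '' {t | t ∈ c ∨ t ∈ v})
    have hm : ∀ t, (t ∈ c ∨ t ∈ v) → q t ∈ convexHull ℝ (q '' {t | t ∈ c ∨ t ∈ v}) :=
      fun t ht => subset_convexHull ℝ _ ⟨t, ht, rfl⟩
    exact hcv.segment_subset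
      (hcv.segment_subset (hm _ (Or.inr (edge_mem ha).1)) (hm _ (Or.inr (edge_mem ha).2)) hy₂)
      (hcv.segment_subset (hm _ (Or.inl (edge_mem hu).1)) (hm _ (Or.inl (edge_mem hu).2)) hy₁)
      (mem_vertical_segment l₂ l₁)

end Geometry


/-! ## Weights of paths and polygons -/

section Weights

variable {n : ℕ} {q : Fin n → ℝ × ℝ} {w : Fin n → ℝ}

open Classical in
-- The edges of a left-to-right path span disjoint open intervals of indices, so no point is counted
-- twice. The predicate `Q` is left free in order to serve both kinds of edge weight.
theorem edgeSum_eq_sum (Q : Fin n → Fin n → Fin n → Prop) : ∀ {c : List (Fin n)},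
    c.IsChain (· < ·) →
    edgeSum (fun i j => ∑ t ∈ (Finset.Ioo i j).filter (Q i j), w t) c =
      ∑ t ∈ Finset.univ.filter (fun t => ∃ u v, [u, v] <:+: c ∧ u < t ∧ t < v ∧ Q u v t), w t
  | [], _ => by simp [edgeSum]
  | [a], _ => by simp [edgeSum, not_edge_singleton]
  | a :: b :: l, hc => by
    rw [edgeSum, edgeSum_eq_sum (c := b :: l) Q hc.tail, ← Finset.sum_union]
    · congr 1
      ext t
      simp only [Finset.mem_union, Finset.mem_filter, Finset.mem_Ioo, Finset.mem_univ, true_and,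
        edge_cons_cons]
      constructor
      · rintro (⟨⟨h₁, h₂⟩, h₃⟩ | ⟨u, v, h, h'⟩)
        · exact ⟨a, b, Or.inl ⟨rfl, rfl⟩, h₁, h₂, h₃⟩
        · exact ⟨u, v, Or.inr h, h'⟩
      · rintro ⟨u, v, ⟨rfl, rfl⟩ | h, h₁, h₂, h₃⟩
        · exact Or.inl ⟨⟨h₁, h₂⟩, h₃⟩
        · exact Or.inr ⟨u, v, h, h₁, h₂, h₃⟩
    · rw [Finset.disjoint_left]
      simp only [Finset.mem_filter, Finset.mem_Ioo, Finset.mem_univ, true_and]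
      rintro t ⟨⟨-, h⟩, -⟩ ⟨u, v, huv, hu, -⟩
      have hbu : b ≤ u := by
        rcases List.mem_cons.1 (edge_mem huv).1 with rfl | h
        · exact le_rfl
        · exact (List.rel_of_pairwise_cons (List.isChain_iff_pairwise.1 hc.tail) h).le
      exact absurd (hbu.trans_lt hu) h.asymm

open Classical in
-- Edge weights omit the ends of the edges; adding every vertex once makes the count of the points
-- under the path exact.
theorem pathWeight_eq_sum (hx : StrictMono fun t => (q t).1) {i k : Fin n} {c : List (Fin n)}
    (hik : i < k) (hp : IsPath i k c) :
    pathWeight q w c = ∑ t ∈ Finset.univ.filter (fun t => Under q c (q t)), w t := by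
  have hpw := List.isChain_iff_pairwise.1 hp.2.2
  have hnd : c.Nodup := hpw.imp fun h => h.ne
  have h₀ : upperEdge q w = fun i j => ∑ t ∈ (Finset.Ioo i j).filter
      (fun t => 0 ≤ cross (q t - q i) (q j - q i)), w t := rfl
  rw [pathWeight, h₀, edgeSum_eq_sum (fun i j t => 0 ≤ cross (q t - q i) (q j - q i)) hp.2.2,
    ← List.sum_toFinset w hnd, ← Finset.sum_union]
  · congr 1
    ext t
    simp only [Finset.mem_union, Finset.mem_filter, Finset.mem_univ, true_and, List.mem_toFinset]
    constructor
    · rintro (⟨u, v, h, h₁, h₂, h₃⟩ | h)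
      · exact ⟨u, v, h, (hx h₁).le, (hx h₂).le, h₃⟩
      · exact under_of_mem hx hik hp h
    · rintro ⟨u, v, h, h₁, h₂, h₃⟩
      rcases (hx.le_iff_le.1 h₁).eq_or_lt with rfl | h₁
      · exact Or.inr (edge_mem h).1
      rcases (hx.le_iff_le.1 h₂).eq_or_lt with rfl | h₂
      · exact Or.inr (edge_mem h).2
      · exact Or.inl ⟨u, v, h, h₁, h₂, h₃⟩
  · rw [Finset.disjoint_left]
    simp only [Finset.mem_filter, Finset.mem_univ, true_and, List.mem_toFinset]
    rintro t ⟨u, v, h, h₁, h₂, -⟩ ht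
    rcases edge_not_between hp.2.2 h ht with h' | h'
    · exact absurd h₁ h'.not_gt
    · exact absurd h₂ h'.not_gt

open Classical in
-- No vertex term is needed since vertices are on the path and hence not strictly below it. The
-- range is restricted to `Icc i k` because `Above` also fails outside the vertical strip.
theorem pathSubweight_eq_sum (hx : StrictMono fun t => (q t).1) {i k : Fin n} {v : List (Fin n)}
    (hik : i < k) (hp : IsPath i k v) (hv : IsConvex q v) :
    pathSubweight q w v =
      ∑ t ∈ (Finset.Icc i k).filter (fun t => ¬ Above q v (q t)), w t := by
  have h₀ : lowerEdge q w = fun i j => ∑ t ∈ (Finset.Ioo i j).filter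
      (fun t => 0 < cross (q t - q i) (q j - q i)), w t := rfl
  rw [pathSubweight, h₀, edgeSum_eq_sum (fun i j t => 0 < cross (q t - q i) (q j - q i)) hp.2.2]
  congr 1
  ext t
  simp only [Finset.mem_filter, Finset.mem_univ, true_and, Finset.mem_Icc]
  constructor
  · rintro ⟨u, u', h, h₁, h₂, h₃⟩
    have h₄ := (hp.mem_le (edge_mem h).1).1.trans h₁.le
    have h₅ := h₂.le.trans (hp.mem_le (edge_mem h).2).2
    refine ⟨⟨h₄, h₅⟩, fun h' => ?_⟩
    exact absurd (((hv.above_iff hx hik hp _).1 h').2.2 u u' h) h₃.not_ge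
  · rintro ⟨⟨h₁, h₂⟩, h⟩
    obtain ⟨u, u', huu, h₃, h₄⟩ := hp.exists_edge hx hik (hx.monotone h₁) (hx.monotone h₂)
    have hlt : ∀ t', t' ∈ v → t' ≠ t := by
      rintro t' ht' rfl
      exact h (above_of_mem hx hik hp ht')
    refine ⟨u, u', huu, lt_of_le_of_ne (hx.le_iff_le.1 h₃) (hlt _ (edge_mem huu).1),
      lt_of_le_of_ne (hx.le_iff_le.1 h₄) (hlt _ (edge_mem huu).2).symm, ?_⟩
    by_contra h'
    exact h ⟨u, u', huu, h₃, h₄, not_lt.1 h'⟩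

theorem under_range (hx : StrictMono fun t => (q t).1) {i k : Fin n} {c : List (Fin n)}
    (hp : IsPath i k c) {z : ℝ × ℝ} (h : Under q c z) : (q i).1 ≤ z.1 ∧ z.1 ≤ (q k).1 := by
  obtain ⟨u, v, h, h₁, h₂, -⟩ := h
  exact ⟨(hx.monotone (hp.mem_le (edge_mem h).1).1).trans h₁,
    h₂.trans (hx.monotone (hp.mem_le (edge_mem h).2).2)⟩

/-- The points under `c` split into those of the polygon and those strictly below `v`. That the
latter are all under `c` is where the common chord is needed. -/
theorem weight_hull_eq (hx : StrictMono fun t => (q t).1) {i k : Fin n} {c v : List (Fin n)}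
    (hik : i < k) (hp : IsPath i k c) (hc : IsConcave q c) (hp' : IsPath i k v)
    (hv : IsConvex q v) :
    weight q w (hull q {t | t ∈ c ∨ t ∈ v}) = pathWeight q w c - pathSubweight q w v := by
  classical
  rw [hull_eq_region hx hik hp hc hp' hv, weight, pathWeight_eq_sum hx hik hp,
    pathSubweight_eq_sum hx hik hp' hv, eq_sub_iff_add_eq, ← Finset.sum_union]
  · congr 1
    ext t
    simp only [Finset.mem_union, Finset.mem_filter, Finset.mem_univ, true_and, Finset.mem_Icc,
      Set.mem_ofPred_eq]
    constructor
    · rintro (h | ⟨h, h'⟩)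
      · exact h.1
      · exact hc.under_of_chord hx hik hp (hx.monotone h.1) (hx.monotone h.2)
          (hv.cross_chord_of_not_above hx hik hp' (hx.monotone h.1) (hx.monotone h.2) h')
    · intro h
      by_cases h' : Above q v (q t)
      · exact Or.inl ⟨h, h'⟩
      · have := under_range hx hp h
        exact Or.inr ⟨⟨hx.le_iff_le.1 this.1, hx.le_iff_le.1 this.2⟩, h'⟩
  · rw [Finset.disjoint_left]
    simp only [Finset.mem_filter, Finset.mem_univ, true_and, Set.mem_ofPred_eq]
    exact fun t h h' => h'.2 h.2

/-! ## The upper hull -/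

/-- Every three consecutive vertices of the path make a strict right turn. -/
def StrictlyConcave (q : Fin n → ℝ × ℝ) (c : List (Fin n)) : Prop :=
  IsConcave q c ∧ ∀ a b d, [a, b, d] <:+: c → 0 < cross (q d - q a) (q b - q a)

/-- The upper hull of a set of points is a strictly concave path. -/
theorem exists_upper_hull (hx : StrictMono fun t => (q t).1) {k : Fin n} (A : Finset (Fin n))
    (hkA : k ∈ A) (hAk : ∀ t ∈ A, t ≤ k) (m : ℕ) : ∀ i ∈ A, i < k → k.val - i.val ≤ m →
    ∃ j l, IsPath i k (i :: j :: l) ∧ StrictlyConcave q (i :: j :: l) ∧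
      (∀ t ∈ i :: j :: l, t ∈ A) ∧
      (∀ t ∈ A, i < t → 0 ≤ cross (q t - q i) (q j - q i)) ∧
      (∀ t ∈ A, i ≤ t → Under q (i :: j :: l) (q t)) := by
  -- `A` and `k` stay fixed while the start moves to the right; `m` bounds the remaining distance.
  induction m with
  | zero => intro i _ hik h; rw [Fin.lt_def] at hik; omega
  | succ m ih =>
    intro i hi hik hm
    set s : Fin n → ℝ := fun t => ((q t).2 - (q i).2) / ((q t).1 - (q i).1) with hs
    have hcross : ∀ t u, i < t → i < u → ((0 ≤ cross (q t - q i) (q u - q i) ↔ s t ≤ s u) ∧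
        (0 < cross (q t - q i) (q u - q i) ↔ s t < s u)) := by
      intro t u ht hu
      have h₁ := sub_pos.2 (hx ht)
      have h₂ := sub_pos.2 (hx hu)
      simp only at h₁ h₂
      simp only [hs, cross, Prod.fst_sub, Prod.snd_sub]
      rw [div_le_div_iff₀ h₁ h₂, div_lt_div_iff₀ h₁ h₂]
      constructor <;> constructor <;> intro h <;> linarith
    -- Gift wrapping: among the points of largest slope seen from `i` the rightmost is taken, so no
    -- later point is collinear with the new edge and the next turn is strict.
    obtain ⟨j, hj, hmax⟩ := Finset.exists_max_image (A.filter (fun t => i < t))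
      (fun t => toLex (s t, t)) ⟨k, by simp [hkA, hik]⟩
    simp only [Finset.mem_filter] at hj hmax
    have hmax' : ∀ t ∈ A, i < t → s t < s j ∨ (s t = s j ∧ t ≤ j) := by
      intro t ht hit
      simpa [Prod.Lex.toLex_le_toLex] using hmax t ⟨ht, hit⟩
    have hle : ∀ t ∈ A, i < t → 0 ≤ cross (q t - q i) (q j - q i) := by
      intro t ht hit
      rw [(hcross t j hit hj.2).1]
      rcases hmax' t ht hit with h | h
      · exact h.le
      · exact h.1.le
    rcases (hAk j hj.1).eq_or_lt with rfl | hjk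
    · refine ⟨j, [], ⟨rfl, rfl, by simpa using hj.2⟩, ⟨trivial, fun a b d h => ?_⟩, by simp [hi, hkA],
        hle, fun t ht hit => ⟨i, j, by simp, hx.monotone hit, hx.monotone (hAk t ht), ?_⟩⟩
      · simpa using h.length_le
      · rcases hit.eq_or_lt with rfl | hit
        · simp [cross]
        · exact hle t ht hit
    · obtain ⟨j', l, hp, ⟨hc, hc'⟩, hmem, hle', hund⟩ := ih j hj.1 hjk (by
        have := hj.2; rw [Fin.lt_def] at this hjk; omega)
      have hj'A : j' ∈ A := hmem j' (by simp)
      have hjj' : j < j' := by simpa using hp.2.2.rel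
      have hst : 0 < cross (q j' - q i) (q j - q i) := by
        rw [(hcross j' j (hj.2.trans hjj') hj.2).2]
        rcases hmax' j' hj'A (hj.2.trans hjj') with h | h
        · exact h
        · exact absurd hjj' h.2.not_gt
      refine ⟨j, j' :: l, hp.cons hj.2, ⟨⟨hst.le, hc⟩, fun a b d h => ?_⟩, ?_, hle, ?_⟩
      · rw [List.infix_cons_iff] at h
        rcases h with h | h
        · simp at h
          obtain ⟨rfl, rfl, rfl⟩ := h
          exact hst
        · exact hc' a b d h
      · intro t ht
        rcases List.mem_cons.1 ht with rfl | ht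
        · exact hi
        · exact hmem t ht
      · intro t ht hit
        rcases le_or_gt j t with h | h
        · obtain ⟨u, v, huv, h'⟩ := hund t ht h
          exact ⟨u, v, edge_cons_cons.2 (Or.inr huv), h'⟩
        · refine ⟨i, j, edge_cons_cons.2 (Or.inl ⟨rfl, rfl⟩), hx.monotone hit, (hx h).le, ?_⟩
          rcases hit.eq_or_lt with rfl | hit
          · simp [cross]
          · exact hle t ht hit

/-! ## Extreme points -/

theorem exists_neighbours {c : List (Fin n)} {i k b : Fin n} (hp : IsPath i k c) (hb : b ∈ c)
    (hi : b ≠ i) (hk : b ≠ k) : ∃ a d, [a, b, d] <:+: c := by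
  obtain ⟨l₁, l₂, rfl⟩ := List.append_of_mem hb
  rcases List.eq_nil_or_concat l₁ with rfl | ⟨l₁, a, rfl⟩
  · exact absurd hp.1 (by simpa using hi)
  cases l₂ with
  | nil => exact absurd hp.2.1 (by simpa using hk)
  | cons d l₂ => exact ⟨a, d, l₁, l₂, by simp⟩

/-- A point where two non-parallel lines support a set is an extreme point of the set. -/
theorem mem_extremePoints_of_two_lines {R : Set (ℝ × ℝ)} {b u v : ℝ × ℝ} (hb : b ∈ R)
    (huv : cross u v ≠ 0) (hu : ∀ z ∈ R, 0 ≤ cross (z - b) u)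
    (hv : ∀ z ∈ R, 0 ≤ cross (z - b) v) : b ∈ R.extremePoints ℝ := by
  rw [mem_extremePoints]
  refine ⟨hb, fun x hxR y hyR hxy => ?_⟩
  -- If `b` is strictly between `x` and `y`, two nonnegative numbers have a positively weighted sum
  -- zero, so both vanish.
  have key : ∀ d : ℝ × ℝ, (∀ z ∈ R, 0 ≤ cross (z - b) d) →
      cross (x - b) d = 0 ∧ cross (y - b) d = 0 := by
    intro d hd
    obtain ⟨s, t, hs, ht, hst, rfl⟩ := hxy
    have h₁ := hd x hxR
    have h₂ := hd y hyR
    have h : s * cross (x - (s • x + t • y)) d + t * cross (y - (s • x + t • y)) d = 0 := by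
      obtain rfl : t = 1 - s := by linarith
      simp only [cross, Prod.fst_sub, Prod.snd_sub, Prod.fst_add, Prod.snd_add, Prod.smul_fst,
        Prod.smul_snd, smul_eq_mul]
      ring
    have h₃ := mul_nonneg hs.le h₁
    have h₄ := mul_nonneg ht.le h₂
    constructor
    · exact (mul_eq_zero.1 (by linarith : s * _ = 0)).resolve_left hs.ne'
    · exact (mul_eq_zero.1 (by linarith : t * _ = 0)).resolve_left ht.ne'
  -- Two independent linear equations in the plane have only the trivial solution; the identities
  -- below are Cramer's rule.
  have key₂ : ∀ z : ℝ × ℝ, cross (z - b) u = 0 → cross (z - b) v = 0 → z = b := by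
    intro z h₁ h₂
    have e₁ : (z - b).1 * cross u v = 0 := by
      have : (z - b).1 * cross u v = u.1 * cross (z - b) v - v.1 * cross (z - b) u := by
        simp only [cross]; ring
      rw [this, h₁, h₂]; simp
    have e₂ : (z - b).2 * cross u v = 0 := by
      have : (z - b).2 * cross u v = u.2 * cross (z - b) v - v.2 * cross (z - b) u := by
        simp only [cross]; ring
      rw [this, h₁, h₂]; simp
    have e₁ := (mul_eq_zero.1 e₁).resolve_right huv
    have e₂ := (mul_eq_zero.1 e₂).resolve_right huv
    exact sub_eq_zero.1 (Prod.ext e₁ e₂)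
  exact ⟨key₂ x (key u hu).1 (key v hv).1, key₂ y (key u hu).2 (key v hv).2⟩

/-- The lines through the two edges at `b` both support the region, and the strict turn makes them
non-parallel. -/
theorem StrictlyConcave.mem_extremePoints (hx : StrictMono fun t => (q t).1) {i k b : Fin n}
    {c : List (Fin n)} (hik : i < k) (hp : IsPath i k c) (hc : StrictlyConcave q c) (hb : b ∈ c)
    (hi : b ≠ i) (hk : b ≠ k) {R : Set (ℝ × ℝ)} (hR : ∀ z ∈ R, Under q c z) (hbR : q b ∈ R) :
    q b ∈ R.extremePoints ℝ := by
  obtain ⟨a, d, h⟩ := exists_neighbours hp hb hi hk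
  have h₁ : [a, b] <:+: c := (List.infix_append [] [a, b] [d]).trans h
  have h₂ : [b, d] <:+: c := (List.infix_append [a] [b, d] []).trans (by simpa using h)
  have hu := fun z hz => ((hc.1.under_iff hx hik hp z).1 (hR z hz)).2.2
  refine mem_extremePoints_of_two_lines hbR (u := q b - q a) (v := q d - q b) ?_ ?_ ?_
  · have := hc.2 a b d h
    rw [cross_sub_swap] at this
    simp only [cross] at this ⊢
    linarith
  · intro z hz
    rw [← cross_sub_swap]
    exact hu z hz a b h₁
  · exact fun z hz => hu z hz b d h₂

/-- The vertical line through the left end supports the region. It meets the region only in that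
end, because a point on it must be on or below the first vertex of `c` and on or above the first
vertex of `v`, and these coincide. -/
theorem left_mem_extremePoints (hx : StrictMono fun t => (q t).1) {i k : Fin n}
    {c v : List (Fin n)} (hp : IsPath i k c) (hp' : IsPath i k v)
    {R : Set (ℝ × ℝ)} (hR : ∀ z ∈ R, Under q c z ∧ Above q v z) (hbR : q i ∈ R) :
    q i ∈ R.extremePoints ℝ := by
  rw [mem_extremePoints]
  refine ⟨hbR, fun x hxR y hyR hxy => ?_⟩
  have key : ∀ z ∈ R, z.1 = (q i).1 → z = q i := by
    intro z hz hzi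
    obtain ⟨⟨u, u', hu, h₁, -, h₃⟩, ⟨v, v', hv, h₄, -, h₆⟩⟩ := hR z hz
    obtain rfl := le_antisymm (hx.le_iff_le.1 (h₁.trans_eq hzi)) (hp.mem_le (edge_mem hu).1).1
    obtain rfl := le_antisymm (hx.le_iff_le.1 (h₄.trans_eq hzi)) (hp'.mem_le (edge_mem hv).1).1
    have hu' := sub_pos.2 (hx (edge_lt hp.2.2 hu))
    have hv' := sub_pos.2 (hx (edge_lt hp'.2.2 hv))
    simp only [cross, Prod.fst_sub, Prod.snd_sub, hzi] at h₃ h₆ hu' hv'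
    refine Prod.ext hzi (le_antisymm ?_ ?_)
    · have : (z.2 - (q v).2) * ((q u').1 - (q v).1) ≤ 0 := by linarith
      linarith [nonpos_of_mul_nonpos_left this hu']
    · have : 0 ≤ (z.2 - (q v).2) * ((q v').1 - (q v).1) := by linarith
      linarith [nonneg_of_mul_nonneg_left this hv']
  have h₁ := (under_range hx hp (hR x hxR).1).1
  have h₂ := (under_range hx hp (hR y hyR).1).1
  obtain ⟨s, t, hs, ht, hst, h⟩ := hxy
  have h := congrArg Prod.fst h
  simp only [Prod.fst_add, Prod.smul_fst, smul_eq_mul] at h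
  have h₃ := mul_nonneg hs.le (sub_nonneg.2 h₁)
  have h₄ := mul_nonneg ht.le (sub_nonneg.2 h₂)
  have h₅ : s * (x.1 - (q i).1) + t * (y.1 - (q i).1) = 0 := by
    obtain rfl : t = 1 - s := by linarith
    linarith
  exact ⟨key x hxR (sub_eq_zero.1 ((mul_eq_zero.1 (by linarith : s * _ = 0)).resolve_left hs.ne')),
    key y hyR (sub_eq_zero.1 ((mul_eq_zero.1 (by linarith : t * _ = 0)).resolve_left ht.ne'))⟩

theorem right_mem_extremePoints (hx : StrictMono fun t => (q t).1) {i k : Fin n}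
    {c v : List (Fin n)} (hp : IsPath i k c) (hp' : IsPath i k v)
    {R : Set (ℝ × ℝ)} (hR : ∀ z ∈ R, Under q c z ∧ Above q v z) (hbR : q k ∈ R) :
    q k ∈ R.extremePoints ℝ := by
  rw [mem_extremePoints]
  refine ⟨hbR, fun x hxR y hyR hxy => ?_⟩
  have key : ∀ z ∈ R, z.1 = (q k).1 → z = q k := by
    intro z hz hzi
    obtain ⟨⟨u, u', hu, -, h₁, h₃⟩, ⟨v, v', hv, -, h₄, h₆⟩⟩ := hR z hz
    obtain rfl := le_antisymm (hx.le_iff_le.1 (hzi.symm.trans_le h₁)) (hp.mem_le (edge_mem hu).2).2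
    obtain rfl := le_antisymm (hx.le_iff_le.1 (hzi.symm.trans_le h₄)) (hp'.mem_le (edge_mem hv).2).2
    have hu' := sub_pos.2 (hx (edge_lt hp.2.2 hu))
    have hv' := sub_pos.2 (hx (edge_lt hp'.2.2 hv))
    simp only [cross, Prod.fst_sub, Prod.snd_sub, hzi] at h₃ h₆ hu' hv'
    refine Prod.ext hzi (le_antisymm ?_ ?_)
    · have : (z.2 - (q k).2) * ((q k).1 - (q u).1) ≤ 0 := by linarith
      linarith [nonpos_of_mul_nonpos_left this hu']
    · have : 0 ≤ (z.2 - (q k).2) * ((q k).1 - (q v).1) := by linarith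
      linarith [nonneg_of_mul_nonneg_left this hv']
  have h₁ := (under_range hx hp (hR x hxR).1).2
  have h₂ := (under_range hx hp (hR y hyR).1).2
  obtain ⟨s, t, hs, ht, hst, h⟩ := hxy
  have h := congrArg Prod.fst h
  simp only [Prod.fst_add, Prod.smul_fst, smul_eq_mul] at h
  have h₃ := mul_nonneg hs.le (sub_nonneg.2 h₁)
  have h₄ := mul_nonneg ht.le (sub_nonneg.2 h₂)
  have h₅ : s * ((q k).1 - x.1) + t * ((q k).1 - y.1) = 0 := by
    obtain rfl : t = 1 - s := by linarith
    linarith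
  exact ⟨key x hxR
      (sub_eq_zero.1 ((mul_eq_zero.1 (by linarith : s * _ = 0)).resolve_left hs.ne')).symm,
    key y hyR
      (sub_eq_zero.1 ((mul_eq_zero.1 (by linarith : t * _ = 0)).resolve_left ht.ne')).symm⟩

/-- Reflection in the first axis as a linear equivalence. -/
def flipEquiv : (ℝ × ℝ) ≃ₗ[ℝ] (ℝ × ℝ) :=
  (LinearEquiv.refl ℝ ℝ).prodCongr (LinearEquiv.neg ℝ)

theorem flip_mem_extremePoints {R : Set (ℝ × ℝ)} {z : ℝ × ℝ}
    (h : flip z ∈ (flip '' R).extremePoints ℝ) : z ∈ R.extremePoints ℝ := by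
  have h' : flipEquiv z ∈ (flipEquiv '' R).extremePoints ℝ := h
  rw [← image_extremePoints] at h'
  exact (Function.Injective.mem_set_image flipEquiv.injective).1 h'

/-- The paths are the upper hull of `A` and the upper hull of its reflection. Extreme points of a
hull are among the generating points; conversely inner vertices are extreme by the strict turns and
the two ends by the vertical supporting lines. -/
theorem exists_decomposition (hx : StrictMono fun t => (q t).1) {i k : Fin n}
    {A : Finset (Fin n)} (hik : i < k) (hA : Spans i k A) :
    ∃ c v : List (Fin n), IsPath i k c ∧ IsConcave q c ∧ IsPath i k v ∧ IsConvex q v ∧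
      hull q A = {z | Under q c z ∧ Above q v z} ∧
      (hull q A).extremePoints ℝ = q '' {t | t ∈ c ∨ t ∈ v} := by
  obtain ⟨hi, hk, hA⟩ := hA
  have hAi : ∀ t ∈ A, i ≤ t := fun t ht => (Finset.mem_Icc.1 (hA ht)).1
  have hAk : ∀ t ∈ A, t ≤ k := fun t ht => (Finset.mem_Icc.1 (hA ht)).2
  obtain ⟨j, l, hp, hc, hcA, -, hund⟩ := exists_upper_hull hx A hk hAk _ i hi hik le_rfl
  obtain ⟨j', l', hp', hv, hvA, -, habv⟩ := exists_upper_hull (q := fun t => flip (q t)) hx A hk hAk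
    _ i hi hik le_rfl
  generalize i :: j :: l = c at *
  generalize i :: j' :: l' = v at *
  have hv' : IsConvex q v := isConvex_iff_flip.2 hv.1
  have hreg := hull_eq_region hx hik hp hc.1 hp' hv'
  have hR : hull q A = {z | Under q c z ∧ Above q v z} := by
    apply Set.Subset.antisymm
    · refine convexHull_min ?_ ((hc.1.convex_under hx hik hp).inter (hv'.convex_above hx hik hp'))
      rintro _ ⟨t, ht, rfl⟩
      exact ⟨hund t ht (hAi t ht), above_iff_flip.2 (habv t ht (hAi t ht))⟩
    · rw [← hreg]
      refine convexHull_mono (Set.image_mono ?_)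
      rintro t (ht | ht)
      exacts [hcA t ht, hvA t ht]
  refine ⟨c, v, hp, hc.1, hp', hv', hR, Set.Subset.antisymm ?_ ?_⟩
  · rw [hR, ← hreg]
    exact extremePoints_convexHull_subset
  · have hRm : ∀ z ∈ hull q A, Under q c z ∧ Above q v z := fun z hz => by rwa [hR] at hz
    rintro _ ⟨t, ht, rfl⟩
    have htA : t ∈ A := ht.elim (hcA t) (hvA t)
    have htR : q t ∈ hull q A := subset_convexHull ℝ _ ⟨t, htA, rfl⟩
    by_cases hti : t = i
    · rw [hti] at htR ⊢; exact left_mem_extremePoints hx hp hp' hRm htR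
    by_cases htk : t = k
    · rw [htk] at htR ⊢; exact right_mem_extremePoints hx hp hp' hRm htR
    rcases ht with ht | ht
    · exact hc.mem_extremePoints hx hik hp ht hti htk (fun z hz => (hRm z hz).1) htR
    · refine flip_mem_extremePoints (hv.mem_extremePoints (q := fun t => flip (q t)) hx hik hp' ht
        hti htk ?_ ⟨_, htR, rfl⟩)
      rintro _ ⟨z, hz, rfl⟩
      exact above_iff_flip.1 (hRm z hz).2

end Weights


/-! ## Best paths -/

section Tables

variable {n : ℕ}

/-- Increasing lists have no repetitions, so their length is at most `n`. This finiteness turns the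
suprema in the tables into maxima. -/
theorem finite_chains : {c : List (Fin n) | c.IsChain (· < ·)}.Finite := by
  refine (List.finite_length_le (Fin n) n).subset fun c hc => ?_
  have hnd : c.Nodup := (List.isChain_iff_pairwise.1 hc).imp fun h => h.ne
  simpa using hnd.length_le_card

theorem exists_isGreatest {S : Set ℝ} (hf : S.Finite) (hS : S.Nonempty) : ∃ g, IsGreatest S g := by
  obtain ⟨g, hg, h⟩ := Set.exists_max_image S id hf hS
  exact ⟨g, hg, fun x hx => h x hx⟩

theorem exists_isLeast {S : Set ℝ} (hf : S.Finite) (hS : S.Nonempty) : ∃ g, IsLeast S g := by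
  obtain ⟨g, hg, h⟩ := Set.exists_min_image S id hf hS
  exact ⟨g, hg, fun x hx => h x hx⟩

theorem isGreatest_coe {S : Set ℝ} {g : ℝ} (h : IsGreatest S g) :
    IsGreatest (((↑) : ℝ → EReal) '' S) g :=
  ⟨⟨g, h.1, rfl⟩, by rintro _ ⟨x, hx, rfl⟩; exact EReal.coe_le_coe_iff.2 (h.2 hx)⟩

/-- Every three consecutive entries of the list satisfy `T`. -/
def Chain3 (T : Fin n → Fin n → Fin n → Prop) : List (Fin n) → Prop
  | a :: b :: d :: l => T a b d ∧ Chain3 T (b :: d :: l)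
  | _ => True

theorem isConcave_iff_chain3 {q : Fin n → ℝ × ℝ} : ∀ {c : List (Fin n)},
    IsConcave q c ↔ Chain3 (ConcaveTriple q) c
  | [] => Iff.rfl
  | [_] => Iff.rfl
  | [_, _] => Iff.rfl
  | _ :: _ :: _ :: _ => and_congr Iff.rfl isConcave_iff_chain3

theorem isConvex_iff_chain3 {q : Fin n → ℝ × ℝ} : ∀ {c : List (Fin n)},
    IsConvex q c ↔ Chain3 (ConvexTriple q) c
  | [] => Iff.rfl
  | [_] => Iff.rfl
  | [_, _] => Iff.rfl
  | _ :: _ :: _ :: _ => and_congr Iff.rfl isConvex_iff_chain3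

/-- The values of the paths from `i` to `k` with first edge `i → j`, where the edges have weights
`e` and the end has weight `f`. -/
def pathValues (T : Fin n → Fin n → Fin n → Prop) (e : Fin n → Fin n → ℝ) (f : Fin n → ℝ)
    (i j k : Fin n) : Set ℝ :=
  {x | ∃ l, IsPath i k (i :: j :: l) ∧ Chain3 T (i :: j :: l) ∧ x = edgeSum e (i :: j :: l) + f k}

/-- The largest value of a path from `i` to `k` with first edge `i → j`. -/
noncomputable def best (T : Fin n → Fin n → Fin n → Prop) (e : Fin n → Fin n → ℝ) (f : Fin n → ℝ)
    (i j k : Fin n) : EReal :=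
  sSup ((↑) '' pathValues T e f i j k)

variable {T : Fin n → Fin n → Fin n → Prop} {e : Fin n → Fin n → ℝ} {f : Fin n → ℝ}

theorem finite_pathValues {i j k : Fin n} : (pathValues T e f i j k).Finite := by
  refine (finite_chains.image fun c => edgeSum e c + f k).subset ?_
  rintro x ⟨l, hl, -, rfl⟩
  exact ⟨_, hl.2.2, rfl⟩

theorem pathValues_self {i k : Fin n} (hik : i < k) :
    pathValues T e f i k k = {e i k + f k} := by
  ext x
  rw [Set.mem_singleton_iff]
  constructor
  · rintro ⟨l, hl, -, rfl⟩
    cases l with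
    | nil => simp [edgeSum]
    | cons a l =>
      have h₁ := (hl.mem_le (t := a) (by simp)).2
      have h₂ : k < a := by simpa using hl.2.2.tail.rel
      exact absurd h₁ h₂.not_ge
  · rintro rfl
    exact ⟨[], ⟨rfl, rfl, by simpa using hik⟩, trivial, by simp [edgeSum]⟩

/-- Optimal substructure at the level of sets of reals, before any maximum is taken. Both the
recurrences in `EReal` and the correctness of the program start from here. -/
theorem mem_pathValues_iff {i j k : Fin n} (hij : i < j) (hjk : j < k) {x : ℝ} :
    x ∈ pathValues T e f i j k ↔
      ∃ j', j < j' ∧ j' ≤ k ∧ T i j j' ∧ ∃ y ∈ pathValues T e f j j' k, x = e i j + y := by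
  constructor
  · rintro ⟨l, hl, hc, rfl⟩
    cases l with
    | nil => exact absurd (by simpa using hl.2.1) hjk.ne
    | cons a l =>
      exact ⟨a, by simpa using hl.2.2.tail.rel, (hl.mem_le (by simp)).2, hc.1, _,
        ⟨l, hl.tail, hc.2, rfl⟩, add_assoc _ _ _⟩
  · rintro ⟨a, -, -, hT, _, ⟨l, hl, hc, rfl⟩, rfl⟩
    exact ⟨a :: l, hl.cons hij, ⟨hT, hc⟩, (add_assoc _ _ _).symm⟩

theorem best_of_isGreatest {i j k : Fin n} {g : ℝ} (h : IsGreatest (pathValues T e f i j k) g) :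
    best T e f i j k = g :=
  (isGreatest_coe h).csSup_eq

theorem best_of_empty {i j k : Fin n} (h : pathValues T e f i j k = ∅) :
    best T e f i j k = ⊥ := by
  rw [best, h]; simp

theorem le_best {i j k : Fin n} {x : ℝ} (h : x ∈ pathValues T e f i j k) :
    (x : EReal) ≤ best T e f i j k :=
  le_sSup ⟨x, h, rfl⟩

theorem best_eq_bot_or (i j k : Fin n) : (pathValues T e f i j k = ∅ ∧ best T e f i j k = ⊥) ∨
    ∃ g ∈ pathValues T e f i j k, best T e f i j k = g := by
  rcases (pathValues T e f i j k).eq_empty_or_nonempty with h | h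
  · exact Or.inl ⟨h, best_of_empty h⟩
  · obtain ⟨g, hg⟩ := exists_isGreatest finite_pathValues h
    exact Or.inr ⟨g, hg.1, best_of_isGreatest hg⟩

theorem best_self {i k : Fin n} (hik : i < k) : best T e f i k k = (e i k + f k : ℝ) :=
  best_of_isGreatest (by rw [pathValues_self hik]; exact isGreatest_singleton)

theorem best_eq_iSup {i j k : Fin n} (hij : i < j) (hjk : j < k) :
    best T e f i j k =
      ⨆ j' ∈ {j' | j < j' ∧ j' ≤ k ∧ T i j j'}, (e i j : EReal) + best T e f j j' k := by
  apply le_antisymm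
  · refine sSup_le ?_
    rintro _ ⟨x, hx, rfl⟩
    obtain ⟨j', h₁, h₂, h₃, y, hy, rfl⟩ := (mem_pathValues_iff hij hjk).1 hx
    refine le_trans ?_ (le_iSup₂ (f := fun j' _ => (e i j : EReal) + best T e f j j' k) j'
      (⟨h₁, h₂, h₃⟩ : j < j' ∧ j' ≤ k ∧ T i j j'))
    rw [EReal.coe_add]
    gcongr
    exact le_best hy
  · refine iSup₂_le ?_
    rintro j' ⟨h₁, h₂, h₃⟩
    rcases best_eq_bot_or (T := T) (e := e) (f := f) j j' k with ⟨-, h⟩ | ⟨g, hg, h⟩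
    · rw [h]; simp
    · rw [h, ← EReal.coe_add]
      exact le_best ((mem_pathValues_iff hij hjk).2 ⟨j', h₁, h₂, h₃, g, hg, rfl⟩)

/-- Adding a real number is an order automorphism of `EReal` with inverse the addition of its
negative, so it commutes with all suprema, including the empty one. -/
theorem coe_add_biSup {α : Type*} (r : ℝ) (S : Set α) (g : α → EReal) :
    (r : EReal) + ⨆ x ∈ S, g x = ⨆ x ∈ S, ((r : EReal) + g x) := by
  have key : ∀ a b : EReal, (r : EReal) + a ≤ b ↔ a ≤ ((-r : ℝ) : EReal) + b := by
    intro a b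
    induction a <;> induction b <;> simp [-EReal.coe_neg, ← EReal.coe_add]
  refine eq_of_forall_ge_iff fun b => ?_
  rw [key]
  simp only [iSup_le_iff, key]

theorem neg_biSup {α : Type*} (S : Set α) (g : α → EReal) :
    -(⨆ x ∈ S, g x) = ⨅ x ∈ S, -g x := by
  refine eq_of_forall_le_iff fun b => ?_
  rw [EReal.le_neg]
  simp only [le_iInf_iff, iSup_le_iff]
  exact forall₂_congr fun x _ => EReal.le_neg.symm

theorem neg_coe_neg_add (r : ℝ) (a : EReal) :
    -(((-r : ℝ) : EReal) + a) = (r : EReal) + -a := by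
  induction a
  · simp
  · rw [← EReal.coe_neg, ← EReal.coe_add, ← EReal.coe_add, ← EReal.coe_neg]; congr 1; ring
  · simp

/-! ## The two tables as tables of best paths -/

variable {q : Fin n → ℝ × ℝ} {w : Fin n → ℝ}

/-- The weight of a vertex is charged to the edge that leaves it, so only the weight of the last
vertex remains; path weights thus take the form used by `pathValues`. -/
theorem edgeSum_add_eq (g : Fin n → Fin n → ℝ) : ∀ {c : List (Fin n)} {i k : Fin n}, IsPath i k c →
    edgeSum (fun i j => g i j + w i) c + w k = edgeSum g c + (c.map w).sum
  | [], _, _, h => by simp [IsPath] at h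
  | [a], _, k, h => by
    obtain rfl : a = k := by simpa using h.2.1
    simp [edgeSum]
  | a :: b :: l, _, k, h => by
    have := edgeSum_add_eq g h.tail
    rw [edgeSum, edgeSum, List.map_cons, List.sum_cons]
    linarith

theorem edgeSum_neg (g : Fin n → Fin n → ℝ) : ∀ c : List (Fin n),
    edgeSum (fun i j => - g i j) c = - edgeSum g c
  | [] => by simp [edgeSum]
  | [_] => by simp [edgeSum]
  | a :: b :: l => by
    rw [edgeSum, edgeSum, edgeSum_neg g (b :: l)]; ring

theorem mem_pathValues_upper {i j k : Fin n} {x : ℝ} :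
    x ∈ pathValues (ConcaveTriple q) (fun i j => upperEdge q w i j + w i) w i j k ↔
      ∃ l, IsPath i k (i :: j :: l) ∧ IsConcave q (i :: j :: l) ∧
        x = pathWeight q w (i :: j :: l) := by
  refine exists_congr fun l => and_congr_right fun h => and_congr isConcave_iff_chain3.symm ?_
  rw [edgeSum_add_eq _ h, pathWeight]

theorem mem_pathValues_lower {i j k : Fin n} {x : ℝ} :
    x ∈ pathValues (ConvexTriple q) (fun i j => - lowerEdge q w i j) (fun _ => 0) i j k ↔
      ∃ l, IsPath i k (i :: j :: l) ∧ IsConvex q (i :: j :: l) ∧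
        x = - pathSubweight q w (i :: j :: l) := by
  refine exists_congr fun l => and_congr_right fun h => and_congr isConvex_iff_chain3.symm ?_
  rw [edgeSum_neg, pathSubweight, add_zero]

theorem tableC_eq_best (i j k : Fin n) : tableC q w i j k =
    best (ConcaveTriple q) (fun i j => upperEdge q w i j + w i) w i j k := by
  rw [tableC, best]
  congr 1
  ext x
  constructor
  · rintro ⟨l, h₁, h₂, rfl⟩
    exact ⟨_, mem_pathValues_upper.2 ⟨l, h₁, h₂, rfl⟩, rfl⟩
  · rintro ⟨x, hx, rfl⟩
    obtain ⟨l, h₁, h₂, rfl⟩ := mem_pathValues_upper.1 hx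
    exact ⟨l, h₁, h₂, rfl⟩

/-- A minimum is the negative of the maximum of the negatives, so the table of the lower paths is
another instance of `best`. -/
theorem tableV_eq_best (i j k : Fin n) : tableV q w i j k =
    - best (ConvexTriple q) (fun i j => - lowerEdge q w i j) (fun _ => 0) i j k := by
  rw [tableV, best, sSup_image, neg_biSup, ← sInf_image]
  congr 1
  ext x
  constructor
  · rintro ⟨l, h₁, h₂, rfl⟩
    exact ⟨_, mem_pathValues_lower.2 ⟨l, h₁, h₂, rfl⟩, by simp⟩
  · rintro ⟨x, hx, rfl⟩
    obtain ⟨l, h₁, h₂, rfl⟩ := mem_pathValues_lower.1 hx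
    exact ⟨l, h₁, h₂, by simp⟩

theorem tableC_self {i k : Fin n} (hik : i < k) :
    tableC q w i k k = (upperEdge q w i k + w i + w k : ℝ) := by
  rw [tableC_eq_best, best_self hik]

theorem tableV_self {i k : Fin n} (hik : i < k) :
    tableV q w i k k = (lowerEdge q w i k : ℝ) := by
  rw [tableV_eq_best, best_self hik]; simp

theorem tableC_eq_iSup {i j k : Fin n} (hij : i < j) (hjk : j < k) :
    tableC q w i j k = ⨆ j' ∈ {j' | j < j' ∧ j' ≤ k ∧ ConcaveTriple q i j j'},
      ((upperEdge q w i j + w i : ℝ) : EReal) + tableC q w j j' k := by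
  simp only [tableC_eq_best]
  exact best_eq_iSup hij hjk

theorem tableV_eq_iInf {i j k : Fin n} (hij : i < j) (hjk : j < k) :
    tableV q w i j k = ⨅ j' ∈ {j' | j < j' ∧ j' ≤ k ∧ ConvexTriple q i j j'},
      (lowerEdge q w i j : EReal) + tableV q w j j' k := by
  simp only [tableV_eq_best]
  rw [best_eq_iSup hij hjk, neg_biSup]
  simp only [neg_coe_neg_add]

/-- The last vertex of a concave path must lie on or below the line through its first edge. -/
theorem tableC_eq_bot (hx : StrictMono fun t => (q t).1) {i j k : Fin n}
    (h : cross (q k - q i) (q j - q i) < 0) : tableC q w i j k = ⊥ := by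
  rw [tableC, sSup_eq_bot]
  rintro _ ⟨l, hp, hc, rfl⟩
  exact absurd (hc.cross_vertex hx hp.2.2 (edge_cons_cons.2 (Or.inl ⟨rfl, rfl⟩)) hp.right_mem)
    h.not_ge

theorem tableV_eq_top (hx : StrictMono fun t => (q t).1) {i j k : Fin n}
    (h : 0 < cross (q k - q i) (q j - q i)) : tableV q w i j k = ⊤ := by
  rw [tableV, sInf_eq_top]
  rintro _ ⟨l, hp, hc, rfl⟩
  have := (isConvex_iff_flip.1 hc).cross_vertex (q := fun t => flip (q t)) hx hp.2.2
    (edge_cons_cons.2 (Or.inl ⟨rfl, rfl⟩)) hp.right_mem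
  rw [cross_flip, neg_nonneg] at this
  exact absurd this h.not_ge

/-! ## Angularly sorted lists -/

/-- If the predicate persists once it holds, the entries satisfying it are exactly the suffix that
starts at the first of them. -/
theorem mem_drop_findIdx_iff {α : Type*} (p : α → Bool) {t : α} : ∀ {R : List α},
    R.Pairwise (fun u v => p u → p v) → t ∈ R → (p t ↔ t ∈ R.drop (R.findIdx p))
  | [], _, h => by simp at h
  | u :: R, hR, ht => by
    rw [List.pairwise_cons] at hR
    by_cases hu : p u
    · have : List.findIdx p (u :: R) = 0 := by simp [List.findIdx_cons, hu]
      rw [this, List.drop_zero]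
      refine ⟨fun _ => ht, fun _ => ?_⟩
      rcases List.mem_cons.1 ht with rfl | h
      · exact hu
      · exact hR.1 t h hu
    · have : List.findIdx p (u :: R) = List.findIdx p R + 1 := by simp [List.findIdx_cons, hu]
      rw [this, List.drop_succ_cons]
      rcases List.mem_cons.1 ht with rfl | h
      -- The list may contain repetitions, so membership of the head in a later suffix has to be
      -- refuted through the predicate.
      · refine ⟨fun h => absurd h hu, fun h => ?_⟩
        exact (mem_drop_findIdx_iff p hR.2 (List.mem_of_mem_drop h)).2 h
      · exact mem_drop_findIdx_iff p hR.2 h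

theorem findIdx_mono {α : Type*} {p p' : α → Bool} : ∀ {R : List α},
    (∀ t ∈ R, p' t → p t) → R.findIdx p ≤ R.findIdx p'
  | [], _ => by simp
  | u :: R, h => by
    have ih := findIdx_mono (R := R) fun t ht => h t (by simp [ht])
    have := h u (by simp)
    rw [List.findIdx_cons, List.findIdx_cons]
    cases h₁ : p u <;> cases h₂ : p' u <;> simp_all

/-- Concavity at `j` says that the outgoing slope is at most the incoming one, and outgoing slopes
decrease along the clockwise list, so the property persists. -/
theorem concaveTriple_iff_mem_drop (hx : StrictMono fun t => (q t).1) {i j j' : Fin n}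
    {R : List (Fin n)} (hR : ClockwiseList q j {t | j < t} R) (hij : i < j) (hj : j < j') :
    ConcaveTriple q i j j' ↔ j' ∈ R.drop (fcConcave q i j R) := by
  classical
  have h := mem_drop_findIdx_iff (fun t => decide (ConcaveTriple q i j t)) (t := j') (R := R) ?_
    ((hR.2.1 j').2 hj)
  · rw [decide_eq_true_iff] at h
    rw [h, fcConcave]
  · refine hR.2.2.imp_of_mem fun {u v} hu hv huv => ?_
    have hu := (hR.2.1 u).1 hu
    have hv := (hR.2.1 v).1 hv
    simp only [decide_eq_true_iff, concaveTriple_iff]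
    exact fun h => cross_trans (by simpa using hx hv) (by simpa using hx hu) (by simpa using hx hij)
      huv h

/-- Clockwise order on the left of `j` means decreasing slope of the edge into `j`. A smaller
incoming slope admits fewer outgoing edges, hence the first compatible position moves on. -/
theorem fcConcave_mono (hx : StrictMono fun t => (q t).1) {j : Fin n} {L R : List (Fin n)}
    (hL : ClockwiseList q j {t | t < j} L) (hR : ClockwiseList q j {t | j < t} R) :
    (L.map (fun i => fcConcave q i j R)).Pairwise (· ≤ ·) := by
  rw [List.pairwise_map]
  refine hL.2.2.imp_of_mem fun {u v} hu hv huv => findIdx_mono fun t ht => ?_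
  have hu := (hL.2.1 u).1 hu
  have hv := (hL.2.1 v).1 hv
  have ht := (hR.2.1 t).1 ht
  simp only [decide_eq_true_iff, concaveTriple_iff]
  refine fun h => cross_trans (by simpa using hx ht) (by simpa using hx hv) (by simpa using hx hu)
    h ?_
  have : cross (q j - q v) (q j - q u) = cross (q v - q j) (q u - q j) := by
    simp only [cross, Prod.fst_sub, Prod.snd_sub]; ring
  rwa [this]

/-- Reflection exchanges clockwise and counterclockwise order, which turns the lists for the lower
paths into clockwise lists of the reflected points. -/
theorem ClockwiseList.flip_of_reverse {j : Fin n} {I : Set (Fin n)} {L : List (Fin n)}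
    (h : ClockwiseList q j I L.reverse) : ClockwiseList (fun t => flip (q t)) j I L := by
  obtain ⟨h₁, h₂, h₃⟩ := h
  refine ⟨List.nodup_reverse.1 h₁, by simpa using h₂, (List.pairwise_reverse.1 h₃).imp ?_⟩
  intro u v huv
  rw [cross_flip]
  simp only [cross] at *
  linarith

theorem fcConvex_eq_flip (i j : Fin n) (R : List (Fin n)) :
    fcConvex q i j R = fcConcave (fun t => flip (q t)) i j R := by
  classical
  rw [fcConvex, fcConcave]
  congr! 2 with t
  simp only [convexTriple_iff_flip]

theorem convexTriple_iff_mem_drop (hx : StrictMono fun t => (q t).1) {i j j' : Fin n}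
    {R : List (Fin n)} (hR : ClockwiseList q j {t | j < t} R.reverse) (hij : i < j) (hj : j < j') :
    ConvexTriple q i j j' ↔ j' ∈ R.drop (fcConvex q i j R) := by
  rw [convexTriple_iff_flip, fcConvex_eq_flip]
  exact concaveTriple_iff_mem_drop (q := fun t => flip (q t)) hx hR.flip_of_reverse hij hj

theorem fcConvex_mono (hx : StrictMono fun t => (q t).1) {j : Fin n} {L R : List (Fin n)}
    (hL : ClockwiseList q j {t | t < j} L.reverse) (hR : ClockwiseList q j {t | j < t} R.reverse) :
    (L.map (fun i => fcConvex q i j R)).Pairwise (· ≤ ·) := by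
  simp only [fcConvex_eq_flip]
  exact fcConcave_mono (q := fun t => flip (q t)) hx hL.flip_of_reverse hR.flip_of_reverse

theorem tableC_eq_suffixMaxC (hx : StrictMono fun t => (q t).1) {i j k : Fin n}
    {R : List (Fin n)} (hR : ClockwiseList q j {t | j < t} R) (hij : i < j) (hjk : j < k) :
    tableC q w i j k = ((upperEdge q w i j + w i : ℝ) : EReal) +
      suffixMaxC q w R j (fcConcave q i j R) k := by
  rw [tableC_eq_iSup hij hjk, suffixMaxC, coe_add_biSup]
  refine iSup_congr fun t => iSup_congr_Prop ⟨?_, ?_⟩ fun _ => rfl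
  · rintro ⟨h₁, h₂, h₃⟩
    exact ⟨(concaveTriple_iff_mem_drop hx hR hij h₁).1 h₃, h₂⟩
  · rintro ⟨h₁, h₂⟩
    have h := (hR.2.1 t).1 (List.mem_of_mem_drop h₁)
    exact ⟨h, h₂, (concaveTriple_iff_mem_drop hx hR hij h).2 h₁⟩

theorem coe_add_biInf {α : Type*} (r : ℝ) (S : Set α) (g : α → EReal) :
    (r : EReal) + ⨅ x ∈ S, g x = ⨅ x ∈ S, ((r : EReal) + g x) := by
  have h : ⨅ x ∈ S, g x = -⨆ x ∈ S, -g x := by simp only [neg_biSup, neg_neg]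
  rw [h, ← neg_coe_neg_add, coe_add_biSup, neg_biSup]
  simp only [neg_coe_neg_add, neg_neg]

theorem tableV_eq_suffixMinV (hx : StrictMono fun t => (q t).1) {i j k : Fin n}
    {R : List (Fin n)} (hR : ClockwiseList q j {t | j < t} R.reverse) (hij : i < j) (hjk : j < k) :
    tableV q w i j k = (lowerEdge q w i j : EReal) +
      suffixMinV q w R j (fcConvex q i j R) k := by
  rw [tableV_eq_iInf hij hjk, suffixMinV, coe_add_biInf]
  refine iInf_congr fun t => iInf_congr_Prop ⟨?_, ?_⟩ fun _ => rfl
  · rintro ⟨h₁, h₂, h₃⟩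
    exact ⟨(convexTriple_iff_mem_drop hx hR hij h₁).1 h₃, h₂⟩
  · rintro ⟨h₁, h₂⟩
    have h := (hR.2.1 t).1 (List.mem_reverse.2 (List.mem_of_mem_drop h₁))
    exact ⟨h, h₂, (convexTriple_iff_mem_drop hx hR hij h).2 h₁⟩

/-! ## The maximum weight of a polygon and of a polytope -/

theorem isPath_edge {i k : Fin n} (hik : i < k) : IsPath i k [i, k] :=
  ⟨rfl, rfl, by simpa using hik⟩

/-- The single edge is always an admissible path, so the maximum over all first edges is attained
and real; the difference in `tableM_eq` is therefore a difference of real numbers. -/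
theorem exists_best_upper {i k : Fin n} (hik : i < k) : ∃ c, IsPath i k c ∧ IsConcave q c ∧
    (∀ c', IsPath i k c' → IsConcave q c' → pathWeight q w c' ≤ pathWeight q w c) ∧
    ⨆ j ∈ Finset.Ioc i k, tableC q w i j k = (pathWeight q w c : ℝ) := by
  obtain ⟨g, ⟨c, ⟨hp, hc⟩, rfl⟩, hg⟩ := exists_isGreatest
    (((finite_chains (n := n)).subset fun c h => h.1.2.2).image (pathWeight q w) :
      (pathWeight q w '' {c | IsPath i k c ∧ IsConcave q c}).Finite)
    ⟨_, [i, k], ⟨isPath_edge hik, trivial⟩, rfl⟩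
  have hmax : ∀ c', IsPath i k c' → IsConcave q c' → pathWeight q w c' ≤ pathWeight q w c :=
    fun c' h₁ h₂ => hg ⟨c', ⟨h₁, h₂⟩, rfl⟩
  refine ⟨c, hp, hc, hmax, le_antisymm (iSup₂_le fun j _ => sSup_le ?_) ?_⟩
  · rintro _ ⟨l, h₁, h₂, rfl⟩
    exact EReal.coe_le_coe_iff.2 (hmax _ h₁ h₂)
  · obtain ⟨j, l, rfl⟩ := hp.exists_cons_cons hik
    have hj : j ∈ Finset.Ioc i k :=
      Finset.mem_Ioc.2 ⟨by simpa using hp.2.2.rel, (hp.mem_le (by simp)).2⟩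
    exact (le_sSup ⟨l, hp, hc, rfl⟩ : _ ≤ tableC q w i j k).trans
      (le_iSup₂ (f := fun j _ => tableC q w i j k) j hj)

theorem exists_best_lower {i k : Fin n} (hik : i < k) : ∃ v, IsPath i k v ∧ IsConvex q v ∧
    (∀ v', IsPath i k v' → IsConvex q v' → pathSubweight q w v ≤ pathSubweight q w v') ∧
    ⨅ j ∈ Finset.Ioc i k, tableV q w i j k = (pathSubweight q w v : ℝ) := by
  obtain ⟨g, ⟨c, ⟨hp, hc⟩, rfl⟩, hg⟩ := exists_isLeast
    (((finite_chains (n := n)).subset fun c h => h.1.2.2).image (pathSubweight q w) :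
      (pathSubweight q w '' {c | IsPath i k c ∧ IsConvex q c}).Finite)
    ⟨_, [i, k], ⟨isPath_edge hik, trivial⟩, rfl⟩
  have hmin : ∀ c', IsPath i k c' → IsConvex q c' → pathSubweight q w c ≤ pathSubweight q w c' :=
    fun c' h₁ h₂ => hg ⟨c', ⟨h₁, h₂⟩, rfl⟩
  refine ⟨c, hp, hc, hmin, le_antisymm ?_ (le_iInf₂ fun j _ => le_sInf ?_)⟩
  · obtain ⟨j, l, rfl⟩ := hp.exists_cons_cons hik
    have hj : j ∈ Finset.Ioc i k :=
      Finset.mem_Ioc.2 ⟨by simpa using hp.2.2.rel, (hp.mem_le (by simp)).2⟩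
    exact (iInf₂_le (f := fun j _ => tableV q w i j k) j hj).trans (sInf_le ⟨l, hp, hc, rfl⟩)
  · rintro _ ⟨l, h₁, h₂, rfl⟩
    exact EReal.coe_le_coe_iff.2 (hmin _ h₁ h₂)

/-- Supplies, for the upper bound on `tableM`, a pair of paths realizing the weight of an arbitrary
spanned polygon. -/
theorem weight_hull_le (hx : StrictMono fun t => (q t).1) {i k : Fin n} (hik : i < k)
    {A : Finset (Fin n)} (hA : Spans i k A) : ∃ c v, IsPath i k c ∧ IsConcave q c ∧
      IsPath i k v ∧ IsConvex q v ∧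
      weight q w (hull q A) = pathWeight q w c - pathSubweight q w v := by
  obtain ⟨c, v, h₁, h₂, h₃, h₄, h₅, -⟩ := exists_decomposition hx hik hA
  refine ⟨c, v, h₁, h₂, h₃, h₄, ?_⟩
  rw [h₅, ← hull_eq_region hx hik h₁ h₂ h₃ h₄, weight_hull_eq hx hik h₁ h₂ h₃ h₄]

theorem spans_paths {i k : Fin n} {c v : List (Fin n)} (hp : IsPath i k c) (hp' : IsPath i k v) :
    Spans i k (c.toFinset ∪ v.toFinset) ∧
      ((c.toFinset ∪ v.toFinset : Finset (Fin n)) : Set (Fin n)) = {t | t ∈ c ∨ t ∈ v} := by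
  refine ⟨⟨by simp [hp.left_mem], by simp [hp.right_mem], fun t ht => ?_⟩, by ext; simp⟩
  simp only [Finset.mem_union, List.mem_toFinset] at ht
  exact Finset.mem_Icc.2 (ht.elim hp.mem_le hp'.mem_le)

/-- The best upper and the best lower path may be combined freely, since every such pair bounds a
polygon; conversely each polygon comes from one pair. -/
theorem tableM_eq (hx : StrictMono fun t => (q t).1) {i k : Fin n} (hik : i < k) :
    tableM q w i k = (⨆ j ∈ Finset.Ioc i k, tableC q w i j k) -
      ⨅ j ∈ Finset.Ioc i k, tableV q w i j k := by
  obtain ⟨c, hp, hc, hmax, e₁⟩ := exists_best_upper (q := q) (w := w) hik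
  obtain ⟨v, hp', hv, hmin, e₂⟩ := exists_best_lower (q := q) (w := w) hik
  rw [e₁, e₂, ← EReal.coe_sub]
  refine IsGreatest.csSup_eq ⟨⟨_, (spans_paths hp hp').1, ?_⟩, ?_⟩
  · rw [(spans_paths hp hp').2, weight_hull_eq hx hik hp hc hp' hv]
  · rintro _ ⟨A, hA, rfl⟩
    obtain ⟨c', v', h₁, h₂, h₃, h₄, h₅⟩ := weight_hull_le (w := w) hx hik hA
    rw [h₅]
    exact EReal.coe_le_coe_iff.2 (sub_le_sub (hmax _ h₁ h₂) (hmin _ h₃ h₄))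

theorem weight_hull_singleton (hx : StrictMono fun t => (q t).1) (k : Fin n) :
    weight q w (hull q {k}) = w k := by
  classical
  have : ∀ t, q t ∈ hull q {k} ↔ t = k := fun t => by
    simp only [hull, Set.image_singleton, convexHull_singleton, Set.mem_singleton_iff]
    exact ⟨fun h => hx.injective (congrArg Prod.fst h), fun h => by rw [h]⟩
  simp only [weight, this]
  simp [Finset.filter_eq']

theorem spans_self {k : Fin n} {A : Finset (Fin n)} : Spans k k A ↔ A = {k} := by
  constructor
  · rintro ⟨h₁, -, h₂⟩
    exact Finset.Subset.antisymm (by simpa using h₂) (by simpa using h₁)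
  · rintro rfl
    simp [Spans]

theorem tableM_self (hx : StrictMono fun t => (q t).1) (k : Fin n) :
    tableM q w k k = (w k : ℝ) := by
  have : {x : EReal | ∃ A : Finset (Fin n), Spans k k A ∧ x = (weight q w (hull q A) : ℝ)}
      = {(w k : EReal)} := by
    ext x
    simp only [spans_self, exists_eq_left, Set.mem_ofPred_eq, Set.mem_singleton_iff,
      Finset.coe_singleton, weight_hull_singleton hx]
  rw [tableM, this, sSup_singleton]

theorem isPolytope_hull (A : Set (Fin n)) : IsPolytope (hull q A) := by
  refine ⟨(Set.toFinite (q '' A)).toFinset, by simp [hull]⟩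

theorem weight_empty : weight q w (hull q ∅) = 0 := by
  simp [weight, hull]

/-- A polytope has weight `0` or the weight of a polygon spanned by some of the points. -/
theorem weight_eq_zero_or {P : Set (ℝ × ℝ)} (hP : IsPolytope P) : weight q w P = 0 ∨
    ∃ i k, i ≤ k ∧ ∃ A : Finset (Fin n), Spans i k A ∧ weight q w P = weight q w (hull q A) := by
  classical
  -- The hull of the input points in `P` is contained in `P` by convexity, so it contains the same
  -- input points.
  set A := Finset.univ.filter fun t => q t ∈ P with hA
  rcases A.eq_empty_or_nonempty with h | h
  · left
    rw [weight]
    convert Finset.sum_empty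
  · right
    refine ⟨A.min' h, A.max' h, A.min'_le_max' h, A, ⟨A.min'_mem h, A.max'_mem h, fun t ht =>
      Finset.mem_Icc.2 ⟨A.min'_le t ht, A.le_max' t ht⟩⟩, ?_⟩
    rw [weight, weight]
    congr 1
    ext t
    simp only [Finset.mem_filter, Finset.mem_univ, true_and]
    constructor
    · intro ht
      exact subset_convexHull ℝ _ ⟨t, by simpa [hA] using ht, rfl⟩
    · obtain ⟨B, rfl⟩ := hP
      intro ht
      refine convexHull_min ?_ (convex_convexHull ℝ _) ht
      rintro _ ⟨u, hu, rfl⟩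
      simpa [hA] using hu

theorem exists_tableM_eq {i k : Fin n} (hik : i ≤ k) : ∃ A : Finset (Fin n), Spans i k A ∧
    tableM q w i k = (weight q w (hull q A) : ℝ) := by
  have hf : {x : EReal | ∃ A : Finset (Fin n), Spans i k A ∧
      x = (weight q w (hull q A) : ℝ)}.Finite := by
    refine (Set.finite_range fun A : Finset (Fin n) => ((weight q w (hull q A) : ℝ) : EReal)).subset
      ?_
    rintro _ ⟨A, -, rfl⟩
    exact ⟨A, rfl⟩
  have hne : {x : EReal | ∃ A : Finset (Fin n), Spans i k A ∧
      x = (weight q w (hull q A) : ℝ)}.Nonempty :=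
    ⟨_, Finset.Icc i k, ⟨by simp [hik], by simp [hik], subset_rfl⟩, rfl⟩
  obtain ⟨A, hA, h⟩ := hne.csSup_mem hf
  exact ⟨A, hA, h⟩

theorem le_iSup_tableM {i k : Fin n} (hik : i ≤ k) :
    tableM q w i k ≤ ⨆ (i : Fin n) (k : Fin n) (_ : i ≤ k), tableM q w i k :=
  (le_iSup (fun _ : i ≤ k => tableM q w i k) hik).trans
    ((le_iSup (fun k => ⨆ (_ : i ≤ k), tableM q w i k) k).trans
      (le_iSup (fun i => ⨆ (k : Fin n) (_ : i ≤ k), tableM q w i k) i))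

theorem iSup_tableM_mem [Nonempty (Fin n)] :
    ∃ P, IsPolytope P ∧
      ⨆ (i : Fin n) (k : Fin n) (_ : i ≤ k), tableM q w i k = (weight q w P : ℝ) := by
  obtain ⟨t⟩ := ‹Nonempty (Fin n)›
  obtain ⟨⟨i, k⟩, hm, hmax⟩ := Finset.exists_max_image
    (Finset.univ.filter fun z : Fin n × Fin n => z.1 ≤ z.2) (fun z => tableM q w z.1 z.2)
    ⟨(t, t), by simp⟩
  simp only [Finset.mem_filter, Finset.mem_univ, true_and] at hm hmax
  obtain ⟨A, -, h⟩ := exists_tableM_eq (q := q) (w := w) hm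
  refine ⟨hull q A, isPolytope_hull _, ?_⟩
  rw [← h]
  exact le_antisymm (iSup_le fun i' => iSup₂_le fun k' h' => hmax (i', k') h') (le_iSup_tableM hm)

theorem weight_le_max {P : Set (ℝ × ℝ)} (hP : IsPolytope P) : (weight q w P : EReal) ≤
    max 0 (⨆ (i : Fin n) (k : Fin n) (_ : i ≤ k), tableM q w i k) := by
  rcases weight_eq_zero_or (w := w) hP with h | ⟨i, k, hik, A, hA, h⟩
  · rw [h]; exact le_max_left _ _
  · rw [h]
    refine le_max_of_le_right (le_trans ?_ (le_iSup_tableM hik))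
    exact le_sSup ⟨A, hA, rfl⟩

theorem isGreatest_weight : IsGreatest {x : EReal | ∃ P, IsPolytope P ∧ x = (weight q w P : ℝ)}
    (max 0 (⨆ (i : Fin n) (k : Fin n) (_ : i ≤ k), tableM q w i k)) := by
  refine ⟨?_, by rintro _ ⟨P, hP, rfl⟩; exact weight_le_max hP⟩
  rcases max_choice 0 (⨆ (i : Fin n) (k : Fin n) (_ : i ≤ k), tableM q w i k) with h | h
  · rw [h]
    exact ⟨hull q ∅, isPolytope_hull _, by rw [weight_empty]; rfl⟩
  · rw [h]
    rcases isEmpty_or_nonempty (Fin n) with he | he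
    -- Without points the supremum is `⊥`, which cannot be the maximum with `0`.
    · simp at h
    · exact iSup_tableM_mem

theorem isGreatest_weight_of_pos (hx : StrictMono fun t => (q t).1) (h : ∃ t, 0 < w t) :
    IsGreatest {x : EReal | ∃ P, IsPolytope P ∧ x = (weight q w P : ℝ)}
      (⨆ (i : Fin n) (k : Fin n) (_ : i ≤ k), tableM q w i k) := by
  obtain ⟨t, ht⟩ := h
  have h₁ := le_iSup_tableM (q := q) (w := w) (le_refl t)
  rw [tableM_self hx] at h₁
  have h₂ : (0 : EReal) ≤ (w t : ℝ) := EReal.coe_nonneg.2 ht.le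
  have := isGreatest_weight (q := q) (w := w)
  rwa [max_eq_right (h₂.trans h₁)] at this

end Tables


/-! ## Structured programs

Programs whose loops all run over `0, …, n - 1`, where `n` is the input size held by word variable
`0`. They have a functional semantics, and their running time and the size of their words can be read
off from the text. -/

/-- Structured programs. -/
inductive SProg where
  | skip
  | setI (x : ℕ) (e : IExp)
  | setR (x : ℕ) (e : RExp)
  | putI (a : ℕ) (idx e : IExp)
  | putR (a : ℕ) (idx : IExp) (e : RExp)
  | seq (c d : SProg)
  | cond (b : BExp) (c d : SProg)
  | rep (x : ℕ) (c : SProg)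

namespace SProg

/-- The program of the random access machine. -/
def compile : SProg → Prog
  | skip => .skip
  | setI x e => .setI x e
  | setR x e => .setR x e
  | putI a idx e => .putI a idx e
  | putR a idx e => .putR a idx e
  | seq c d => .seq c.compile d.compile
  | cond b c d => .cond b c.compile d.compile
  | rep x c => .seq (.setI x (.const 0))
      (.loop (.ilt (.var x) (.var 0)) (.seq c.compile (.setI x (.add (.var x) (.const 1)))))

/-- The memory after `m` rounds of a loop over `x` with body `F`. -/
noncomputable def iter (F : State → State) (x : ℕ) (s : State) : ℕ → State
  | 0 => s.setI x 0
  -- The counter is set, not incremented. This matches the compiled loop because well-formed bodies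
  -- do not write their counter.
  | m + 1 => (F (iter F x s m)).setI x (m + 1)

open Classical in
/-- The final memory. -/
noncomputable def run : SProg → State → State
  | skip, s => s
  | setI x e, s => s.setI x (e.eval s)
  | setR x e, s => s.setR x (e.eval s)
  | putI a idx e, s => s.putI a (idx.eval s) (e.eval s)
  | putR a idx e, s => s.putR a (idx.eval s) (e.eval s)
  | seq c d, s => d.run (c.run s)
  | cond b c d, s => if b.Holds s then c.run s else d.run s
  | rep x c, s => iter c.run x s (s.ivar 0)

/-- The program may change word variable `x`. -/
def wI : SProg → ℕ → Bool
  | setI y _, x => x == y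
  | seq c d, x => c.wI x || d.wI x
  | cond _ c d, x => c.wI x || d.wI x
  | rep y c, x => x == y || c.wI x
  | _, _ => false

/-- The program may change real variable `x`. -/
def wR : SProg → ℕ → Bool
  | setR y _, x => x == y
  | seq c d, x => c.wR x || d.wR x
  | cond _ c d, x => c.wR x || d.wR x
  | rep _ c, x => c.wR x
  | _, _ => false

/-- The program may change word array `x`. -/
def wIA : SProg → ℕ → Bool
  | putI y _ _, x => x == y
  | seq c d, x => c.wIA x || d.wIA x
  | cond _ c d, x => c.wIA x || d.wIA x
  | rep _ c, x => c.wIA x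
  | _, _ => false

/-- The program may change real array `x`. -/
def wRA : SProg → ℕ → Bool
  | putR y _ _, x => x == y
  | seq c d, x => c.wRA x || d.wRA x
  | cond _ c d, x => c.wRA x || d.wRA x
  | rep _ c, x => c.wRA x
  | _, _ => false

end SProg

@[simp] theorem State.setI_ivar (s : State) (x m y : ℕ) :
    (s.setI x m).ivar y = if y = x then m else s.ivar y := by
  simp [State.setI, Function.update_apply]
@[simp] theorem State.setI_rvar (s : State) (x m : ℕ) : (s.setI x m).rvar = s.rvar := rfl
@[simp] theorem State.setI_iarr (s : State) (x m : ℕ) : (s.setI x m).iarr = s.iarr := rfl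
@[simp] theorem State.setI_rarr (s : State) (x m : ℕ) : (s.setI x m).rarr = s.rarr := rfl
@[simp] theorem State.setR_ivar (s : State) (x : ℕ) (r : ℝ) : (s.setR x r).ivar = s.ivar := rfl
@[simp] theorem State.setR_rvar (s : State) (x : ℕ) (r : ℝ) (y : ℕ) :
    (s.setR x r).rvar y = if y = x then r else s.rvar y := by
  simp [State.setR, Function.update_apply]
@[simp] theorem State.setR_iarr (s : State) (x : ℕ) (r : ℝ) : (s.setR x r).iarr = s.iarr := rfl
@[simp] theorem State.setR_rarr (s : State) (x : ℕ) (r : ℝ) : (s.setR x r).rarr = s.rarr := rfl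
@[simp] theorem State.putI_ivar (s : State) (a i m : ℕ) : (s.putI a i m).ivar = s.ivar := rfl
@[simp] theorem State.putI_rvar (s : State) (a i m : ℕ) : (s.putI a i m).rvar = s.rvar := rfl
@[simp] theorem State.putI_iarr (s : State) (a i m b : ℕ) :
    (s.putI a i m).iarr b = if b = a then Function.update (s.iarr a) i m else s.iarr b := by
  simp [State.putI, Function.update_apply]
@[simp] theorem State.putI_rarr (s : State) (a i m : ℕ) : (s.putI a i m).rarr = s.rarr := rfl
@[simp] theorem State.putR_ivar (s : State) (a i : ℕ) (r : ℝ) : (s.putR a i r).ivar = s.ivar := rfl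
@[simp] theorem State.putR_rvar (s : State) (a i : ℕ) (r : ℝ) : (s.putR a i r).rvar = s.rvar := rfl
@[simp] theorem State.putR_iarr (s : State) (a i : ℕ) (r : ℝ) : (s.putR a i r).iarr = s.iarr := rfl
@[simp] theorem State.putR_rarr (s : State) (a i : ℕ) (r : ℝ) (b : ℕ) :
    (s.putR a i r).rarr b = if b = a then Function.update (s.rarr a) i r else s.rarr b := by
  simp [State.putR, Function.update_apply]

/-! ### Frames and loop invariants -/

/-- The memory `s'` agrees with `s` wherever the program `c` does not write. -/
structure Frame (c : SProg) (s s' : State) : Prop where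
  ivar : ∀ x, c.wI x = false → s'.ivar x = s.ivar x
  rvar : ∀ x, c.wR x = false → s'.rvar x = s.rvar x
  iarr : ∀ x, c.wIA x = false → s'.iarr x = s.iarr x
  rarr : ∀ x, c.wRA x = false → s'.rarr x = s.rarr x

namespace SProg

theorem frame_refl (c : SProg) (s : State) : Frame c s s :=
  ⟨fun _ _ => rfl, fun _ _ => rfl, fun _ _ => rfl, fun _ _ => rfl⟩

theorem frame_iter {c : SProg} (hc : ∀ s, Frame c s (c.run s)) (x : ℕ) (s : State) (m : ℕ) :
    Frame (.rep x c) s (iter c.run x s m) := by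
  induction m with
  | zero =>
    constructor <;> intro y hy
    · simp only [wI, Bool.or_eq_false_iff, beq_eq_false_iff_ne] at hy
      simp [iter, hy.1]
    all_goals rfl
  | succ m ih =>
    have h := hc (iter c.run x s m)
    constructor <;> intro y hy
    · have h₁ := ih.ivar y hy
      simp only [wI, Bool.or_eq_false_iff, beq_eq_false_iff_ne] at hy
      simp [iter, hy.1, h.ivar y hy.2, h₁]
    · simp [iter, h.rvar y hy, ih.rvar y hy]
    · simp [iter, h.iarr y hy, ih.iarr y hy]
    · simp [iter, h.rarr y hy, ih.rarr y hy]

/-- The write sets are computable from the program text, so for a concrete program the side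
conditions of a frame hold by `rfl`. -/
theorem frame_run (c : SProg) (s : State) : Frame c s (c.run s) := by
  induction c generalizing s with
  | skip => exact frame_refl _ _
  | setI x e => constructor <;> simp +contextual [run, wI]
  | setR x e => constructor <;> simp +contextual [run, wR]
  | putI a i e => constructor <;> simp +contextual [run, wIA]
  | putR a i e => constructor <;> simp +contextual [run, wRA]
  | seq c d hc hd =>
    constructor <;> intro x hx <;>
      simp only [wI, wR, wIA, wRA, Bool.or_eq_false_iff] at hx <;> rw [run]
    · rw [(hd _).ivar x hx.2, (hc _).ivar x hx.1]
    · rw [(hd _).rvar x hx.2, (hc _).rvar x hx.1]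
    · rw [(hd _).iarr x hx.2, (hc _).iarr x hx.1]
    · rw [(hd _).rarr x hx.2, (hc _).rarr x hx.1]
  | cond b c d hc hd =>
    constructor <;> intro x hx <;>
      simp only [wI, wR, wIA, wRA, Bool.or_eq_false_iff] at hx <;> rw [run] <;> split_ifs
    exacts [(hc _).ivar x hx.1, (hd _).ivar x hx.2, (hc _).rvar x hx.1, (hd _).rvar x hx.2,
      (hc _).iarr x hx.1, (hd _).iarr x hx.2, (hc _).rarr x hx.1, (hd _).rarr x hx.2]
  | rep x c hc => exact frame_iter hc x s _

/-- Loop invariants. -/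
theorem run_rep (x : ℕ) (c : SProg) (s : State) (P : ℕ → State → Prop)
    (h₀ : P 0 (s.setI x 0))
    (hstep : ∀ m < s.ivar 0, ∀ s', Frame (.rep x c) s s' → s'.ivar x = m → P m s' →
      P (m + 1) ((c.run s').setI x (m + 1))) :
    P (s.ivar 0) (run (.rep x c) s) := by
  have key : ∀ m ≤ s.ivar 0, P m (iter c.run x s m) := by
    intro m
    induction m with
    | zero => exact fun _ => h₀
    | succ m ih =>
      intro hm
      refine hstep m hm _ (frame_iter (frame_run c) x s m) ?_ (ih (by omega))
      cases m <;> simp [iter]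
  exact key _ le_rfl

end SProg

/-! ## Safety and running time -/

/-- All words in memory are at most `B`. -/
def State.Words (s : State) (B : ℕ) : Prop :=
  (∀ x, s.ivar x ≤ B) ∧ ∀ a i, s.iarr a i ≤ B

/-- A bound for the words in the evaluation of an expression. -/
def IExp.cap (M : ℕ) : IExp → ℕ
  | .const m => m
  | .var _ => M
  | .get _ e => e.cap M + M
  | .add e f => e.cap M + f.cap M
  | .sub e f => e.cap M + f.cap M
  -- A product can vanish although a factor is large; the extra summands keep the bound above the
  -- bounds of both factors.
  | .mul e f => e.cap M * f.cap M + e.cap M + f.cap M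

theorem IExp.eval_le_cap {s : State} {M : ℕ} (hs : s.Words M) (e : IExp) :
    e.eval s ≤ e.cap M := by
  induction e with
  | const m => exact le_rfl
  | var x => exact hs.1 x
  | get a e ih => exact (hs.2 _ _).trans (Nat.le_add_left _ _)
  | add e f he hf => exact add_le_add he hf
  | sub e f he hf => exact (Nat.sub_le _ _).trans (he.trans (Nat.le_add_right _ _))
  | mul e f he hf =>
    exact (Nat.mul_le_mul he hf).trans (by rw [IExp.cap, add_assoc]; exact Nat.le_add_right _ _)

theorem IExp.safe {s : State} {M W : ℕ} (hs : s.Words M) (e : IExp) (h : e.cap M ≤ W) :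
    e.Safe W s := by
  induction e with
  | const m => exact h
  | var x => exact (hs.1 x).trans h
  | get a e ih => exact ⟨ih (by rw [cap] at h; omega), (hs.2 _ _).trans (by rw [cap] at h; omega)⟩
  | add e f he hf =>
    rw [cap] at h
    exact ⟨he (by omega), hf (by omega),
      (add_le_add (e.eval_le_cap hs) (f.eval_le_cap hs)).trans h⟩
  | sub e f he hf => rw [cap] at h; exact ⟨he (by omega), hf (by omega)⟩
  | mul e f he hf =>
    have h' := (IExp.mul e f).eval_le_cap hs
    rw [cap] at h
    exact ⟨he (by omega), hf (by omega), h'.trans (by rw [cap]; exact h)⟩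

def RExp.cap (M : ℕ) : RExp → ℕ
  | .const _ => 0
  | .var _ => 0
  | .get _ e => e.cap M
  | .add e f => e.cap M + f.cap M
  | .sub e f => e.cap M + f.cap M
  | .mul e f => e.cap M + f.cap M
  | .div e f => e.cap M + f.cap M

/-- The expression contains no division. -/
def RExp.noDiv : RExp → Bool
  | .add e f => e.noDiv && f.noDiv
  | .sub e f => e.noDiv && f.noDiv
  | .mul e f => e.noDiv && f.noDiv
  | .div _ _ => false
  | _ => true

theorem RExp.safe {s : State} {M W : ℕ} (hs : s.Words M) (e : RExp) (h : e.cap M ≤ W)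
    (hd : e.noDiv = true) : e.Safe W s := by
  induction e with
  | const m => trivial
  | var x => trivial
  | get a e => exact e.safe hs h
  | add e f he hf | sub e f he hf | mul e f he hf =>
    simp only [noDiv, Bool.and_eq_true] at hd
    rw [cap] at h
    exact ⟨he (by omega) hd.1, hf (by omega) hd.2⟩
  | div e f => simp [noDiv] at hd

def BExp.cap (M : ℕ) : BExp → ℕ
  | .ilt e f => e.cap M + f.cap M
  | .ieq e f => e.cap M + f.cap M
  | .rlt e f => e.cap M + f.cap M
  | .req e f => e.cap M + f.cap M
  | .neg b => b.cap M
  | .conj b c => b.cap M + c.cap M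

def BExp.noDiv : BExp → Bool
  | .rlt e f => e.noDiv && f.noDiv
  | .req e f => e.noDiv && f.noDiv
  | .neg b => b.noDiv
  | .conj b c => b.noDiv && c.noDiv
  | _ => true

theorem BExp.safe {s : State} {M W : ℕ} (hs : s.Words M) (b : BExp) (h : b.cap M ≤ W)
    (hd : b.noDiv = true) : b.Safe W s := by
  induction b with
  | ilt e f => rw [cap] at h; exact ⟨e.safe hs (by omega), f.safe hs (by omega)⟩
  | ieq e f => rw [cap] at h; exact ⟨e.safe hs (by omega), f.safe hs (by omega)⟩
  | rlt e f | req e f =>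
    simp only [noDiv, Bool.and_eq_true] at hd
    rw [cap] at h
    exact ⟨e.safe hs (by omega) hd.1, f.safe hs (by omega) hd.2⟩
  | neg b ih => exact ih h hd
  | conj b c hb hc =>
    simp only [noDiv, Bool.and_eq_true] at hd
    rw [cap] at h
    exact ⟨hb (by omega) hd.1, hc (by omega) hd.2⟩

/-- The value of the expression exceeds the words in memory by at most one. -/
def IExp.slow : IExp → Bool
  | .const m => m ≤ 1
  | .var _ => true
  | .get _ _ => true
  | .sub (.var _) _ => true
  | .sub (.sub (.var _) _) _ => true
  | .add (.var _) (.const m) => m ≤ 1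
  | _ => false

/-- One assignment raises the bound on the words in memory by at most one, so the running time
controls their size. Products occur only in addresses, which are not stored. -/
theorem IExp.eval_le_of_slow {s : State} {B : ℕ} (hs : s.Words B) {e : IExp}
    (he : e.slow = true) : e.eval s ≤ B + 1 := by
  unfold slow at he
  split at he
  · simp at he; simp only [eval]; omega
  · exact (hs.1 _).trans (Nat.le_succ _)
  · exact (hs.2 _ _).trans (Nat.le_succ _)
  · exact (Nat.sub_le _ _).trans ((hs.1 _).trans (Nat.le_succ _))
  · exact (Nat.sub_le _ _).trans ((Nat.sub_le _ _).trans ((hs.1 _).trans (Nat.le_succ _)))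
  · simp at he; have := hs.1; simp only [eval]; exact add_le_add (hs.1 _) he
  · simp at he

theorem State.Words.mono {s : State} {B B' : ℕ} (hs : s.Words B) (h : B ≤ B') : s.Words B' :=
  ⟨fun x => (hs.1 x).trans h, fun a i => (hs.2 a i).trans h⟩

theorem State.Words.setI {s : State} {B : ℕ} (hs : s.Words B) {x m : ℕ} (h : m ≤ B) :
    (s.setI x m).Words B := by
  refine ⟨fun y => ?_, hs.2⟩
  rw [State.setI_ivar]
  split_ifs
  exacts [h, hs.1 y]

theorem State.Words.putI {s : State} {B : ℕ} (hs : s.Words B) {a i m : ℕ} (h : m ≤ B) :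
    (s.putI a i m).Words B := by
  refine ⟨hs.1, fun b j => ?_⟩
  rw [State.putI_iarr]
  split_ifs
  · rw [Function.update_apply]
    split_ifs
    exacts [h, hs.2 _ _]
  · exact hs.2 _ _

namespace SProg

/-- Well-formed programs: loops do not change their counters or the input size, there is no
division, and stored words grow slowly. -/
def wf : SProg → Bool
  | skip => true
  | setI x e => e.slow && x != 0
  | setR _ e => e.noDiv
  | putI _ _ e => e.slow
  | putR _ _ e => e.noDiv
  | seq c d => c.wf && d.wf
  | cond b c d => b.noDiv && c.wf && d.wf
  | rep x c => c.wf && !c.wI x && x != 0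

/-- A bound for the running time with input size `n`. -/
def time (n : ℕ) : SProg → ℕ
  | skip => 1
  | setI _ e => e.cost + 1
  | setR _ e => e.cost + 1
  | putI _ i e => i.cost + e.cost + 1
  | putR _ i e => i.cost + e.cost + 1
  | seq c d => c.time n + d.time n
  | cond b c d => b.cost + 1 + c.time n + d.time n
  -- Initializing the counter costs 2 and the final failing test 4; each round pays 4 for the test
  -- and 4 for the increment.
  | rep _ c => 6 + n * (c.time n + 8)

/-- A bound for the words that occur if the words in memory are at most `M`. -/
def cap (M : ℕ) : SProg → ℕ
  | skip => 0
  | setI _ e => e.cap M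
  | setR _ e => e.cap M
  | putI _ i e => i.cap M + e.cap M
  | putR _ i e => i.cap M + e.cap M
  | seq c d => c.cap M + d.cap M
  | cond b c d => b.cap M + c.cap M + d.cap M
  | rep _ c => c.cap M + 2 * M + 1

/-- The depth of nested loops. -/
def depth : SProg → ℕ
  | seq c d => max c.depth d.depth
  | cond _ c d => max c.depth d.depth
  | rep _ c => c.depth + 1
  | _ => 0

theorem wI_zero {c : SProg} (hc : c.wf = true) : c.wI 0 = false := by
  induction c with
  | skip | setR | putI | putR => rfl
  | setI x e =>
    simp only [wf, Bool.and_eq_true, bne_iff_ne] at hc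
    simpa [wI] using hc.2.symm
  | seq c d ihc ihd =>
    simp only [wf, Bool.and_eq_true] at hc
    simp [wI, ihc hc.1, ihd hc.2]
  | cond b c d ihc ihd =>
    simp only [wf, Bool.and_eq_true] at hc
    simp [wI, ihc hc.1.2, ihd hc.2]
  | rep x c ih =>
    simp only [wf, Bool.and_eq_true, bne_iff_ne] at hc
    simpa [wI, ih hc.1.1] using hc.2.symm

/-- The bound `B` on the words grows along the run by at most the time spent, hence never beyond
`M`. Every intermediate value is then at most `cap M`, so no overflow occurs and the machine follows
the functional semantics. -/
theorem exec_compile {M W : ℕ} (c : SProg) (hc : c.wf = true) (hW : c.cap M ≤ W) (s : State)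
    {B n : ℕ} (hn : s.ivar 0 = n) (hs : s.Words B) (hM : B + c.time n ≤ M) :
    (∃ t ≤ c.time n, Exec W c.compile s t (c.run s)) ∧ (c.run s).Words (B + c.time n) := by
  induction c generalizing s B with
  | skip => exact ⟨⟨1, le_rfl, .skip s⟩, hs.mono (by omega)⟩
  | setI x e =>
    simp only [wf, Bool.and_eq_true] at hc
    have h := e.eval_le_of_slow hs hc.1
    have hM' := hs.mono (show B ≤ M by omega)
    rw [time] at hM ⊢
    exact ⟨⟨_, le_rfl, .setI s x e (e.safe hM' hW)⟩, (hs.mono (by omega)).setI (by omega)⟩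
  | setR x e =>
    have hM' := hs.mono (show B ≤ M by omega)
    exact ⟨⟨_, le_rfl, .setR s x e (e.safe hM' hW hc)⟩, hs.mono (by omega)⟩
  | putI a i e =>
    have h := e.eval_le_of_slow hs hc
    have hM' := hs.mono (show B ≤ M by omega)
    rw [cap] at hW
    rw [time] at hM ⊢
    exact ⟨⟨_, le_rfl, .putI s a i e (i.safe hM' (by omega)) (e.safe hM' (by omega))⟩,
      (hs.mono (by omega)).putI (by omega)⟩
  | putR a i e =>
    have hM' := hs.mono (show B ≤ M by omega)
    rw [cap] at hW
    exact ⟨⟨_, le_rfl, .putR s a i e (i.safe hM' (by omega)) (e.safe hM' (by omega) hc)⟩,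
      hs.mono (by omega)⟩
  | seq c d ihc ihd =>
    simp only [wf, Bool.and_eq_true] at hc
    rw [cap] at hW
    rw [time] at hM ⊢
    obtain ⟨⟨t₁, ht₁, h₁⟩, hw₁⟩ := ihc hc.1 (by omega) s hn hs (by omega)
    have hn' : (c.run s).ivar 0 = n := by rw [(c.frame_run s).ivar 0 (wI_zero hc.1), hn]
    obtain ⟨⟨t₂, ht₂, h₂⟩, hw₂⟩ := ihd hc.2 (by omega) _ hn' hw₁ (by omega)
    exact ⟨⟨t₁ + t₂, add_le_add ht₁ ht₂, .seq _ _ _ _ _ _ _ h₁ h₂⟩, hw₂.mono (by omega)⟩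
  | cond b c d ihc ihd =>
    simp only [wf, Bool.and_eq_true] at hc
    rw [cap] at hW
    rw [time] at hM ⊢
    have hb := b.safe (hs.mono (show B ≤ M by omega)) (by omega : b.cap M ≤ W) hc.1.1
    rw [run]
    split_ifs with h
    · obtain ⟨⟨t, ht, h'⟩, hw⟩ := ihc hc.1.2 (by omega) s hn hs (by omega)
      exact ⟨⟨_, by omega, .condTrue _ _ _ _ _ _ hb h h'⟩, hw.mono (by omega)⟩
    · obtain ⟨⟨t, ht, h'⟩, hw⟩ := ihd hc.2 (by omega) s hn hs (by omega)
      exact ⟨⟨_, by omega, .condFalse _ _ _ _ _ _ hb h h'⟩, hw.mono (by omega)⟩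
  | rep x c ih =>
    simp only [wf, Bool.and_eq_true, Bool.not_eq_true', bne_iff_ne] at hc
    rw [cap] at hW
    rw [time] at hM ⊢
    have hnB : n ≤ B := hn ▸ hs.1 0
    have hfr := frame_iter (frame_run c) x s
    have h0 : ∀ m, (iter c.run x s m).ivar 0 = n := fun m => by
      rw [(hfr m).ivar 0 (by simpa [wI, wI_zero hc.1.1] using hc.2.symm), hn]
    have hx : ∀ m, (iter c.run x s m).ivar x = m := fun m => by cases m <;> simp [iter]
    -- After `m` rounds the budget still covers one more.
    have hmul : ∀ m, m < n → m * (c.time n + 8) + c.time n + 8 ≤ n * (c.time n + 8) := by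
      intro m hm
      have := Nat.mul_le_mul_right (c.time n + 8) (show m + 1 ≤ n from hm)
      rw [add_mul] at this
      omega
    have hw : ∀ m ≤ n, (iter c.run x s m).Words (B + m * (c.time n + 8)) := by
      intro m
      induction m with
      | zero => intro _; rw [iter]; exact (hs.mono (by omega)).setI (by omega)
      | succ m ihm =>
        intro hm
        have h₁ := hmul m hm
        have h₂ := (ih hc.1.1 (by omega) _ (h0 m) (ihm (by omega)) (by omega)).2
        rw [iter, add_mul]
        exact (h₂.mono (by omega)).setI (by omega)
    -- Induction on the number of remaining rounds, since a loop execution consists of one round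
    -- followed by the execution of the rest.
    have hloop : ∀ r m, m + r = n → ∃ t ≤ 4 + r * (c.time n + 8),
        Exec W (.loop (.ilt (.var x) (.var 0)) (.seq c.compile (.setI x (.add (.var x) (.const 1)))))
          (iter c.run x s m) t (iter c.run x s n) := by
      intro r
      induction r with
      | zero =>
        rintro m rfl
        refine ⟨4, by omega, .loopFalse _ _ _ ⟨?_, ?_⟩ ?_⟩
        · rw [IExp.Safe, hx]; omega
        · rw [IExp.Safe, h0]; omega
        · simp [BExp.Holds, IExp.eval, hx, h0]
      | succ r ihr =>
        rintro m hm
        have h₁ := hmul m (by omega)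
        obtain ⟨t₂, ht₂, h₂⟩ := ihr (m + 1) (by omega)
        obtain ⟨⟨t₁, ht₁, h₃⟩, -⟩ := ih hc.1.1 (by omega) _ (h0 m) (hw m (by omega)) (by omega)
        have hx' : (c.run (iter c.run x s m)).ivar x = m := by
          rw [(frame_run c _).ivar x hc.1.2, hx]
        have h₄ : Exec W (.setI x (.add (.var x) (.const 1))) (c.run (iter c.run x s m)) 4
            (iter c.run x s (m + 1)) := by
          have := Exec.setI (W := W) (c.run (iter c.run x s m)) x (.add (.var x) (.const 1))
            ⟨by rw [IExp.Safe, hx']; omega, by rw [IExp.Safe]; omega,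
              by simp only [IExp.eval, hx']; omega⟩
          simpa [IExp.eval, IExp.cost, hx', iter] using this
        refine ⟨_, ?_, .loopTrue _ _ _ _ _ _ _ ⟨?_, ?_⟩ ?_ (.seq _ _ _ _ _ _ _ h₃ h₄) h₂⟩
        · simp only [BExp.cost, IExp.cost]; rw [add_mul]; omega
        · rw [IExp.Safe, hx]; omega
        · rw [IExp.Safe, h0]; omega
        · simp only [BExp.Holds, IExp.eval, hx, h0]; omega
    obtain ⟨t, ht, h⟩ := hloop n 0 (by omega)
    rw [run, hn]
    refine ⟨⟨2 + t, by omega, .seq _ _ _ _ _ _ _ (.setI s x (.const 0) (Nat.zero_le _)) h⟩,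
      (hw n le_rfl).mono (by omega)⟩

theorem time_le (c : SProg) : ∃ K, ∀ n, c.time n ≤ K * (n + 1) ^ c.depth := by
  have atom : ∀ K : ℕ, ∃ K', ∀ n : ℕ, K ≤ K' * (n + 1) ^ 0 := fun K => ⟨K, by simp⟩
  have up : ∀ {K d d' n : ℕ}, d ≤ d' → K * (n + 1) ^ d ≤ K * (n + 1) ^ d' := fun h =>
    Nat.mul_le_mul_left _ (Nat.pow_le_pow_right (Nat.succ_pos _) h)
  induction c with
  | skip | setI | setR | putI | putR => exact atom _
  | seq c d hc hd =>
    obtain ⟨K, hK⟩ := hc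
    obtain ⟨L, hL⟩ := hd
    refine ⟨K + L, fun n => ?_⟩
    rw [time, depth, add_mul]
    exact add_le_add ((hK n).trans (up (le_max_left _ _))) ((hL n).trans (up (le_max_right _ _)))
  | cond b c d hc hd =>
    obtain ⟨K, hK⟩ := hc
    obtain ⟨L, hL⟩ := hd
    refine ⟨b.cost + 1 + K + L, fun n => ?_⟩
    rw [time, depth, add_mul, add_mul]
    refine add_le_add (add_le_add ?_ ((hK n).trans (up (le_max_left _ _))))
      ((hL n).trans (up (le_max_right _ _)))
    exact Nat.le_mul_of_pos_right _ (by positivity)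
  | rep x c hc =>
    obtain ⟨K, hK⟩ := hc
    -- The 14 absorbs the constants 6 and 8 of `time`.
    refine ⟨K + 14, fun n => ?_⟩
    rw [time, depth, pow_succ]
    have h₁ := Nat.mul_le_mul_left n (Nat.add_le_add_right (hK n) 8)
    have h₂ : 1 ≤ (n + 1) ^ c.depth := Nat.one_le_pow _ _ (by omega)
    nlinarith

end SProg

/-- The function is bounded by a polynomial. -/
def PolyBounded (g : ℕ → ℕ) : Prop := ∃ A d, ∀ M, g M ≤ A * (M + 1) ^ d

theorem polyBounded_const (m : ℕ) : PolyBounded fun _ => m := ⟨m, 0, by simp⟩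

theorem polyBounded_id : PolyBounded fun M => M := ⟨1, 1, by simp⟩

theorem PolyBounded.add {g h : ℕ → ℕ} (hg : PolyBounded g) (hh : PolyBounded h) :
    PolyBounded fun M => g M + h M := by
  obtain ⟨A, d, hA⟩ := hg
  obtain ⟨B, e, hB⟩ := hh
  refine ⟨A + B, d + e, fun M => ?_⟩
  rw [add_mul]
  exact add_le_add
    ((hA M).trans (Nat.mul_le_mul_left _ (Nat.pow_le_pow_right (by omega) (by omega))))
    ((hB M).trans (Nat.mul_le_mul_left _ (Nat.pow_le_pow_right (by omega) (by omega))))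

theorem PolyBounded.mul {g h : ℕ → ℕ} (hg : PolyBounded g) (hh : PolyBounded h) :
    PolyBounded fun M => g M * h M := by
  obtain ⟨A, d, hA⟩ := hg
  obtain ⟨B, e, hB⟩ := hh
  refine ⟨A * B, d + e, fun M => (Nat.mul_le_mul (hA M) (hB M)).trans_eq ?_⟩
  rw [pow_add]; ring

theorem IExp.polyBounded_cap (e : IExp) : PolyBounded fun M => e.cap M := by
  induction e with
  | const m => exact polyBounded_const m
  | var x => exact polyBounded_id
  | get a e ih => exact ih.add polyBounded_id
  | add e f he hf | sub e f he hf => exact he.add hf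
  | mul e f he hf => exact ((he.mul hf).add he).add hf

theorem RExp.polyBounded_cap (e : RExp) : PolyBounded fun M => e.cap M := by
  induction e with
  | const | var => exact polyBounded_const 0
  | get a e => exact e.polyBounded_cap
  | add e f he hf | sub e f he hf | mul e f he hf | div e f he hf => exact he.add hf

theorem BExp.polyBounded_cap (b : BExp) : PolyBounded fun M => b.cap M := by
  induction b with
  | ilt e f | ieq e f => exact e.polyBounded_cap.add f.polyBounded_cap
  | rlt e f | req e f => exact e.polyBounded_cap.add f.polyBounded_cap
  | neg b ih => exact ih
  | conj b c hb hc => exact hb.add hc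

theorem SProg.polyBounded_cap (c : SProg) : PolyBounded fun M => c.cap M := by
  induction c with
  | skip => exact polyBounded_const 0
  | setI x e => exact e.polyBounded_cap
  | setR x e => exact e.polyBounded_cap
  | putI a i e => exact i.polyBounded_cap.add e.polyBounded_cap
  | putR a i e => exact i.polyBounded_cap.add e.polyBounded_cap
  | seq c d hc hd => exact hc.add hd
  | cond b c d hc hd => exact (b.polyBounded_cap.add hc).add hd
  | rep x c hc => exact (hc.add ((polyBounded_const 2).mul polyBounded_id)).add (polyBounded_const 1)

/-- A well-formed program with loops nested at most three deep runs in time `O(n ^ 3)` with words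
of `O(log n)` bits. -/
theorem SProg.exec_of_depth_le (c : SProg) (hc : c.wf = true) (hd : c.depth ≤ 3) :
    ∃ K e, ∀ n s, s.ivar 0 = n → s.Words n →
      ∃ t, Exec (K * (n + 1) ^ e) c.compile s t (c.run s) ∧ t ≤ K * (n + 1) ^ 3 := by
  obtain ⟨K, hK⟩ := c.time_le
  obtain ⟨A, d, hA⟩ := c.polyBounded_cap
  -- The words in memory are at most `n` plus the time, which is below `(K + 2) * (n + 1) ^ 3`; a
  -- bound of degree `d` in this quantity has degree `3 * d` in `n + 1`.
  refine ⟨max K (A * (K + 2) ^ d), 3 * d, fun n s hn hs => ?_⟩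
  have hpos : 1 ≤ (n + 1) ^ 3 := Nat.one_le_pow _ _ (by omega)
  have hT : c.time n ≤ K * (n + 1) ^ 3 := (hK n).trans
    (Nat.mul_le_mul_left _ (Nat.pow_le_pow_right (by omega) hd))
  have hcap : c.cap (n + c.time n) ≤ max K (A * (K + 2) ^ d) * (n + 1) ^ (3 * d) := by
    refine (hA _).trans ?_
    have h₁ : n + 1 ≤ (n + 1) ^ 3 := Nat.le_self_pow (by omega) _
    have h₂ : n + c.time n + 1 ≤ (K + 2) * (n + 1) ^ 3 := by nlinarith
    calc A * (n + c.time n + 1) ^ d ≤ A * ((K + 2) * (n + 1) ^ 3) ^ d :=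
          Nat.mul_le_mul_left _ (Nat.pow_le_pow_left h₂ _)
      _ = A * (K + 2) ^ d * (n + 1) ^ (3 * d) := by rw [mul_pow, pow_mul, mul_assoc]
      _ ≤ _ := Nat.mul_le_mul_right _ (le_max_right _ _)
  obtain ⟨⟨t, ht, h⟩, -⟩ := c.exec_compile hc hcap s hn hs le_rfl
  exact ⟨t, h, ht.trans (hT.trans (Nat.mul_le_mul_right _ (le_max_left _ _)))⟩


/-! ## Rules for loops -/

namespace SProg

theorem run_cond_iff {b : BExp} {s : State} {p : Prop} [Decidable p] (h : b.Holds s ↔ p)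
    (c d : SProg) : run (.cond b c d) s = if p then run c s else run d s := by
  rw [run]
  by_cases hp : p
  · rw [if_pos hp, if_pos (h.2 hp)]
  · rw [if_neg hp, if_neg (mt h.1 hp)]

/-- A loop that processes the numbers below the input size one after the other. -/
theorem run_rep_set (x : ℕ) (c : SProg) (s : State) (P : Set ℕ → State → Prop)
    (hP : ∀ D s' m, P D s' → P D (s'.setI x m)) (h₀ : P ∅ s)
    (hstep : ∀ m < s.ivar 0, ∀ s' D, Frame (.rep x c) s s' → s'.ivar x = m →
      (∀ i ∈ D, i < m) → P D s' → P (insert m D) (c.run s')) :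
    P {m | m < s.ivar 0} (run (.rep x c) s) := by
  refine run_rep x c s (fun m s' => P {i | i < m} s') ?_ ?_
  · have : {i : ℕ | i < 0} = ∅ := by ext; simp
    rw [this]
    exact hP _ _ _ h₀
  · intro m hm s' hf hx h
    have : {i | i < m + 1} = insert m {i | i < m} := by
      ext i; simp only [Set.mem_insert_iff, Set.mem_ofPred_eq]; omega
    rw [this]
    exact hP _ _ _ (hstep m hm s' _ hf hx (fun i hi => hi) h)

/-- Two nested loops that process all pairs of numbers below the input size. -/
theorem run_rep_rep_set (x y : ℕ) (hxy : x ≠ y) (c : SProg) (hcx : c.wI x = false)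
    (hc0 : (rep x (rep y c)).wI 0 = false) (s : State)
    (P : Set (ℕ × ℕ) → State → Prop)
    (hP : ∀ D s' m, P D s' → P D (s'.setI x m)) (hP' : ∀ D s' m, P D s' → P D (s'.setI y m))
    (h₀ : P ∅ s)
    (hstep : ∀ i < s.ivar 0, ∀ j < s.ivar 0, ∀ s' D, Frame (.rep x (.rep y c)) s s' →
      s'.ivar x = i → s'.ivar y = j → P D s' → P (insert (i, j) D) (c.run s')) :
    P {z | z.1 < s.ivar 0 ∧ z.2 < s.ivar 0} (run (.rep x (.rep y c)) s) := by
  have := run_rep_set x (.rep y c) s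
    (fun D s' => P {z | z.1 ∈ D ∧ z.2 < s.ivar 0} s') (fun D s' m h => hP _ _ _ h) (by
      have : {z : ℕ × ℕ | z.1 ∈ (∅ : Set ℕ) ∧ z.2 < s.ivar 0} = ∅ := by ext; simp
      rw [this]; exact h₀) ?_
  · exact this
  · intro i hi s' D hf hx _ h
    have h0 : s'.ivar 0 = s.ivar 0 := hf.ivar 0 hc0
    have := run_rep_set y c s'
      (fun D' s'' => P ({z | z.1 ∈ D ∧ z.2 < s.ivar 0} ∪ {z | z.1 = i ∧ z.2 ∈ D'}) s'')
      (fun D s' m h => hP' _ _ _ h) (by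
        have : {z : ℕ × ℕ | z.1 ∈ D ∧ z.2 < s.ivar 0} ∪ {z | z.1 = i ∧ z.2 ∈ (∅ : Set ℕ)}
          = {z : ℕ × ℕ | z.1 ∈ D ∧ z.2 < s.ivar 0} := by ext; simp
        rw [this]; exact h) ?_
    · have e : {z : ℕ × ℕ | z.1 ∈ insert i D ∧ z.2 < s.ivar 0} =
          {z | z.1 ∈ D ∧ z.2 < s.ivar 0} ∪ {z | z.1 = i ∧ z.2 ∈ {m | m < s'.ivar 0}} := by
        ext z
        simp only [Set.mem_insert_iff, Set.mem_ofPred_eq, Set.mem_union, h0]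
        tauto
      simp only [e]
      exact this
    · intro j hj s'' D' hf' hy _ h'
      have e : {z : ℕ × ℕ | z.1 ∈ D ∧ z.2 < s.ivar 0} ∪ {z | z.1 = i ∧ z.2 ∈ insert j D'}
          = insert (i, j) ({z | z.1 ∈ D ∧ z.2 < s.ivar 0} ∪ {z | z.1 = i ∧ z.2 ∈ D'}) := by
        ext z
        simp only [Set.mem_insert_iff, Set.mem_ofPred_eq, Set.mem_union, Prod.ext_iff]
        tauto
      rw [e]
      refine hstep i hi j (by omega) s'' _ ?_ ?_ hy h'
      · constructor <;> intro a ha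
        · rw [hf'.ivar a (by simp [wI] at ha ⊢; tauto), hf.ivar a ha]
        · rw [hf'.rvar a ha, hf.rvar a ha]
        · rw [hf'.iarr a ha, hf.iarr a ha]
        · rw [hf'.rarr a ha, hf.rarr a ha]
      · rw [hf'.ivar x (by simp [wI, hxy, hcx]), hx]

/-- A loop that counts the numbers that pass a test. -/
theorem run_count (x r : ℕ) (hxr : r ≠ x) (b : BExp) (s : State) (p : ℕ → Prop)
    [DecidablePred p]
    (hb : ∀ m < s.ivar 0, ∀ s', Frame (.rep x (.cond b (.setI r (.add (.var r) (.const 1))) .skip))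
      s s' → s'.ivar x = m → (b.Holds s' ↔ p m)) :
    (run (.rep x (.cond b (.setI r (.add (.var r) (.const 1))) .skip)) s).ivar r =
      s.ivar r + Nat.count p (s.ivar 0) := by
  refine run_rep x _ s (fun m s' => s'.ivar r = s.ivar r + Nat.count p m) (by simp [hxr]) ?_
  intro m hm s' hf hx h
  have := hb m hm s' hf hx
  rw [run, Nat.count_succ]
  by_cases hp : p m
  · simp [this.2 hp, hp, run, hxr, IExp.eval, h, add_assoc]
  · simp [mt this.1 hp, hp, run, hxr, h]

end SProg

/-- The address `i * n + j`. -/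
def addr2 (i j : ℕ) : IExp := .add (.mul (.var i) (.var 0)) (.var j)

/-- The address `(i * n + j) * n + k`. -/
def addr3 (i j k : ℕ) : IExp := .add (.mul (addr2 i j) (.var 0)) (.var k)

@[simp] theorem addr2_eval (i j : ℕ) (s : State) :
    (addr2 i j).eval s = s.ivar i * s.ivar 0 + s.ivar j := rfl

@[simp] theorem addr3_eval (i j k : ℕ) (s : State) :
    (addr3 i j k).eval s = (s.ivar i * s.ivar 0 + s.ivar j) * s.ivar 0 + s.ivar k := rfl

theorem addr_inj {n i j i' j' : ℕ} (hj : j < n) (hj' : j' < n) :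
    i * n + j = i' * n + j' ↔ i = i' ∧ j = j' := by
  constructor
  · intro h
    have h₁ : (i * n + j) / n = i := by
      rw [mul_comm, Nat.mul_add_div (by omega), Nat.div_eq_of_lt hj, add_zero]
    have h₂ : (i' * n + j') / n = i' := by
      rw [mul_comm, Nat.mul_add_div (by omega), Nat.div_eq_of_lt hj', add_zero]
    have h₃ : i = i' := by rw [← h₁, ← h₂, h]
    subst h₃
    exact ⟨rfl, by omega⟩
  · rintro ⟨rfl, rfl⟩; rfl

theorem addr3_inj {n i j k i' j' k' : ℕ} (hj : j < n) (hj' : j' < n) (hk : k < n) (hk' : k' < n) :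
    (i * n + j) * n + k = (i' * n + j') * n + k' ↔ i = i' ∧ j = j' ∧ k = k' := by
  rw [addr_inj hk hk', addr_inj hj hj', and_assoc]

/-! ## Choosing the axes -/

/-- Turns the axis if the points with indices in word variables `3` and `4` require it. -/
def turnAxis : SProg :=
  .cond (.conj (.rlt (.const 0) (.var 3))
      (.neg (.rlt (.mul (.var 2) (.var 4)) (.mul (.var 1) (.var 3)))))
    (.seq (.setR 1 (.mul (.const 2) (.var 4))) (.setR 2 (.var 3))) .skip

/-- Records whether two points have the same first coordinate. -/
def recordTie : SProg :=
  .cond (.conj (.neg (.ieq (.var 3) (.var 4))) (.req (.var 3) (.const 0)))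
    (.setI 2 (.const 1)) .skip

/-- For a pair `i`, `j`, real variable `3` receives the difference of abscissas `x i - x j` and real
variable `4` the opposite difference of ordinates `y j - y i`. The direction `(a, b)` keeps the pair
in order when `b * (y j - y i) < a * (x i - x j)`. -/
def axesStep : SProg :=
  .seq (.setR 3 (.sub (.get 0 (.var 3)) (.get 0 (.var 4)))) <|
  .seq (.setR 4 (.sub (.get 1 (.var 4)) (.get 1 (.var 3)))) <|
  .seq turnAxis recordTie

def axesLoop : SProg := .rep 3 (.rep 4 axesStep)

/-- Finds a direction in which no two points have the same first coordinate. -/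
def chooseAxes : SProg :=
  .seq (.setR 1 (.const 1)) <| .seq (.setR 2 (.const 1)) <| .seq (.setI 2 (.const 0)) <|
  .seq axesLoop <|
  .cond (.ieq (.var 2) (.const 0)) (.seq (.setR 1 (.const 1)) (.setR 2 (.const 0))) .skip

/-- A violated condition `b * v < a * u` with `u > 0` forces `v > 0`, and the direction `(2 * v, u)`
satisfies it with a factor two to spare. This turns the axis towards the old one, because `u / (2 *
v) < b / a`, so all conditions already established survive. -/
theorem turnAxis_spec (s : State) (ha : 0 < s.rvar 1) (hb : 0 < s.rvar 2) :
    0 < (turnAxis.run s).rvar 1 ∧ 0 < (turnAxis.run s).rvar 2 ∧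
    (0 < s.rvar 3 → (turnAxis.run s).rvar 2 * s.rvar 4 < (turnAxis.run s).rvar 1 * s.rvar 3) ∧
    ∀ u v, 0 < u → s.rvar 2 * v < s.rvar 1 * u →
      (turnAxis.run s).rvar 2 * v < (turnAxis.run s).rvar 1 * u := by
  rw [turnAxis, SProg.run_cond_iff
    (p := 0 < s.rvar 3 ∧ s.rvar 1 * s.rvar 3 ≤ s.rvar 2 * s.rvar 4) (by
      simp [BExp.Holds, RExp.eval])]
  split_ifs with h
  · obtain ⟨h₁, h₂⟩ := h
    have h₃ : 0 < s.rvar 2 * s.rvar 4 := (mul_pos ha h₁).trans_le h₂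
    have h₄ : 0 < s.rvar 4 := (mul_pos_iff_of_pos_left hb).1 h₃
    simp only [SProg.run, RExp.eval, State.setR_rvar]
    norm_num
    refine ⟨h₄, h₁, fun _ => by nlinarith, fun u v hu huv => ?_⟩
    rcases le_or_gt v 0 with hv | hv
    · nlinarith [mul_pos h₄ hu]
    -- Chain the old condition, multiplied by real variable `3`, with the violated one, multiplied
    -- by `u`; the common factor `b` is cancelled afterwards.
    · have h₅ : s.rvar 2 * (s.rvar 3 * v) < s.rvar 2 * (s.rvar 4 * u) := by
        nlinarith [mul_lt_mul_of_pos_left huv h₁, mul_le_mul_of_nonneg_left h₂ hu.le]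
      nlinarith [lt_of_mul_lt_mul_left h₅ hb.le, mul_pos h₄ hu]
  · simp only [SProg.run]
    refine ⟨ha, hb, fun h' => ?_, fun _ _ _ h => h⟩
    simpa [h'] using h

theorem recordTie_spec (s : State) : (recordTie.run s).ivar 2 =
    if s.ivar 3 ≠ s.ivar 4 ∧ s.rvar 3 = 0 then 1 else s.ivar 2 := by
  rw [recordTie, SProg.run_cond_iff (p := s.ivar 3 ≠ s.ivar 4 ∧ s.rvar 3 = 0) (by
      simp [BExp.Holds, RExp.eval, IExp.eval])]
  split_ifs with h <;> simp [SProg.run, IExp.eval]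

theorem axesLoop_spec (s : State) {n : ℕ} (hn : s.ivar 0 = n) {x y : ℕ → ℝ}
    (hx : s.rarr 0 = x) (hy : s.rarr 1 = y) (h1 : s.rvar 1 = 1) (h2 : s.rvar 2 = 1)
    (hi : s.ivar 2 = 0) :
    0 < (axesLoop.run s).rvar 1 ∧ 0 < (axesLoop.run s).rvar 2 ∧
    (∀ i < n, ∀ j < n, x j < x i →
      (axesLoop.run s).rvar 2 * (y j - y i) < (axesLoop.run s).rvar 1 * (x i - x j)) ∧
    (((axesLoop.run s).ivar 2 = 0 ∧ ∀ i < n, ∀ j < n, i ≠ j → x i ≠ x j) ∨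
      ((axesLoop.run s).ivar 2 = 1 ∧ ∃ i < n, ∃ j < n, i ≠ j ∧ x i = x j)) := by
  have := SProg.run_rep_rep_set 3 4 (by decide) axesStep rfl rfl s (fun D s' =>
    0 < s'.rvar 1 ∧ 0 < s'.rvar 2 ∧
    (∀ z ∈ D, x z.2 < x z.1 → s'.rvar 2 * (y z.2 - y z.1) < s'.rvar 1 * (x z.1 - x z.2)) ∧
    ((s'.ivar 2 = 0 ∧ ∀ z ∈ D, z.1 ≠ z.2 → x z.1 ≠ x z.2) ∨
      (s'.ivar 2 = 1 ∧ ∃ i < n, ∃ j < n, i ≠ j ∧ x i = x j))) ?_ ?_ ?_ ?_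
  · obtain ⟨h₁, h₂, h₃, h₄⟩ := this
    refine ⟨h₁, h₂, fun i hi j hj => h₃ (i, j) ⟨by omega, by omega⟩, ?_⟩
    refine h₄.imp_left fun h => ⟨h.1, fun i hi j hj => h.2 (i, j) ⟨by omega, by omega⟩⟩
  · intro D s' m h; simpa using h
  · intro D s' m h; simpa using h
  · simp [h1, h2, hi]
  · intro i hi j hj s' D hf h3 h4 ⟨ha, hb, h₁, h₂⟩
    have hx' : s'.rarr 0 = x := by rw [hf.rarr 0 rfl, hx]
    have hy' : s'.rarr 1 = y := by rw [hf.rarr 1 rfl, hy]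
    set s₂ := (s'.setR 3 (x i - x j)).setR 4 (y j - y i) with hs₂
    have hrun : axesStep.run s' = recordTie.run (turnAxis.run s₂) := by
      simp only [axesStep, SProg.run, RExp.eval, IExp.eval, State.setR_ivar, State.setR_rarr,
        h3, h4, hx', hy', hs₂]
    obtain ⟨t₁, t₂, t₃, t₄⟩ := turnAxis_spec s₂ (by simpa [hs₂] using ha) (by simpa [hs₂] using hb)
    have hf₃ := SProg.frame_run recordTie (turnAxis.run s₂)
    have hf₂ := SProg.frame_run turnAxis s₂
    have htie := recordTie_spec (turnAxis.run s₂)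
    rw [hf₂.ivar 3 rfl, hf₂.ivar 4 rfl, hf₂.rvar 3 rfl, hf₂.ivar 2 rfl] at htie
    rw [hrun, hf₃.rvar 1 rfl, hf₃.rvar 2 rfl]
    simp only [hs₂, State.setR_rvar, State.setR_ivar, h3, h4] at t₃ t₄ htie
    norm_num at t₃ t₄ htie
    refine ⟨t₁, t₂, ?_, ?_⟩
    · intro z hz hlt
      rcases Set.mem_insert_iff.1 hz with rfl | hz
      · exact t₃ hlt
      · exact t₄ _ _ (sub_pos.2 hlt) (h₁ z hz hlt)
    · rw [htie]
      split_ifs with h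
      · exact Or.inr ⟨rfl, i, by omega, j, by omega, h.1, sub_eq_zero.1 h.2⟩
      · refine h₂.imp_left fun h' => ⟨h'.1, fun z hz hne => ?_⟩
        rcases Set.mem_insert_iff.1 hz with rfl | hz
        · exact fun e => h ⟨hne, sub_eq_zero.2 e⟩
        · exact h'.2 z hz hne

theorem chooseAxes_spec (s : State) {n : ℕ} (hn : s.ivar 0 = n) {x y : ℕ → ℝ}
    (hx : s.rarr 0 = x) (hy : s.rarr 1 = y) {a b : ℝ}
    (ha : (chooseAxes.run s).rvar 1 = a) (hb : (chooseAxes.run s).rvar 2 = b) :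
    ((∀ i < n, ∀ j < n, i ≠ j → x i ≠ x j) ∧ a = 1 ∧ b = 0) ∨
    ((∃ i < n, ∃ j < n, i ≠ j ∧ x i = x j) ∧ 0 < a ∧ 0 < b ∧
      ∀ i < n, ∀ j < n, x j < x i → b * (y j - y i) < a * (x i - x j)) := by
  set s₁ := ((s.setR 1 1).setR 2 1).setI 2 0 with hs₁
  obtain ⟨h₁, h₂, h₃, h₄⟩ := axesLoop_spec s₁ (n := n) (by simp [hs₁, hn]) (x := x) (y := y)
    (by simpa [hs₁]) (by simpa [hs₁]) (by simp [hs₁]) (by simp [hs₁]) (by simp [hs₁])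
  have hrun : chooseAxes.run s = SProg.run (.cond (.ieq (.var 2) (.const 0))
      (.seq (.setR 1 (.const 1)) (.setR 2 (.const 0))) .skip) (axesLoop.run s₁) := by
    have : s₁ = ((s.setR 1 ((1 : ℤ) : ℝ)).setR 2 ((1 : ℤ) : ℝ)).setI 2 0 := by simp [hs₁]
    rw [this]
    rfl
  rw [hrun, SProg.run_cond_iff (p := (axesLoop.run s₁).ivar 2 = 0) (by
    simp [BExp.Holds, IExp.eval])] at ha hb
  rcases h₄ with ⟨h₅, h₆⟩ | ⟨h₅, h₆⟩
  · rw [if_pos h₅] at ha hb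
    simp [SProg.run, RExp.eval] at ha hb
    exact Or.inl ⟨h₆, ha.symm, hb.symm⟩
  · rw [if_neg (by omega)] at ha hb
    simp only [SProg.run] at ha hb
    subst ha hb
    exact Or.inr ⟨h₆, h₁, h₂, h₃⟩


/-! ## Sorting the points from left to right -/

/-- The first new coordinate of the input point with index `e`. -/
def newX (e : IExp) : RExp := .add (.mul (.var 1) (.get 0 e)) (.mul (.var 2) (.get 1 e))

/-- The second new coordinate of the input point with index `e`. -/
def newY (e : IExp) : RExp := .sub (.mul (.var 1) (.get 1 e)) (.mul (.var 2) (.get 0 e))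

/-- The final position of a point is the number of points to its left. Counting costs quadratic time
in total, which the cubic budget allows. -/
def rankLoop : SProg :=
  .rep 5 (.cond (.rlt (newX (.var 5)) (newX (.var 3))) (.setI 4 (.add (.var 4) (.const 1))) .skip)

/-- Ranks the points by their first coordinate. -/
def sortPoints : SProg :=
  .rep 3 (.seq (.setI 4 (.const 0)) (.seq rankLoop (.putI 1 (.var 4) (.var 3))))

/-- Arrays `5`, `6`, `7` hold the sorted abscissas, ordinates and weights. Array `10` holds the
negated ordinates, i.e. the reflected points for the lower paths. -/
def copyPoint : SProg :=
  .seq (.putR 5 (.var 3) (newX (.get 1 (.var 3)))) <|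
  .seq (.putR 6 (.var 3) (newY (.get 1 (.var 3)))) <|
  .seq (.putR 7 (.var 3) (.get 2 (.get 1 (.var 3)))) <|
  .putR 10 (.var 3) (.sub (.const 0) (newY (.get 1 (.var 3))))

/-- Copies the sorted points. -/
def copyPoints : SProg := .rep 3 copyPoint

/-- In a strict total order the predecessors of an element, together with the element itself,
precede every later element, so ranks are distinct. Used both for the left-to-right order and, with
`D` the points right of `j`, for the angular order. -/
theorem count_lt_injOn {n : ℕ} {r : ℕ → ℕ → Prop} [∀ i, DecidablePred fun j => r j i] {D : Set ℕ}
    (hD : ∀ i, ∀ j < n, r j i → j ∈ D)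
    (hirr : ∀ i, ¬ r i i) (htr : ∀ i ∈ D, ∀ j ∈ D, ∀ k ∈ D, r i j → r j k → r i k)
    (htot : ∀ i ∈ D, ∀ j ∈ D, i ≠ j → r i j ∨ r j i) {i j : ℕ} (hi : i ∈ D) (hj : j ∈ D)
    (hin : i < n) (hjn : j < n)
    (h : Nat.count (fun t => r t i) n = Nat.count (fun t => r t j) n) : i = j := by
  have key : ∀ i ∈ D, i < n → ∀ j ∈ D, r i j →
      Nat.count (fun t => r t i) n < Nat.count (fun t => r t j) n := by
    intro i hi hin j hj hij
    rw [Nat.count_eq_card_filter_range, Nat.count_eq_card_filter_range]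
    refine Finset.card_lt_card (Finset.ssubset_iff_of_subset ?_ |>.2 ⟨i, ?_, ?_⟩)
    · intro t ht
      simp only [Finset.mem_filter] at ht ⊢
      exact ⟨ht.1, htr t (hD _ _ (Finset.mem_range.1 ht.1) ht.2) i hi j hj ht.2 hij⟩
    · simp [hin, hij]
    · simp [hirr]
  by_contra hne
  rcases htot i hi j hj hne with h' | h'
  · exact (key i hi hin j hj h').ne h
  · exact (key j hj hjn i hi h').ne h.symm

/-- Since ranks are distinct, a slot once written is never overwritten. -/
theorem sortPoints_spec (s : State) {n : ℕ} (hn : s.ivar 0 = n) {X : ℕ → ℝ}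
    (hX : ∀ t, X t = s.rvar 1 * s.rarr 0 t + s.rvar 2 * s.rarr 1 t)
    (hinj : ∀ i < n, ∀ j < n, X i = X j → i = j) :
    ∀ i < n, (sortPoints.run s).iarr 1 (Nat.count (fun j => X j < X i) n) = i := by
  have := SProg.run_rep_set 3 (.seq (.setI 4 (.const 0)) (.seq rankLoop (.putI 1 (.var 4) (.var 3))))
    s (fun D s' => ∀ i ∈ D, s'.iarr 1 (Nat.count (fun j => X j < X i) n) = i) ?_ ?_ ?_
  · exact fun i hi => this i (by simpa [hn] using hi)
  · intro D s' m h; simpa using h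
  · simp
  · intro m hm s' D hf hx hD h
    have h0 : s'.ivar 0 = n := by rw [hf.ivar 0 rfl, hn]
    have hcount := SProg.run_count 5 4 (by decide) (.rlt (newX (.var 5)) (newX (.var 3)))
      (s'.setI 4 0) (fun j => X j < X m) (by
        intro j hj s'' hf' hj'
        have h3 : s''.ivar 3 = m := by rw [hf'.ivar 3 rfl]; simp [hx]
        have r0 : s''.rarr 0 = s.rarr 0 := by rw [hf'.rarr 0 rfl]; simp [hf.rarr 0 rfl]
        have r1 : s''.rarr 1 = s.rarr 1 := by rw [hf'.rarr 1 rfl]; simp [hf.rarr 1 rfl]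
        have v1 : s''.rvar 1 = s.rvar 1 := by rw [hf'.rvar 1 rfl]; simp [hf.rvar 1 rfl]
        have v2 : s''.rvar 2 = s.rvar 2 := by rw [hf'.rvar 2 rfl]; simp [hf.rvar 2 rfl]
        simp only [BExp.Holds, newX, RExp.eval, IExp.eval, hj', h3, r0, r1, v1, v2, hX])
    have hf₂ := SProg.frame_run rankLoop (s'.setI 4 0)
    set s₂ := rankLoop.run (s'.setI 4 0) with hs₂
    have h4 : s₂.ivar 4 = Nat.count (fun j => X j < X m) n := by
      rw [hs₂]
      refine hcount.trans ?_
      simp [h0]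
    have h3 : s₂.ivar 3 = m := by rw [hf₂.ivar 3 rfl]; simp [hx]
    have hrun : SProg.run (.seq (.setI 4 (.const 0)) (.seq rankLoop (.putI 1 (.var 4) (.var 3)))) s'
        = s₂.putI 1 (Nat.count (fun j => X j < X m) n) m := by
      rw [← h4, ← h3]
      rfl
    rw [hrun]
    intro i hi
    simp only [State.putI_iarr, if_true]
    rcases Set.mem_insert_iff.1 hi with rfl | hi
    · simp
    · have hin : i < n := by have := hD i hi; omega
      rw [Function.update_of_ne, hf₂.iarr 1 rfl]
      · simpa using h i hi
      · intro he
        have := count_lt_injOn (n := n) (r := fun j i => X j < X i) (D := {t | t < n})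
          (fun i j hj h => hj) (fun i => lt_irrefl _)
          (fun i hi j hj k hk h₁ h₂ => h₁.trans h₂)
          (fun i hi j hj hij => lt_or_gt_of_ne fun h => hij (hinj i hi j hj h))
          (i := i) (j := m) hin (by simpa [hn] using hm) hin (by simpa [hn] using hm) he
        have := hD i hi
        omega

theorem copyPoints_spec (s : State) {n : ℕ} (hn : s.ivar 0 = n) {σ : ℕ → ℕ}
    (hσ : s.iarr 1 = σ) : ∀ t < n,
    (copyPoints.run s).rarr 5 t = s.rvar 1 * s.rarr 0 (σ t) + s.rvar 2 * s.rarr 1 (σ t) ∧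
    (copyPoints.run s).rarr 6 t = s.rvar 1 * s.rarr 1 (σ t) - s.rvar 2 * s.rarr 0 (σ t) ∧
    (copyPoints.run s).rarr 7 t = s.rarr 2 (σ t) ∧
    (copyPoints.run s).rarr 10 t = -(s.rvar 1 * s.rarr 1 (σ t) - s.rvar 2 * s.rarr 0 (σ t)) := by
  have := SProg.run_rep_set 3 copyPoint s (fun D s' => ∀ t ∈ D,
    s'.rarr 5 t = s.rvar 1 * s.rarr 0 (σ t) + s.rvar 2 * s.rarr 1 (σ t) ∧
    s'.rarr 6 t = s.rvar 1 * s.rarr 1 (σ t) - s.rvar 2 * s.rarr 0 (σ t) ∧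
    s'.rarr 7 t = s.rarr 2 (σ t) ∧
    s'.rarr 10 t = -(s.rvar 1 * s.rarr 1 (σ t) - s.rvar 2 * s.rarr 0 (σ t)))
    (fun D s' m h => by simpa using h) (by simp) ?_
  · exact fun t ht => this t (by simpa [hn] using ht)
  · intro m hm s' D hf hx hD h t ht
    have r0 : s'.rarr 0 = s.rarr 0 := hf.rarr 0 rfl
    have r1 : s'.rarr 1 = s.rarr 1 := hf.rarr 1 rfl
    have r2 : s'.rarr 2 = s.rarr 2 := hf.rarr 2 rfl
    have v1 : s'.rvar 1 = s.rvar 1 := hf.rvar 1 rfl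
    have v2 : s'.rvar 2 = s.rvar 2 := hf.rvar 2 rfl
    have i1 : s'.iarr 1 = σ := (hf.iarr 1 rfl).trans hσ
    simp only [copyPoint, SProg.run, newX, newY, RExp.eval, IExp.eval, hx, State.putR_rarr, State.putR_ivar,
      State.putR_rvar, State.putR_iarr, r0, r1, r2, v1, v2, i1]
    norm_num [r0, r1, r2]
    rcases Set.mem_insert_iff.1 ht with rfl | ht
    · simp
    · have htm : t ≠ m := (hD t ht).ne
      simpa [htm] using h t ht


/-! ## Edge weights -/

/-- The point number `t` whose coordinates are in the real arrays `5` and `a`. -/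
def State.pt (s : State) (a t : ℕ) : ℝ × ℝ := (s.rarr 5 t, s.rarr a t)

/-- The cross product that decides whether three points form a concave path. -/
def crossExp (y : ℕ) (a b d : IExp) : RExp :=
  .sub (.mul (.sub (.get 5 d) (.get 5 a)) (.sub (.get y b) (.get y a)))
    (.mul (.sub (.get y d) (.get y a)) (.sub (.get 5 b) (.get 5 a)))

theorem crossExp_eval (y : ℕ) (a b d : IExp) (s : State) : (crossExp y a b d).eval s =
    cross (s.pt y (d.eval s) - s.pt y (a.eval s)) (s.pt y (b.eval s) - s.pt y (a.eval s)) := rfl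

def addUpper : SProg :=
  .cond (.conj (.conj (.ilt (.var 3) (.var 5)) (.ilt (.var 5) (.var 4)))
      (.neg (.rlt (crossExp 6 (.var 3) (.var 4) (.var 5)) (.const 0))))
    (.setR 3 (.add (.var 3) (.get 7 (.var 5)))) .skip

/-- The sum is accumulated negatively, so that the minimum over lower paths becomes a maximum. -/
def subLower : SProg :=
  .cond (.conj (.conj (.ilt (.var 3) (.var 5)) (.ilt (.var 5) (.var 4)))
      (.rlt (.const 0) (crossExp 6 (.var 3) (.var 4) (.var 5))))
    (.setR 4 (.sub (.var 4) (.get 7 (.var 5)))) .skip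

def edgeLoop : SProg := .rep 5 (.seq addUpper subLower)

/-- The upper sum starts from the weight of the left end, in accordance with charging vertices to
outgoing edges; the lower sum starts from zero. -/
def edgeStep : SProg :=
  .seq (.setR 3 (.get 7 (.var 3))) <| .seq (.setR 4 (.const 0)) <| .seq edgeLoop <|
  .seq (.putR 8 (addr2 3 4) (.var 3)) (.putR 9 (addr2 3 4) (.var 4))

/-- Computes the weights of all edges. -/
def edges : SProg := .rep 3 (.rep 4 edgeStep)

open Classical in
/-- The total weight of the points between `i` and `j` on or below the edge, and of `i`. -/
noncomputable def upperSum (n : ℕ) (q : ℕ → ℝ × ℝ) (w : ℕ → ℝ) (i j : ℕ) : ℝ :=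
  w i + ∑ t ∈ Finset.range n,
    if i < t ∧ t < j ∧ 0 ≤ cross (q t - q i) (q j - q i) then w t else 0

open Classical in
/-- The negative of the total weight of the points between `i` and `j` strictly below the edge. -/
noncomputable def lowerSum (n : ℕ) (q : ℕ → ℝ × ℝ) (w : ℕ → ℝ) (i j : ℕ) : ℝ :=
  -∑ t ∈ Finset.range n,
    if i < t ∧ t < j ∧ 0 < cross (q t - q i) (q j - q i) then w t else 0

open Classical in
theorem addUpper_spec (s : State) : (addUpper.run s).rvar 3 = s.rvar 3 +
    if s.ivar 3 < s.ivar 5 ∧ s.ivar 5 < s.ivar 4 ∧ 0 ≤ cross (s.pt 6 (s.ivar 5) - s.pt 6 (s.ivar 3))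
      (s.pt 6 (s.ivar 4) - s.pt 6 (s.ivar 3)) then s.rarr 7 (s.ivar 5) else 0 := by
  rw [addUpper, SProg.run_cond_iff (p := s.ivar 3 < s.ivar 5 ∧ s.ivar 5 < s.ivar 4 ∧
    0 ≤ cross (s.pt 6 (s.ivar 5) - s.pt 6 (s.ivar 3)) (s.pt 6 (s.ivar 4) - s.pt 6 (s.ivar 3))) (by
      simp [BExp.Holds, crossExp_eval, RExp.eval, IExp.eval, and_assoc])]
  split_ifs with h <;> simp [SProg.run, RExp.eval, IExp.eval]

open Classical in
theorem subLower_spec (s : State) : (subLower.run s).rvar 4 = s.rvar 4 -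
    if s.ivar 3 < s.ivar 5 ∧ s.ivar 5 < s.ivar 4 ∧ 0 < cross (s.pt 6 (s.ivar 5) - s.pt 6 (s.ivar 3))
      (s.pt 6 (s.ivar 4) - s.pt 6 (s.ivar 3)) then s.rarr 7 (s.ivar 5) else 0 := by
  rw [subLower, SProg.run_cond_iff (p := s.ivar 3 < s.ivar 5 ∧ s.ivar 5 < s.ivar 4 ∧
    0 < cross (s.pt 6 (s.ivar 5) - s.pt 6 (s.ivar 3)) (s.pt 6 (s.ivar 4) - s.pt 6 (s.ivar 3))) (by
      simp [BExp.Holds, crossExp_eval, RExp.eval, IExp.eval, and_assoc])]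
  split_ifs with h <;> simp [SProg.run, RExp.eval, IExp.eval]

theorem edgeLoop_spec (s : State) {n i j : ℕ} (hn : s.ivar 0 = n) (hi : s.ivar 3 = i)
    (hj : s.ivar 4 = j) (h3 : s.rvar 3 = s.rarr 7 i) (h4 : s.rvar 4 = 0) :
    (edgeLoop.run s).rvar 3 = upperSum n (s.pt 6) (s.rarr 7) i j ∧
    (edgeLoop.run s).rvar 4 = lowerSum n (s.pt 6) (s.rarr 7) i j := by
  have := SProg.run_rep 5 (.seq addUpper subLower) s (fun m s' =>
    s'.rvar 3 = upperSum m (s.pt 6) (s.rarr 7) i j ∧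
    s'.rvar 4 = lowerSum m (s.pt 6) (s.rarr 7) i j) ?_ ?_
  · rwa [hn] at this
  · simp [upperSum, lowerSum, h3, h4]
  · intro m hm s' hf h5 ⟨h₁, h₂⟩
    have hf₁ := SProg.frame_run addUpper s'
    have hf₂ := SProg.frame_run subLower (addUpper.run s')
    have e : ∀ s'' : State, s''.rarr = s'.rarr → s''.pt 6 = s.pt 6 := by
      intro s'' h
      funext t
      simp [State.pt, h, hf.rarr 5 rfl, hf.rarr 6 rfl]
    have hr₁ : (addUpper.run s').rarr = s'.rarr := funext fun a => hf₁.rarr a rfl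
    have i3 : s'.ivar 3 = i := by rw [hf.ivar 3 rfl, hi]
    have i4 : s'.ivar 4 = j := by rw [hf.ivar 4 rfl, hj]
    rw [SProg.run]
    simp only [State.setI_rvar]
    rw [hf₂.rvar 3 rfl, subLower_spec, addUpper_spec, hf₁.rvar 4 rfl, h₁, h₂, hr₁, e _ hr₁,
      e _ rfl, hf₁.ivar 3 rfl, hf₁.ivar 4 rfl, hf₁.ivar 5 rfl, i3, i4, h5, hf.rarr 7 rfl]
    constructor
    · rw [upperSum, upperSum, Finset.sum_range_succ, add_assoc]
    · rw [lowerSum, lowerSum, Finset.sum_range_succ]; ring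

theorem edges_spec (s : State) {n : ℕ} (hn : s.ivar 0 = n) : ∀ i < n, ∀ j < n,
    (edges.run s).rarr 8 (i * n + j) = upperSum n (s.pt 6) (s.rarr 7) i j ∧
    (edges.run s).rarr 9 (i * n + j) = lowerSum n (s.pt 6) (s.rarr 7) i j := by
  have := SProg.run_rep_rep_set 3 4 (by decide) edgeStep rfl rfl s (fun D s' =>
    ∀ z ∈ D, z.2 < n → s'.rarr 8 (z.1 * n + z.2) = upperSum n (s.pt 6) (s.rarr 7) z.1 z.2 ∧
      s'.rarr 9 (z.1 * n + z.2) = lowerSum n (s.pt 6) (s.rarr 7) z.1 z.2)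
    (fun D s' m h => by simpa using h) (fun D s' m h => by simpa using h) (by simp) ?_
  · exact fun i hi j hj => this (i, j) ⟨by omega, by omega⟩ hj
  · intro i hi j hj s' D hf h3 h4 h
    have h0 : s'.ivar 0 = n := by rw [hf.ivar 0 rfl, hn]
    set s₂ := (s'.setR 3 (s'.rarr 7 i)).setR 4 0 with hs₂
    have e : s₂.pt 6 = s.pt 6 := by
      funext t
      simp [State.pt, hs₂, hf.rarr 5 rfl, hf.rarr 6 rfl]
    obtain ⟨h₁, h₂⟩ := edgeLoop_spec s₂ (n := n) (i := i) (j := j) (by simp [hs₂, h0])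
      (by simp [hs₂, h3]) (by simp [hs₂, h4]) (by simp [hs₂]) (by simp [hs₂])
    have e' : s₂.rarr 7 = s.rarr 7 := by simp [hs₂, hf.rarr 7 rfl]
    rw [e, e'] at h₁ h₂
    have hf₂ := SProg.frame_run edgeLoop s₂
    have hrun : edgeStep.run s' = ((edgeLoop.run s₂).putR 8 (i * n + j)
        (upperSum n (s.pt 6) (s.rarr 7) i j)).putR 9 (i * n + j)
        (lowerSum n (s.pt 6) (s.rarr 7) i j) := by
      have : s₂ = (s'.setR 3 (s'.rarr 7 (s'.ivar 3))).setR 4 ((0 : ℤ) : ℝ) := by simp [hs₂, h3]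
      have a0 : (edgeLoop.run s₂).ivar 0 = n := by rw [hf₂.ivar 0 rfl]; simp [hs₂, h0]
      have a3 : (edgeLoop.run s₂).ivar 3 = i := by rw [hf₂.ivar 3 rfl]; simp [hs₂, h3]
      have a4 : (edgeLoop.run s₂).ivar 4 = j := by rw [hf₂.ivar 4 rfl]; simp [hs₂, h4]
      simp only [edgeStep, SProg.run, IExp.eval, RExp.eval, addr2_eval, State.putR_ivar,
        State.putR_rvar, ← this, a0, a3, a4, h₁, h₂]
    rw [hrun]
    intro z hz hzn
    rcases Set.mem_insert_iff.1 hz with rfl | hz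
    · simp
    · by_cases hzij : z = (i, j)
      · simp [hzij]
      · have hne : z.1 * n + z.2 ≠ i * n + j := fun h => hzij
          (Prod.ext_iff.2 ((addr_inj hzn (by omega)).1 h))
        have := h z hz hzn
        have r8 : (edgeLoop.run s₂).rarr 8 = s'.rarr 8 := hf₂.rarr 8 rfl
        have r9 : (edgeLoop.run s₂).rarr 9 = s'.rarr 9 := hf₂.rarr 9 rfl
        simpa [hne, r8, r9] using this


/-! ## The dynamic program

The program for the table of the upper paths (`true`) and, after a reflection, for the table of the
lower paths with negated values (`false`). -/

/-- The array of the second coordinates. -/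
def ya (b : Bool) : ℕ := bif b then 6 else 10

/-- The array of the edge weights. -/
def ea (b : Bool) : ℕ := bif b then 8 else 9

/-- The array of the weights of the last vertex. -/
def fa (b : Bool) : ℕ := bif b then 7 else 11

/-- The array of the flags. -/
def fl (b : Bool) : ℕ := bif b then 2 else 3

/-- The array of the values. -/
def va (b : Bool) : ℕ := bif b then 3 else 12

/-- The value `n` marks an empty slot. It exceeds every index, so the test `j' ≤ k` fails there
without a separate case. -/
def clearOrder : SProg := .rep 4 (.putI 4 (.var 4) (.var 0))

/-- The point with index in word variable `5` precedes the one with index in word variable `4` in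
clockwise order around the one with index in word variable `3`. -/
def precedes (b : Bool) : BExp :=
  .conj (.ilt (.var 3) (.var 5))
    -- Tests have no disjunction; it is expressed by De Morgan's law. Ties in slope are broken by
    -- the index.
    (.neg (.conj (.neg (.rlt (.const 0) (crossExp (ya b) (.var 3) (.var 5) (.var 4))))
      (.neg (.conj (.req (crossExp (ya b) (.var 3) (.var 5) (.var 4)) (.const 0))
        (.ilt (.var 5) (.var 4))))))

def angleRank (b : Bool) : SProg :=
  .rep 5 (.cond (precedes b) (.setI 6 (.add (.var 6) (.const 1))) .skip)

def angleStep (b : Bool) : SProg :=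
  .cond (.ilt (.var 3) (.var 4))
    (.seq (.setI 6 (.const 0)) (.seq (angleRank b) (.putI 4 (.var 6) (.var 4)))) .skip

/-- Sorts the points to the right of a point in clockwise order. -/
def angleSort (b : Bool) : SProg := .rep 4 (angleStep b)

/-- The incompatible points come first in clockwise order, so their number is the first compatible
position. A linear count for each pair replaces the moving pointer. -/
def firstCompatibleLoop (b : Bool) : SProg :=
  .rep 5 (.cond (.conj (.ilt (.var 3) (.var 5))
      (.rlt (crossExp (ya b) (.var 4) (.var 3) (.var 5)) (.const 0)))
    (.setI 6 (.add (.var 6) (.const 1))) .skip)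

def firstCompatibleStep (b : Bool) : SProg :=
  .seq (.setI 6 (.const 0)) (.seq (firstCompatibleLoop b) (.putI 5 (.var 4) (.var 6)))

/-- Computes the first compatible positions. -/
def firstCompatible (b : Bool) : SProg := .rep 4 (firstCompatibleStep b)

/-! ### Angular positions by counting -/

section Positions

variable (n : ℕ) (q : ℕ → ℝ × ℝ)

/-- The point `u` precedes the point `t` in clockwise order around the point `j`. -/
def Precedes (j u t : ℕ) : Prop :=
  j < u ∧ (0 < cross (q t - q j) (q u - q j) ∨ cross (q t - q j) (q u - q j) = 0 ∧ u < t)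

open Classical in
/-- The position of `t` in clockwise order around `j`. -/
noncomputable def position (j t : ℕ) : ℕ := Nat.count (fun u => Precedes q j u t) n

open Classical in
/-- The first position of a point that forms a concave path with `i` and `j`. -/
noncomputable def firstPosition (i j : ℕ) : ℕ :=
  Nat.count (fun u => j < u ∧ cross (q u - q i) (q j - q i) < 0) n

variable {n q}

theorem slope_lt_iff {u v : ℝ × ℝ} (hu : 0 < u.1) (hv : 0 < v.1) :
    0 < cross u v ↔ u.2 / u.1 < v.2 / v.1 := by
  rw [div_lt_div_iff₀ hu hv, cross]
  constructor <;> intro h <;> linarith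

theorem slope_eq_iff {u v : ℝ × ℝ} (hu : 0 < u.1) (hv : 0 < v.1) :
    cross u v = 0 ↔ u.2 / u.1 = v.2 / v.1 := by
  rw [div_eq_div_iff hu.ne' hv.ne', cross]
  constructor <;> intro h <;> linarith

/-- Clockwise order is decreasing slope with ties by index; in this lexicographic form it is visibly
a strict total order. -/
theorem precedes_iff (hx : ∀ a b, a < b → b < n → (q a).1 < (q b).1) {j u t : ℕ} (hju : j < u)
    (hun : u < n) (hjt : j < t) (htn : t < n) : Precedes q j u t ↔
      ((q t - q j).2 / (q t - q j).1 < (q u - q j).2 / (q u - q j).1 ∨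
        (q t - q j).2 / (q t - q j).1 = (q u - q j).2 / (q u - q j).1 ∧ u < t) := by
  have h₁ : 0 < (q t - q j).1 := sub_pos.2 (hx j t hjt htn)
  have h₂ : 0 < (q u - q j).1 := sub_pos.2 (hx j u hju hun)
  rw [Precedes, slope_lt_iff h₁ h₂, slope_eq_iff h₁ h₂]
  simp [hju]

theorem not_concave_iff (hx : ∀ a b, a < b → b < n → (q a).1 < (q b).1) {i j t : ℕ} (hij : i < j)
    (hjt : j < t) (htn : t < n) : cross (q t - q i) (q j - q i) < 0 ↔
      (q j - q i).2 / (q j - q i).1 < (q t - q j).2 / (q t - q j).1 := by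
  have h₁ : 0 < (q t - q j).1 := sub_pos.2 (hx j t hjt htn)
  have h₂ : 0 < (q j - q i).1 := sub_pos.2 (hx i j hij (by omega))
  rw [← slope_lt_iff h₂ h₁, cross_sub_swap]
  simp only [cross]
  constructor <;> intro h <;> linarith

theorem position_injOn (hx : ∀ a b, a < b → b < n → (q a).1 < (q b).1) {j t t' : ℕ} (hjt : j < t)
    (htn : t < n) (hjt' : j < t') (htn' : t' < n) (h : position n q j t = position n q j t') :
    t = t' := by
  classical
  refine count_lt_injOn (n := n) (r := fun u t => Precedes q j u t) (D := {t | j < t ∧ t < n})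
    (fun i u hu h => ⟨h.1, hu⟩) ?_ ?_ ?_ ⟨hjt, htn⟩ ⟨hjt', htn'⟩ htn htn' (by
      simp only [position] at h
      convert h)
  · rintro i ⟨-, h | h⟩
    · simp only [cross] at h; linarith
    · exact lt_irrefl _ h.2
  · rintro a ⟨ha, ha'⟩ b ⟨hb, hb'⟩ c ⟨hc, hc'⟩
    rw [precedes_iff hx ha ha' hb hb', precedes_iff hx hb hb' hc hc', precedes_iff hx ha ha' hc hc']
    rintro (h₁ | ⟨h₁, h₁'⟩) (h₂ | ⟨h₂, h₂'⟩)
    · exact Or.inl (h₂.trans h₁)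
    · exact Or.inl (h₂.trans_lt h₁)
    · exact Or.inl (h₂.trans_eq h₁)
    · exact Or.inr ⟨h₂.trans h₁, h₁'.trans h₂'⟩
  · rintro a ⟨ha, ha'⟩ b ⟨hb, hb'⟩ hab
    rw [precedes_iff hx ha ha' hb hb', precedes_iff hx hb hb' ha ha']
    rcases lt_trichotomy ((q a - q j).2 / (q a - q j).1) ((q b - q j).2 / (q b - q j).1)
      with h | h | h
    · exact Or.inr (Or.inl h)
    · rcases lt_or_gt_of_ne hab with h' | h'
      · exact Or.inl (Or.inr ⟨h.symm, h'⟩)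
      · exact Or.inr (Or.inr ⟨h, h'⟩)
    · exact Or.inl (Or.inl h)

/-- Incompatible points are those of slope above a threshold, an initial segment of the order. If
`t` is incompatible, so are all its predecessors, and `t` is one more; if it is compatible, all
incompatible points precede it. -/
theorem concave_iff_firstPosition_le (hx : ∀ a b, a < b → b < n → (q a).1 < (q b).1) {i j t : ℕ}
    (hij : i < j) (hjt : j < t) (htn : t < n) :
    0 ≤ cross (q t - q i) (q j - q i) ↔ firstPosition n q i j ≤ position n q j t := by
  classical
  rw [← not_lt, ← not_lt, not_iff_not]
  simp only [position, firstPosition, Nat.count_eq_card_filter_range]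
  constructor
  · intro h
    refine Finset.card_lt_card (Finset.ssubset_iff_of_subset ?_ |>.2 ⟨t, ?_, ?_⟩)
    · intro u hu
      simp only [Finset.mem_filter, Finset.mem_range] at hu ⊢
      have h' := (precedes_iff hx hu.2.1 hu.1 hjt htn).1 hu.2
      rw [not_concave_iff hx hij hjt htn] at h
      rw [not_concave_iff hx hij hu.2.1 hu.1]
      exact ⟨hu.1, hu.2.1, h'.elim (fun h' => h.trans h') (fun h' => h.trans_eq h'.1)⟩
    · simp [htn, hjt, h]
    · rw [Finset.mem_filter, precedes_iff hx hjt htn hjt htn]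
      simp
  · intro h
    by_contra h'
    refine absurd (Finset.card_le_card ?_) h.not_ge
    intro u hu
    simp only [Finset.mem_filter, Finset.mem_range] at hu ⊢
    obtain ⟨hun, hju, hu⟩ := hu
    rw [not_concave_iff hx hij hjt htn, not_lt] at h'
    rw [not_concave_iff hx hij hju hun] at hu
    exact ⟨hun, (precedes_iff hx hju hun hjt htn).2 (Or.inl (h'.trans_lt hu))⟩

end Positions

theorem clearOrder_spec (s : State) {n : ℕ} (hn : s.ivar 0 = n) :
    ∀ a < n, (clearOrder.run s).iarr 4 a = n := by
  have := SProg.run_rep_set 4 (.putI 4 (.var 4) (.var 0)) s (fun D s' => ∀ a ∈ D, s'.iarr 4 a = n)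
    (fun D s' m h => by simpa using h) (by simp) ?_
  · exact fun a ha => this a (by simpa [hn] using ha)
  · intro m hm s' D hf hx hD h a ha
    have h0 : s'.ivar 0 = n := by rw [hf.ivar 0 rfl, hn]
    simp only [SProg.run, IExp.eval, State.putI_iarr, if_true, hx, h0, Function.update_apply]
    split_ifs with h'
    · rfl
    · exact h a (ha.resolve_left h')

theorem precedes_holds (b : Bool) (s : State) : (precedes b).Holds s ↔
    Precedes (s.pt (ya b)) (s.ivar 3) (s.ivar 5) (s.ivar 4) := by
  simp only [precedes, BExp.Holds, crossExp_eval, IExp.eval, RExp.eval, Int.cast_zero, Precedes]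
  tauto

theorem Frame.pt {c : SProg} {s s' : State} (h : Frame c s s') {a : ℕ} (h5 : c.wRA 5 = false)
    (ha : c.wRA a = false) : s'.pt a = s.pt a := by
  funext t
  simp [State.pt, h.rarr 5 h5, h.rarr a ha]

@[simp] theorem State.setI_pt (s : State) (x m a : ℕ) : (s.setI x m).pt a = s.pt a := rfl

theorem angleRank_spec (b : Bool) (s : State) {n : ℕ} (hn : s.ivar 0 = n) (h6 : s.ivar 6 = 0) :
    ((angleRank b).run s).ivar 6 = position n (s.pt (ya b)) (s.ivar 3) (s.ivar 4) := by
  classical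
  refine (SProg.run_count 5 6 (by decide) (precedes b) s
    (fun u => Precedes (s.pt (ya b)) (s.ivar 3) u (s.ivar 4)) ?_).trans ?_
  · intro m hm s' hf hx
    rw [precedes_holds, hf.pt rfl rfl, hf.ivar 3 rfl, hf.ivar 4 rfl, hx]
  · rw [h6, hn, zero_add, position]

theorem angleStep_of_lt (b : Bool) (s : State) {n j t : ℕ} (hn : s.ivar 0 = n) (hj : s.ivar 3 = j)
    (ht : s.ivar 4 = t) (hjt : j < t) : ((angleStep b).run s).iarr 4 =
      Function.update (s.iarr 4) (position n (s.pt (ya b)) j t) t := by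
  have hf := SProg.frame_run (angleRank b) (s.setI 6 0)
  have h := angleRank_spec b (s.setI 6 0) (n := n) (by simp [hn]) (by simp)
  rw [angleStep, SProg.run_cond_iff (p := s.ivar 3 < s.ivar 4) (by simp [BExp.Holds, IExp.eval]),
    if_pos (by omega)]
  simp only [SProg.run, IExp.eval, State.putI_iarr, if_true, h, hf.ivar 4 rfl, hf.iarr 4 rfl]
  simp [hj, ht]

/-- The equivalence also covers empty slots: they hold `n`, which differs from every `t < n`. -/
theorem angleSort_spec (b : Bool) (s : State) {n j : ℕ} (hn : s.ivar 0 = n) (hj : s.ivar 3 = j)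
    (hx : ∀ a a', a < a' → a' < n → (s.pt (ya b) a).1 < (s.pt (ya b) a').1)
    (h4 : ∀ a < n, s.iarr 4 a = n) {a t : ℕ} (ha : a < n) (ht : t < n) :
    ((angleSort b).run s).iarr 4 a = t ↔ j < t ∧ position n (s.pt (ya b)) j t = a := by
  have := SProg.run_rep_set 4 (angleStep b) s (fun D s' => ∀ a < n, ∀ t < n,
      s'.iarr 4 a = t ↔ t ∈ D ∧ j < t ∧ position n (s.pt (ya b)) j t = a)
    (fun D s' m h => by simpa using h) ?_ ?_
  · refine (this a ha t ht).trans (and_iff_right ?_)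
    simpa [hn] using ht
  · intro a ha t ht
    simp [h4 a ha, ht.ne']
  · intro m hm s' D hf h4' hD h a ha t ht
    have h0 : s'.ivar 0 = n := by rw [hf.ivar 0 rfl, hn]
    have h3 : s'.ivar 3 = j := by rw [hf.ivar 3 rfl, hj]
    have e : s'.pt (ya b) = s.pt (ya b) := hf.pt rfl rfl
    by_cases hjm : j < m
    · rw [angleStep_of_lt b s' h0 h3 h4' hjm, e, Function.update_apply]
      split_ifs with hap
      · constructor
        · rintro rfl
          exact ⟨Set.mem_insert _ _, hjm, hap.symm⟩
        · rintro ⟨-, hjt, he⟩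
          exact (position_injOn hx hjt ht hjm (by omega) (he.trans hap)).symm
      · rw [h a ha t ht, Set.mem_insert_iff]
        constructor
        · rintro ⟨h₁, h₂⟩; exact ⟨Or.inr h₁, h₂⟩
        · rintro ⟨rfl | h₁, h₂⟩
          · exact absurd h₂.2.symm hap
          · exact ⟨h₁, h₂⟩
    · rw [angleStep, SProg.run_cond_iff (p := s'.ivar 3 < s'.ivar 4)
        (by simp [BExp.Holds, IExp.eval]), if_neg (by omega), SProg.run, h a ha t ht,
        Set.mem_insert_iff]
      constructor
      · rintro ⟨h₁, h₂⟩; exact ⟨Or.inr h₁, h₂⟩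
      · rintro ⟨rfl | h₁, h₂⟩
        · exact absurd h₂.1 hjm
        · exact ⟨h₁, h₂⟩

theorem firstCompatibleLoop_spec (b : Bool) (s : State) {n : ℕ} (hn : s.ivar 0 = n)
    (h6 : s.ivar 6 = 0) : ((firstCompatibleLoop b).run s).ivar 6 =
      firstPosition n (s.pt (ya b)) (s.ivar 4) (s.ivar 3) := by
  classical
  refine (SProg.run_count 5 6 (by decide) _ s
    (fun u => s.ivar 3 < u ∧ cross (s.pt (ya b) u - s.pt (ya b) (s.ivar 4))
      (s.pt (ya b) (s.ivar 3) - s.pt (ya b) (s.ivar 4)) < 0) ?_).trans ?_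
  · intro m hm s' hf hx
    simp only [BExp.Holds, crossExp_eval, IExp.eval, RExp.eval, Int.cast_zero]
    rw [hf.pt rfl rfl, hf.ivar 3 rfl, hf.ivar 4 rfl, hx]
  · rw [h6, hn, zero_add, firstPosition]

theorem firstCompatible_spec (b : Bool) (s : State) {n j : ℕ} (hn : s.ivar 0 = n)
    (hj : s.ivar 3 = j) : ∀ i < n, ((firstCompatible b).run s).iarr 5 i =
      firstPosition n (s.pt (ya b)) i j := by
  have := SProg.run_rep_set 4 (firstCompatibleStep b) s (fun D s' => ∀ i ∈ D,
      s'.iarr 5 i = firstPosition n (s.pt (ya b)) i j)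
    (fun D s' m h => by simpa using h) (by simp) ?_
  · exact fun i hi => this i (by simpa [hn] using hi)
  · intro m hm s' D hf h4 hD h i hi
    have hf₁ := SProg.frame_run (firstCompatibleLoop b) (s'.setI 6 0)
    have h₁ := firstCompatibleLoop_spec b (s'.setI 6 0) (n := n) (by simp [hf.ivar 0 rfl, hn])
      (by simp)
    have e : s'.pt (ya b) = s.pt (ya b) := hf.pt rfl rfl
    have h3 : s'.ivar 3 = j := by rw [hf.ivar 3 rfl, hj]
    simp only [firstCompatibleStep, SProg.run, IExp.eval, State.putI_iarr, if_true, h₁,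
      hf₁.ivar 4 rfl, hf₁.iarr 5 rfl]
    simp only [State.setI_ivar, State.setI_iarr, State.setI_pt, e, h4, h3]
    norm_num
    rw [Function.update_apply]
    split_ifs with h'
    · rw [h']
    · exact h i (hi.resolve_left h')


/-! ### Filling the table layer by layer -/

def baseStep (b : Bool) : SProg :=
  .cond (.ilt (.var 5) (.var 3))
    (.seq (.putI (fl b) (addr3 5 3 3) (.const 1))
      (.putR (va b) (addr3 5 3 3) (.add (.get (ea b) (addr2 5 3)) (.get (fa b) (.var 3))))) .skip

/-- The entries for paths with one edge. -/
def baseLoop (b : Bool) : SProg := .rep 5 (baseStep b)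

/-- Word array `6` and real array `13` hold flag and value of the suffix maximum at each position,
for the current `j` and `k`. A flag `0` means that the value is meaningless, so it is replaced
without comparison. -/
def suffixUpdate (b : Bool) : SProg :=
  .cond (.conj (.neg (.ilt (.var 4) (.var 7))) (.conj (.ieq (.get (fl b) (addr3 3 7 4)) (.const 1))
      (.neg (.conj (.ieq (.get 6 (.var 6)) (.const 1))
        (.neg (.rlt (.get 13 (.var 6)) (.get (va b) (addr3 3 7 4))))))))
    (.seq (.putI 6 (.var 6) (.const 1)) (.putR 13 (.var 6) (.get (va b) (addr3 3 7 4)))) .skip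

/-- Positions are visited from the end of the clockwise list: each suffix takes over the maximum of
the next shorter one and then includes its own first point. -/
def suffixStep (b : Bool) : SProg :=
  .seq (.setI 6 (.sub (.sub (.var 0) (.const 1)) (.var 5))) <|
  .seq (.putI 6 (.var 6) (.get 6 (.add (.var 6) (.const 1)))) <|
  .seq (.putR 13 (.var 6) (.get 13 (.add (.var 6) (.const 1)))) <|
  .seq (.setI 7 (.get 4 (.var 6))) (suffixUpdate b)

/-- The maxima over the suffixes of a clockwise list. -/
def suffixLoop (b : Bool) : SProg := .rep 5 (suffixStep b)

def fillStep (b : Bool) : SProg :=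
  .cond (.ilt (.var 5) (.var 3))
    (.seq (.putI (fl b) (addr3 5 3 4) (.get 6 (.get 5 (.var 5))))
      (.putR (va b) (addr3 5 3 4) (.add (.get (ea b) (addr2 5 3)) (.get 13 (.get 5 (.var 5))))))
    .skip

def fillLoop (b : Bool) : SProg := .rep 5 (fillStep b)

/-- For fixed `j` and `k` both passes are linear. Position `n` stands for the empty suffix and
receives flag `0`. -/
def columnStep (b : Bool) : SProg :=
  .cond (.ilt (.var 3) (.var 4))
    (.seq (.putI 6 (.var 0) (.const 0)) (.seq (suffixLoop b) (fillLoop b))) .skip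

def columnLoop (b : Bool) : SProg := .rep 4 (columnStep b)

/-- The middle vertex `j` runs from right to left, because entries with middle vertex `j` need those
with first vertex `j`, whose middle vertex is further right. -/
def layer (b : Bool) : SProg :=
  .seq (.setI 3 (.sub (.sub (.var 0) (.const 1)) (.var 2))) <|
  .seq clearOrder <| .seq (angleSort b) <| .seq (firstCompatible b) <|
  .seq (baseLoop b) (columnLoop b)

/-- The dynamic program. -/
def dynProg (b : Bool) : SProg := .rep 2 (layer b)

/-- A flag and a number hold the maximum of a set. -/
def Entry (f : ℕ) (v : ℝ) (S : Set ℝ) : Prop := (f = 1 ∧ IsGreatest S v) ∨ (f = 0 ∧ S = ∅)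

theorem Entry.add {f : ℕ} {v : ℝ} {S S' : Set ℝ} (h : Entry f v S) (r : ℝ)
    (hS : ∀ x, x ∈ S' ↔ ∃ y ∈ S, x = r + y) : Entry f (r + v) S' := by
  rcases h with ⟨h, h₁, h₂⟩ | ⟨h, rfl⟩
  · refine Or.inl ⟨h, (hS _).2 ⟨v, h₁, rfl⟩, fun x hx => ?_⟩
    obtain ⟨y, hy, rfl⟩ := (hS x).1 hx
    have := h₂ hy
    linarith
  · refine Or.inr ⟨h, Set.eq_empty_of_forall_notMem fun x hx => ?_⟩
    obtain ⟨y, hy, -⟩ := (hS x).1 hx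
    exact hy

open Classical in
theorem Entry.union {f g : ℕ} {v w : ℝ} {S S' : Set ℝ} (h : Entry f v S) (h' : Entry g w S') :
    Entry (if g = 1 ∧ (f = 1 → v < w) then 1 else f) (if g = 1 ∧ (f = 1 → v < w) then w else v)
      (S ∪ S') := by
  rcases h' with ⟨rfl, hw⟩ | ⟨rfl, rfl⟩
  · rcases h with ⟨rfl, hv⟩ | ⟨rfl, rfl⟩
    · simp only [true_and, true_implies]
      refine Or.inl ⟨by simp, ?_⟩
      split_ifs with hvw
      · exact ⟨Or.inr hw.1, fun x hx => hx.elim (fun hx => (hv.2 hx).trans hvw.le) fun hx => hw.2 hx⟩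
      · exact ⟨Or.inl hv.1,
          fun x hx => hx.elim (fun hx => hv.2 hx) fun hx => (hw.2 hx).trans (not_lt.1 hvw)⟩
    · have : Entry 1 w S' := Or.inl ⟨rfl, hw⟩
      simpa using this
  · simpa using h

/-- The recurrences of a table. -/
structure IsTable (n : ℕ) (q : ℕ → ℝ × ℝ) (e : ℕ → ℕ → ℝ) (f : ℕ → ℝ)
    (S : ℕ → ℕ → ℕ → Set ℝ) : Prop where
  base : ∀ i k, i < k → k < n → S i k k = {e i k + f k}
  step : ∀ i j k, i < j → j < k → k < n → ∀ x, x ∈ S i j k ↔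
    ∃ t, j < t ∧ t ≤ k ∧ 0 ≤ cross (q t - q i) (q j - q i) ∧ ∃ y ∈ S j t k, x = e i j + y

/-- The entry with indices `i`, `j`, `k` is in memory. -/
def State.HasEntry (s : State) (b : Bool) (n : ℕ) (S : ℕ → ℕ → ℕ → Set ℝ) (i j k : ℕ) : Prop :=
  Entry (s.iarr (fl b) ((i * n + j) * n + k)) (s.rarr (va b) ((i * n + j) * n + k)) (S i j k)

/-- Addresses are expansions in base `n`, so writing one entry disturbs no other. The leading digit
needs no bound. -/
theorem hasEntry_put {s s' : State} {b : Bool} {n : ℕ} {S : ℕ → ℕ → ℕ → Set ℝ} {i j k : ℕ}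
    {f : ℕ} {v : ℝ} (h₁ : s'.iarr (fl b) = Function.update (s.iarr (fl b)) ((i * n + j) * n + k) f)
    (h₂ : s'.rarr (va b) = Function.update (s.rarr (va b)) ((i * n + j) * n + k) v)
    (h : Entry f v (S i j k)) (hj : j < n) (hk : k < n) {i' j' k' : ℕ} (hj' : j' < n) (hk' : k' < n)
    (h' : ¬ (i' = i ∧ j' = j ∧ k' = k) → s.HasEntry b n S i' j' k') :
    s'.HasEntry b n S i' j' k' := by
  rw [State.HasEntry, h₁, h₂, Function.update_apply, Function.update_apply]
  by_cases he : i' = i ∧ j' = j ∧ k' = k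
  · rw [if_pos ((addr3_inj hj' hj hk' hk).2 he), if_pos ((addr3_inj hj' hj hk' hk).2 he)]
    obtain ⟨rfl, rfl, rfl⟩ := he
    exact h
  · rw [if_neg (mt (addr3_inj hj' hj hk' hk).1 he), if_neg (mt (addr3_inj hj' hj hk' hk).1 he)]
    exact h' he

/-! ### Correctness of the dynamic program -/

section Layer

variable {b : Bool} {n : ℕ} {q : ℕ → ℝ × ℝ} {e : ℕ → ℕ → ℝ} {f : ℕ → ℝ}
  {S : ℕ → ℕ → ℕ → Set ℝ}

/-- The disjunction in the hypothesis treats newly written and previously correct entries together,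
so one statement gives both progress and preservation. -/
theorem baseLoop_spec (s : State) (hS : IsTable n q e f S) {j : ℕ} (hn : s.ivar 0 = n)
    (hj : s.ivar 3 = j) (hjn : j < n) (he : ∀ i < n, ∀ j < n, s.rarr (ea b) (i * n + j) = e i j)
    (hf : ∀ k < n, s.rarr (fa b) k = f k) :
    ∀ i' j' k', j' < n → k' < n → ((i' < j ∧ j' = j ∧ k' = j) ∨ s.HasEntry b n S i' j' k') →
      ((baseLoop b).run s).HasEntry b n S i' j' k' := by
  have := SProg.run_rep_set 5 (baseStep b) s (fun D s' => ∀ i' j' k', j' < n → k' < n →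
      ((i' ∈ D ∧ i' < j ∧ j' = j ∧ k' = j) ∨ s.HasEntry b n S i' j' k') →
        s'.HasEntry b n S i' j' k')
    (fun D s' m h => h) (by simp) ?_
  · intro i' j' k' hj' hk' h
    refine this i' j' k' hj' hk' (h.imp_left fun h => ⟨?_, h⟩)
    rw [Set.mem_ofPred_eq]
    omega
  · intro m hm s' D hfr h5 hD h i' j' k' hj' hk' h'
    have h0 : s'.ivar 0 = n := by rw [hfr.ivar 0 (by cases b <;> rfl), hn]
    have h3 : s'.ivar 3 = j := by rw [hfr.ivar 3 (by cases b <;> rfl), hj]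
    rw [baseStep, SProg.run_cond_iff (p := m < j) (by simp [BExp.Holds, IExp.eval, h5, h3])]
    split_ifs with hmj
    · refine hasEntry_put (i := m) (j := j) (k := j) (f := 1) (v := e m j + f j) (s := s') ?_ ?_
        ?_ hjn hjn hj' hk' (fun hne => h i' j' k' hj' hk' ?_)
      · simp [SProg.run, h0, h3, h5, IExp.eval]
      · rw [← he m (by omega) j hjn, ← hf j hjn, ← hfr.rarr (ea b) (by cases b <;> rfl),
          ← hfr.rarr (fa b) (by cases b <;> rfl)]
        simp [SProg.run, h0, h3, h5, IExp.eval, RExp.eval]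
      · exact Or.inl ⟨rfl, by rw [hS.base m j hmj hjn]; exact isGreatest_singleton⟩
      · refine h'.imp_left fun h' => ⟨(Set.mem_insert_iff.1 h'.1).resolve_left ?_, h'.2⟩
        exact fun he => hne ⟨he, h'.2.2⟩
    · rw [SProg.run]
      refine h i' j' k' hj' hk' (h'.imp_left fun h' => ⟨(Set.mem_insert_iff.1 h'.1).resolve_left ?_,
        h'.2⟩)
      have := h'.2.1
      omega

/-- The values of the paths from `j` to `k` whose second vertex is at position `a` or later. -/
def suffixValues (n : ℕ) (q : ℕ → ℝ × ℝ) (S : ℕ → ℕ → ℕ → Set ℝ) (j k a : ℕ) : Set ℝ :=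
  {y | ∃ t, j < t ∧ t ≤ k ∧ a ≤ position n q j t ∧ y ∈ S j t k}

open Classical in
theorem suffixUpdate_spec (s : State) :
    let p := s.ivar 7 ≤ s.ivar 4 ∧
      s.iarr (fl b) ((s.ivar 3 * s.ivar 0 + s.ivar 7) * s.ivar 0 + s.ivar 4) = 1 ∧
      (s.iarr 6 (s.ivar 6) = 1 → s.rarr 13 (s.ivar 6) <
        s.rarr (va b) ((s.ivar 3 * s.ivar 0 + s.ivar 7) * s.ivar 0 + s.ivar 4))
    ((suffixUpdate b).run s).iarr 6 = Function.update (s.iarr 6) (s.ivar 6)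
      (if p then 1 else s.iarr 6 (s.ivar 6)) ∧
    ((suffixUpdate b).run s).rarr 13 = Function.update (s.rarr 13) (s.ivar 6)
      (if p then s.rarr (va b) ((s.ivar 3 * s.ivar 0 + s.ivar 7) * s.ivar 0 + s.ivar 4)
        else s.rarr 13 (s.ivar 6)) := by
  intro p
  rw [suffixUpdate, SProg.run_cond_iff (p := p) (by
    simp [p, BExp.Holds, IExp.eval, RExp.eval])]
  split_ifs with h
  · simp [SProg.run, IExp.eval, RExp.eval]
  · simp [SProg.run]

/-- If slot `a` holds a point `t ≤ k`, the suffix values at `a` are those at `a + 1` together with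
the values through `t`. If it is empty or its point lies beyond `k`, nothing is added. -/
theorem suffixStep_spec (s : State) {j k a : ℕ}
    (hn : s.ivar 0 = n) (hj : s.ivar 3 = j) (hk : s.ivar 4 = k) (hkn : k < n)
    (ha : n - 1 - s.ivar 5 = a)
    (hord : ∀ t < n, s.iarr 4 a = t ↔ j < t ∧ position n q j t = a)
    (hent : ∀ t, j < t → t ≤ k → s.HasEntry b n S j t k)
    (h : Entry (s.iarr 6 (a + 1)) (s.rarr 13 (a + 1)) (suffixValues n q S j k (a + 1))) :
    Entry (((suffixStep b).run s).iarr 6 a) (((suffixStep b).run s).rarr 13 a)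
      (suffixValues n q S j k a) ∧
    ∀ a', a' ≠ a → ((suffixStep b).run s).iarr 6 a' = s.iarr 6 a' ∧
      ((suffixStep b).run s).rarr 13 a' = s.rarr 13 a' := by
  classical
  obtain ⟨s₂, hs₂⟩ : ∃ s₂, s₂ = (((s.setI 6 a).putI 6 a (s.iarr 6 (a + 1))).putR 13 a
      (s.rarr 13 (a + 1))).setI 7 (s.iarr 4 a) := ⟨_, rfl⟩
  have hrun : (suffixStep b).run s = (suffixUpdate b).run s₂ := by
    simp only [suffixStep, SProg.run, IExp.eval, RExp.eval, hn, ha, hs₂]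
    simp
  obtain ⟨h₁, h₂⟩ := suffixUpdate_spec (b := b) s₂
  have e6 : s₂.ivar 6 = a := by simp [hs₂]
  have e7 : s₂.ivar 7 = s.iarr 4 a := by simp [hs₂]
  have e0 : s₂.ivar 0 = n := by simp [hs₂, hn]
  have e3 : s₂.ivar 3 = j := by simp [hs₂, hj]
  have e4 : s₂.ivar 4 = k := by simp [hs₂, hk]
  have ef : s₂.iarr (fl b) = s.iarr (fl b) := by cases b <;> simp [hs₂, fl]
  have ev : s₂.rarr (va b) = s.rarr (va b) := by cases b <;> simp [hs₂, va]
  have ei : s₂.iarr 6 = Function.update (s.iarr 6) a (s.iarr 6 (a + 1)) := by simp [hs₂]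
  have er : s₂.rarr 13 = Function.update (s.rarr 13) a (s.rarr 13 (a + 1)) := by simp [hs₂]
  rw [e6, e7, e0, e3, e4, ef, ev, ei, er] at h₁ h₂
  rw [hrun, h₁, h₂]
  simp only [Function.update_idem, Function.update_self]
  refine ⟨?_, fun a' ha' => by simp [ha']⟩
  by_cases htk : s.iarr 4 a ≤ k
  · obtain ⟨t, ht⟩ : ∃ t, s.iarr 4 a = t := ⟨_, rfl⟩
    rw [ht] at htk ⊢
    obtain ⟨hjt, hpos⟩ := (hord t (by omega)).1 ht
    have := h.union (hent t hjt htk)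
    simp only [htk, true_and]
    convert this using 1
    ext y
    constructor
    · rintro ⟨t', h₁, h₂, h₃, h₄⟩
      rcases h₃.eq_or_lt with h₃ | h₃
      · have := (hord t' (by omega)).2 ⟨h₁, h₃.symm⟩
        rw [ht] at this
        subst this
        exact Or.inr h₄
      · exact Or.inl ⟨t', h₁, h₂, h₃, h₄⟩
    · rintro (⟨t', h₁, h₂, h₃, h₄⟩ | hy)
      · exact ⟨t', h₁, h₂, by omega, h₄⟩
      · exact ⟨t, hjt, htk, hpos.ge, hy⟩
  · simp only [htk, false_and, if_false]
    convert h using 1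
    ext y
    constructor
    · rintro ⟨t', h₁, h₂, h₃, h₄⟩
      refine ⟨t', h₁, h₂, lt_of_le_of_ne h₃ fun h₃ => htk ?_, h₄⟩
      rw [(hord t' (by omega)).2 ⟨h₁, h₃.symm⟩]
      exact h₂
    · rintro ⟨t', h₁, h₂, h₃, h₄⟩
      exact ⟨t', h₁, h₂, by omega, h₄⟩

theorem suffixLoop_spec (s : State) {j k : ℕ}
    (hn : s.ivar 0 = n) (hj : s.ivar 3 = j) (hk : s.ivar 4 = k) (hkn : k < n)
    (hord : ∀ a < n, ∀ t < n, s.iarr 4 a = t ↔ j < t ∧ position n q j t = a)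
    (hent : ∀ t, j < t → t ≤ k → s.HasEntry b n S j t k)
    (h6 : s.iarr 6 n = 0) :
    ∀ a ≤ n, Entry (((suffixLoop b).run s).iarr 6 a) (((suffixLoop b).run s).rarr 13 a)
      (suffixValues n q S j k a) := by
  -- A point does not precede itself, so fewer than `n` points precede it, and the suffix from
  -- position `n` is empty.
  have hpos : ∀ t, j < t → t ≤ k → position n q j t < n := by
    intro t ht htk
    classical
    rw [position, Nat.count_eq_card_filter_range]
    calc _ < (Finset.range n).card := Finset.card_lt_card (Finset.filter_ssubset.2 ⟨t, by
            simp; omega, fun h => h.2.elim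
              (fun h => by simp only [cross] at h; linarith) fun h => lt_irrefl _ h.2⟩)
      _ = n := Finset.card_range n
  have := SProg.run_rep 5 (suffixStep b) s (fun m s' => ∀ a, n - m ≤ a → a ≤ n →
      Entry (s'.iarr 6 a) (s'.rarr 13 a) (suffixValues n q S j k a)) ?_ ?_
  · exact fun a ha => this a (by omega) ha
  · intro a ha ha'
    obtain rfl : a = n := by omega
    refine Or.inr ⟨by simpa using h6, Set.eq_empty_of_forall_notMem ?_⟩
    rintro y ⟨t, h₁, h₂, h₃, -⟩
    exact absurd (hpos t h₁ h₂) h₃.not_gt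
  · intro m hm s' hf h5 h a ha ha'
    have h0 : s'.ivar 0 = n := by rw [hf.ivar 0 rfl, hn]
    have h3 : s'.ivar 3 = j := by rw [hf.ivar 3 rfl, hj]
    have h4 : s'.ivar 4 = k := by rw [hf.ivar 4 rfl, hk]
    have hspec := suffixStep_spec (b := b) (q := q) (S := S) s' (a := n - 1 - m) h0 h3 h4 hkn
      (by rw [h5]) (fun t ht => by
        rw [hf.iarr 4 rfl]; exact hord _ (by omega) t ht)
      (fun t h₁ h₂ => by
        rw [State.HasEntry, hf.iarr (fl b) (by cases b <;> rfl), hf.rarr (va b)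
          (by cases b <;> rfl)]
        exact hent t h₁ h₂) (h _ (by omega) (by omega))
    simp only [State.setI_iarr, State.setI_rarr]
    by_cases hane : a = n - 1 - m
    · rw [hane]
      exact hspec.1
    · rw [(hspec.2 a hane).1, (hspec.2 a hane).2]
      exact h a (by omega) ha'

theorem fillLoop_spec (s : State) (hS : IsTable n q e f S) {j k : ℕ} (hn : s.ivar 0 = n)
    (hj : s.ivar 3 = j) (hk : s.ivar 4 = k) (hjk : j < k) (hkn : k < n)
    (hx : ∀ a b, a < b → b < n → (q a).1 < (q b).1)
    (he : ∀ i < n, ∀ j < n, s.rarr (ea b) (i * n + j) = e i j)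
    (hfc : ∀ i < n, s.iarr 5 i = firstPosition n q i j)
    (hsuf : ∀ a ≤ n, Entry (s.iarr 6 a) (s.rarr 13 a) (suffixValues n q S j k a)) :
    ∀ i' j' k', j' < n → k' < n → ((i' < j ∧ j' = j ∧ k' = k) ∨ s.HasEntry b n S i' j' k') →
      ((fillLoop b).run s).HasEntry b n S i' j' k' := by
  have := SProg.run_rep_set 5 (fillStep b) s (fun D s' => ∀ i' j' k', j' < n → k' < n →
      ((i' ∈ D ∧ i' < j ∧ j' = j ∧ k' = k) ∨ s.HasEntry b n S i' j' k') →
        s'.HasEntry b n S i' j' k')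
    (fun D s' m h => h) (by simp) ?_
  · intro i' j' k' hj' hk' h
    refine this i' j' k' hj' hk' (h.imp_left fun h => ⟨?_, h⟩)
    rw [Set.mem_ofPred_eq]
    omega
  · intro m hm s' D hfr h5 hD h i' j' k' hj' hk' h'
    have h0 : s'.ivar 0 = n := by rw [hfr.ivar 0 (by cases b <;> rfl), hn]
    have h3 : s'.ivar 3 = j := by rw [hfr.ivar 3 (by cases b <;> rfl), hj]
    have h4 : s'.ivar 4 = k := by rw [hfr.ivar 4 (by cases b <;> rfl), hk]
    have f5 : s'.iarr 5 = s.iarr 5 := hfr.iarr 5 (by cases b <;> rfl)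
    have f6 : s'.iarr 6 = s.iarr 6 := hfr.iarr 6 (by cases b <;> rfl)
    have f13 : s'.rarr 13 = s.rarr 13 := hfr.rarr 13 (by cases b <;> rfl)
    have fea : s'.rarr (ea b) = s.rarr (ea b) := hfr.rarr (ea b) (by cases b <;> rfl)
    have hjn : j < n := by omega
    rw [fillStep, SProg.run_cond_iff (p := m < j) (by simp [BExp.Holds, IExp.eval, h5, h3])]
    split_ifs with hmj
    · have hmn : m < n := by omega
      -- The first position may equal `n`; the empty suffix stored there then makes the new entry
      -- empty.
      have hle : firstPosition n q m j ≤ n := by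
        rw [firstPosition]; exact Nat.count_le _
      refine hasEntry_put (i := m) (j := j) (k := k) (f := s.iarr 6 (firstPosition n q m j))
        (v := e m j + s.rarr 13 (firstPosition n q m j)) (s := s') ?_ ?_
        ?_ hjn hkn hj' hk' (fun hne => h i' j' k' hj' hk' ?_)
      · simp [SProg.run, h0, h3, h4, h5, IExp.eval, f5, f6, hfc m hmn]
      · have hne5 : (5 : ℕ) ≠ fl b := by cases b <;> decide
        simp [SProg.run, h0, h3, h4, h5, IExp.eval, RExp.eval, f5, f13, fea, hne5, hfc m hmn,
          he m hmn j hjn]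
      · refine (hsuf _ hle).add _ fun x => ?_
        rw [hS.step m j k hmj hjk hkn]
        constructor
        · rintro ⟨t, h₁, h₂, h₃, y, hy, rfl⟩
          exact ⟨y, ⟨t, h₁, h₂,
            (concave_iff_firstPosition_le hx hmj h₁ (by omega)).1 h₃, hy⟩, rfl⟩
        · rintro ⟨y, ⟨t, h₁, h₂, h₃, hy⟩, rfl⟩
          exact ⟨t, h₁, h₂,
            (concave_iff_firstPosition_le hx hmj h₁ (by omega)).2 h₃, y, hy, rfl⟩
      · refine h'.imp_left fun h' => ⟨(Set.mem_insert_iff.1 h'.1).resolve_left ?_, h'.2⟩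
        exact fun he => hne ⟨he, h'.2.2⟩
    · rw [SProg.run]
      refine h i' j' k' hj' hk' (h'.imp_left fun h' => ⟨(Set.mem_insert_iff.1 h'.1).resolve_left ?_,
        h'.2⟩)
      have := h'.2.1
      omega

theorem columnLoop_spec (s : State) (hS : IsTable n q e f S) {j : ℕ} (hn : s.ivar 0 = n)
    (hj : s.ivar 3 = j)
    (hx : ∀ a b, a < b → b < n → (q a).1 < (q b).1)
    (he : ∀ i < n, ∀ j < n, s.rarr (ea b) (i * n + j) = e i j)
    (hfc : ∀ i < n, s.iarr 5 i = firstPosition n q i j)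
    (hord : ∀ a < n, ∀ t < n, s.iarr 4 a = t ↔ j < t ∧ position n q j t = a)
    (hent : ∀ t k, j < t → t ≤ k → k < n → s.HasEntry b n S j t k) :
    ∀ i' j' k', j' < n → k' < n →
      ((j < k' ∧ i' < j ∧ j' = j) ∨ s.HasEntry b n S i' j' k') →
      ((columnLoop b).run s).HasEntry b n S i' j' k' := by
  have := SProg.run_rep_set 4 (columnStep b) s (fun D s' => ∀ i' j' k', j' < n → k' < n →
      ((k' ∈ D ∧ j < k' ∧ i' < j ∧ j' = j) ∨ s.HasEntry b n S i' j' k') →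
        s'.HasEntry b n S i' j' k')
    (fun D s' m h => h) (by simp) ?_
  · intro i' j' k' hj' hk' h
    refine this i' j' k' hj' hk' (h.imp_left fun h => ⟨?_, h⟩)
    rw [Set.mem_ofPred_eq]
    omega
  · intro k hk s' D hfr h4 hD h i' j' k' hj' hk' h'
    have h0 : s'.ivar 0 = n := by rw [hfr.ivar 0 (by cases b <;> rfl), hn]
    have h3 : s'.ivar 3 = j := by rw [hfr.ivar 3 (by cases b <;> rfl), hj]
    have f4 : s'.iarr 4 = s.iarr 4 := hfr.iarr 4 (by cases b <;> rfl)
    have f5 : s'.iarr 5 = s.iarr 5 := hfr.iarr 5 (by cases b <;> rfl)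
    have fea : s'.rarr (ea b) = s.rarr (ea b) := hfr.rarr (ea b) (by cases b <;> rfl)
    rw [columnStep, SProg.run_cond_iff (p := j < k) (by simp [BExp.Holds, IExp.eval, h4, h3])]
    split_ifs with hjk
    · obtain ⟨s₁, hs₁⟩ : ∃ s₁, s₁ = s'.putI 6 n 0 := ⟨_, rfl⟩
      have hrun : SProg.run (.seq (.putI 6 (.var 0) (.const 0))
          (.seq (suffixLoop b) (fillLoop b))) s' = (fillLoop b).run ((suffixLoop b).run s₁) := by
        rw [hs₁, ← h0]
        rfl
      have hfl : fl b ≠ 6 := by cases b <;> decide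
      have hsame : ∀ i j k, s₁.HasEntry b n S i j k ↔ s'.HasEntry b n S i j k := by
        intro i j k
        simp [State.HasEntry, hs₁, hfl]
      have hsuf := suffixLoop_spec (b := b) (q := q) (S := S) s₁ (n := n) (j := j) (k := k)
        (by simp [hs₁, h0]) (by simp [hs₁, h3]) (by simp [hs₁, h4]) (by omega)
        (by simpa [hs₁, f4] using hord)
        (fun t ht htk => (hsame _ _ _).2 (h j t k (by omega) (by omega)
          (Or.inr (hent t k ht htk (by omega))))) (by simp [hs₁])
      have hf₂ := SProg.frame_run (suffixLoop b) s₁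
      have hsame₂ : ∀ i j k, ((suffixLoop b).run s₁).HasEntry b n S i j k ↔
          s'.HasEntry b n S i j k := by
        intro i j k
        rw [State.HasEntry, hf₂.iarr (fl b) (by cases b <;> rfl),
          hf₂.rarr (va b) (by cases b <;> rfl)]
        exact hsame i j k
      have hfill := fillLoop_spec (b := b) ((suffixLoop b).run s₁) hS (j := j) (k := k)
        (by rw [hf₂.ivar 0 rfl]; simp [hs₁, h0]) (by rw [hf₂.ivar 3 rfl]; simp [hs₁, h3])
        (by rw [hf₂.ivar 4 rfl]; simp [hs₁, h4]) hjk (by omega) hx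
        (by rw [hf₂.rarr (ea b) (by cases b <;> rfl)]; simpa [hs₁, fea] using he)
        (by rw [hf₂.iarr 5 rfl]; simpa [hs₁, f5] using hfc) hsuf
      rw [hrun]
      refine hfill i' j' k' hj' hk' ?_
      rw [hsame₂]
      rcases h' with ⟨h₁, h₂⟩ | h'
      · rcases Set.mem_insert_iff.1 h₁ with rfl | h₁
        · exact Or.inl ⟨h₂.2.1, h₂.2.2, rfl⟩
        · exact Or.inr (h i' j' k' hj' hk' (Or.inl ⟨h₁, h₂⟩))
      · exact Or.inr (h i' j' k' hj' hk' (Or.inr h'))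
    · rw [SProg.run]
      refine h i' j' k' hj' hk' (h'.imp_left fun h' => ⟨(Set.mem_insert_iff.1 h'.1).resolve_left ?_,
        h'.2⟩)
      have := h'.2.1
      omega

theorem layer_spec (s : State) (hS : IsTable n q e f S) {j : ℕ} (hn : s.ivar 0 = n)
    (hj : n - 1 - s.ivar 2 = j) (hjn : j < n) (hq : s.pt (ya b) = q)
    (hx : ∀ a b, a < b → b < n → (q a).1 < (q b).1)
    (he : ∀ i < n, ∀ j < n, s.rarr (ea b) (i * n + j) = e i j)
    (hf : ∀ k < n, s.rarr (fa b) k = f k)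
    (hent : ∀ t k, j < t → t ≤ k → k < n → s.HasEntry b n S j t k) :
    ∀ i' j' k', j' < n → k' < n →
      ((j ≤ k' ∧ i' < j ∧ j' = j) ∨ s.HasEntry b n S i' j' k') →
      ((layer b).run s).HasEntry b n S i' j' k' := by
  obtain ⟨s₁, hs₁⟩ : ∃ s₁, s₁ = s.setI 3 j := ⟨_, rfl⟩
  have hrun : (layer b).run s = (columnLoop b).run ((baseLoop b).run ((firstCompatible b).run
      ((angleSort b).run (clearOrder.run s₁)))) := by
    rw [hs₁, ← hj, ← hn]
    rfl
  rw [hrun]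
  have hf₁ := SProg.frame_run clearOrder s₁
  have hc₁ := clearOrder_spec s₁ (n := n) (by simp [hs₁, hn])
  have a0 : s₁.ivar 0 = n := by simp [hs₁, hn]
  have a3 : s₁.ivar 3 = j := by simp [hs₁]
  have aq : s₁.pt (ya b) = q := by simp [hs₁, hq]
  have ae : ∀ i < n, ∀ j < n, s₁.rarr (ea b) (i * n + j) = e i j := by simpa [hs₁] using he
  have af : ∀ k < n, s₁.rarr (fa b) k = f k := by simpa [hs₁] using hf
  have ah : ∀ i j k, s₁.HasEntry b n S i j k ↔ s.HasEntry b n S i j k := by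
    intro i j k; rw [hs₁]; rfl
  clear hs₁
  generalize clearOrder.run s₁ = s₂ at *
  have hf₂ := SProg.frame_run (angleSort b) s₂
  have hc₂ := fun a ha t ht => angleSort_spec b s₂ (n := n) (j := j) (a := a) (t := t)
    (by rw [hf₁.ivar 0 rfl, a0]) (by rw [hf₁.ivar 3 rfl, a3])
    (by rw [hf₁.pt rfl (by cases b <;> rfl), aq]; exact hx) hc₁ ha ht
  rw [hf₁.pt rfl (by cases b <;> rfl), aq] at hc₂
  generalize (angleSort b).run s₂ = s₃ at *
  have hf₃ := SProg.frame_run (firstCompatible b) s₃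
  have hc₃ := firstCompatible_spec b s₃ (n := n) (j := j)
    (by rw [hf₂.ivar 0 rfl, hf₁.ivar 0 rfl, a0]) (by rw [hf₂.ivar 3 rfl, hf₁.ivar 3 rfl, a3])
  rw [hf₂.pt rfl (by cases b <;> rfl), hf₁.pt rfl (by cases b <;> rfl), aq] at hc₃
  generalize (firstCompatible b).run s₃ = s₄ at *
  have b0 : s₄.ivar 0 = n := by rw [hf₃.ivar 0 rfl, hf₂.ivar 0 rfl, hf₁.ivar 0 rfl, a0]
  have b3 : s₄.ivar 3 = j := by rw [hf₃.ivar 3 rfl, hf₂.ivar 3 rfl, hf₁.ivar 3 rfl, a3]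
  have br : ∀ a, s₄.rarr a = s₁.rarr a := fun a => by
    rw [hf₃.rarr a rfl, hf₂.rarr a rfl, hf₁.rarr a rfl]
  have bi : s₄.iarr (fl b) = s₁.iarr (fl b) := by
    rw [hf₃.iarr _ (by cases b <;> rfl), hf₂.iarr _ (by cases b <;> rfl),
      hf₁.iarr _ (by cases b <;> rfl)]
  have bh : ∀ i j k, s₄.HasEntry b n S i j k ↔ s.HasEntry b n S i j k := by
    intro i j k
    rw [← ah, State.HasEntry, bi, br]
    rfl
  have hf₅ := SProg.frame_run (baseLoop b) s₄
  have hc₄ := baseLoop_spec (b := b) s₄ hS b0 b3 hjn (by rw [br]; exact ae)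
    (by rw [br]; exact af)
  generalize (baseLoop b).run s₄ = s₅ at *
  have hcol := columnLoop_spec (b := b) s₅ hS (j := j)
    (by rw [hf₅.ivar 0 (by cases b <;> rfl), b0]) (by rw [hf₅.ivar 3 (by cases b <;> rfl), b3]) hx
    (by rw [hf₅.rarr (ea b) (by cases b <;> rfl), br]; exact ae)
    (by rw [hf₅.iarr 5 (by cases b <;> rfl)]; exact hc₃)
    (by rw [hf₅.iarr 4 (by cases b <;> rfl), hf₃.iarr 4 rfl]; exact hc₂)
    (fun t k h₁ h₂ h₃ => hc₄ _ _ _ (by omega) h₃ (Or.inr ((bh _ _ _).2 (hent t k h₁ h₂ h₃))))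
  intro i' j' k' hj' hk' h
  refine hcol i' j' k' hj' hk' ?_
  rcases h with ⟨h₁, h₂, h₃⟩ | h
  · rcases h₁.eq_or_lt with h₁ | h₁
    · exact Or.inr (hc₄ _ _ _ hj' hk' (Or.inl ⟨h₂, h₃, h₁.symm⟩))
    · exact Or.inl ⟨h₁, h₂, h₃⟩
  · exact Or.inr (hc₄ _ _ _ hj' hk' (Or.inr ((bh _ _ _).2 h)))

theorem dynProg_spec (s : State) (hS : IsTable n q e f S) (hn : s.ivar 0 = n)
    (hq : s.pt (ya b) = q) (hx : ∀ a b, a < b → b < n → (q a).1 < (q b).1)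
    (he : ∀ i < n, ∀ j < n, s.rarr (ea b) (i * n + j) = e i j)
    (hf : ∀ k < n, s.rarr (fa b) k = f k) :
    ∀ i j k, i < j → j ≤ k → k < n → ((dynProg b).run s).HasEntry b n S i j k := by
  -- After `m` rounds the entries whose middle vertex is among the last `m` points are correct.
  have := SProg.run_rep 2 (layer b) s (fun m s' => ∀ i j k, n - m ≤ j → i < j → j ≤ k → k < n →
      s'.HasEntry b n S i j k) ?_ ?_
  · exact fun i j k => this i j k (by omega)
  · intro i j k h₁ h₂ h₃ h₄; omega
  · intro m hm s' hfr h2 h i j k h₁ h₂ h₃ h₄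
    have := layer_spec (b := b) s' hS (j := n - 1 - m)
      (by rw [hfr.ivar 0 (by cases b <;> rfl), hn]) (by rw [h2]) (by omega)
      (by rw [hfr.pt (by cases b <;> rfl) (by cases b <;> rfl), hq]) hx
      (by rw [hfr.rarr (ea b) (by cases b <;> rfl)]; exact he)
      (by rw [hfr.rarr (fa b) (by cases b <;> rfl)]; exact hf)
      (fun t k h₁ h₂ h₃ => h _ _ _ (by omega) h₁ h₂ h₃)
    refine this i j k (by omega) h₄ ?_
    by_cases hj : j = n - 1 - m
    · exact Or.inl ⟨by omega, by omega, hj⟩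
    · exact Or.inr (h i j k (by omega) h₂ h₃ h₄)

end Layer


/-! ## Negating the table of the lower paths -/

/-- The dynamic program leaves the maxima of negated sub-weights in array `12`; the required minima
go to array `4`. -/
def negateRow : SProg :=
  .rep 5 (.putR 4 (addr3 3 4 5) (.sub (.const 0) (.get 12 (addr3 3 4 5))))

def negateTable : SProg := .rep 3 (.rep 4 negateRow)

theorem negateRow_spec (s : State) {n i j : ℕ} (hn : s.ivar 0 = n) (hi : s.ivar 3 = i)
    (hj : s.ivar 4 = j) : ∀ i' j' k', j' < n → k' < n →
      ((i' = i ∧ j' = j) ∨ s.rarr 4 ((i' * n + j') * n + k') =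
        -s.rarr 12 ((i' * n + j') * n + k')) →
      (negateRow.run s).rarr 4 ((i' * n + j') * n + k') = -s.rarr 12 ((i' * n + j') * n + k') := by
  have := SProg.run_rep_set 5 (.putR 4 (addr3 3 4 5) (.sub (.const 0) (.get 12 (addr3 3 4 5)))) s
    (fun D s' => ∀ i' j' k', j' < n → k' < n →
      ((k' ∈ D ∧ i' = i ∧ j' = j) ∨ s.rarr 4 ((i' * n + j') * n + k') =
        -s.rarr 12 ((i' * n + j') * n + k')) →
      s'.rarr 4 ((i' * n + j') * n + k') = -s.rarr 12 ((i' * n + j') * n + k'))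
    (fun D s' m h => h) (by simp) ?_
  · intro i' j' k' hj' hk' h
    refine this i' j' k' hj' hk' (h.imp_left fun h => ⟨?_, h⟩)
    rw [Set.mem_ofPred_eq]
    omega
  · intro m hm s' D hf h5 hD h i' j' k' hj' hk' h'
    have h0 : s'.ivar 0 = n := by rw [hf.ivar 0 rfl, hn]
    have h3 : s'.ivar 3 = i := by rw [hf.ivar 3 rfl, hi]
    have h4 : s'.ivar 4 = j := by rw [hf.ivar 4 rfl, hj]
    have h12 : s'.rarr 12 = s.rarr 12 := hf.rarr 12 rfl
    simp only [SProg.run, addr3_eval, RExp.eval, State.putR_rarr, if_true, Function.update_apply,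
      h0, h3, h4, h5, h12]
    split_ifs with he
    · rw [he]; simp
    · refine h i' j' k' hj' hk' (h'.imp_left fun h' => ⟨(Set.mem_insert_iff.1 h'.1).resolve_left ?_,
        h'.2⟩)
      rintro rfl
      exact he (by rw [h'.2.1, h'.2.2])

theorem negateTable_spec (s : State) {n : ℕ} (hn : s.ivar 0 = n) : ∀ i < n, ∀ j < n, ∀ k < n,
    (negateTable.run s).rarr 4 ((i * n + j) * n + k) = -s.rarr 12 ((i * n + j) * n + k) := by
  have := SProg.run_rep_rep_set 3 4 (by decide) negateRow rfl rfl s (fun D s' =>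
    ∀ i j k, j < n → k < n → (i, j) ∈ D →
      s'.rarr 4 ((i * n + j) * n + k) = -s.rarr 12 ((i * n + j) * n + k))
    (fun D s' m h => h) (fun D s' m h => h) (by simp) ?_
  · exact fun i hi j hj k hk => this i j k hj hk ⟨by omega, by omega⟩
  · intro i hi j hj s' D hf h3 h4 h i' j' k' hj' hk' hm
    have h12 : s'.rarr 12 = s.rarr 12 := hf.rarr 12 rfl
    have := negateRow_spec s' (by rw [hf.ivar 0 rfl, hn]) h3 h4 i' j' k' hj' hk'
    rw [h12] at this
    refine this ?_
    rcases Set.mem_insert_iff.1 hm with hm | hm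
    · exact Or.inl (Prod.ext_iff.1 hm)
    · exact Or.inr (h i' j' k' hj' hk' hm)

/-! ## Choosing the best polygon -/

/-- The word variable that records whether an edge was found. -/
def fo (b : Bool) : ℕ := bif b then 11 else 12

/-- The real variable for the best value. -/
def vo (b : Bool) : ℕ := bif b then 3 else 4

/-- The word variable for the best first edge. -/
def jo (b : Bool) : ℕ := bif b then 13 else 14

def isBetter (b : Bool) : BExp :=
  .conj (.conj (.ilt (.var 3) (.var 5)) (.neg (.ilt (.var 4) (.var 5))))
    (.conj (.ieq (.get (fl b) (addr3 3 5 4)) (.const 1))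
      (.neg (.conj (.ieq (.var (fo b)) (.const 1))
        (.neg (.rlt (.var (vo b)) (.get (va b) (addr3 3 5 4)))))))

def bestEdgeStep (b : Bool) : SProg :=
  .cond (isBetter b)
    (.seq (.setR (vo b) (.get (va b) (addr3 3 5 4)))
      (.seq (.setI (jo b) (.var 5)) (.setI (fo b) (.const 1)))) .skip

/-- Finds the best first edge of a path between two given points. -/
def bestEdge (b : Bool) : SProg := .seq (.setI (fo b) (.const 0)) (.rep 5 (bestEdgeStep b))

/-- The values are added because the lower one is already negated. Word variable `6` tells whether a
nonempty polygon is recorded, `7` and `8` are its ends, `9` and `10` the first edges of its two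
paths. -/
def improve : SProg :=
  .cond (.conj (.conj (.ieq (.var 11) (.const 1)) (.ieq (.var 12) (.const 1)))
      (.rlt (.var 0) (.add (.var 3) (.var 4))))
    (.seq (.setR 0 (.add (.var 3) (.var 4))) <| .seq (.setI 6 (.const 1)) <|
      .seq (.setI 7 (.var 3)) <| .seq (.setI 8 (.var 4)) <| .seq (.setI 9 (.var 13)) <|
      .setI 10 (.var 14)) .skip

def polygonStep : SProg :=
  .cond (.ilt (.var 3) (.var 4)) (.seq (bestEdge true) (.seq (bestEdge false) improve)) .skip

def polygonLoop : SProg := .rep 3 (.rep 4 polygonStep)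

def singleStep : SProg :=
  .cond (.rlt (.var 0) (.get 7 (.var 3)))
    (.seq (.setR 0 (.get 7 (.var 3))) <| .seq (.setI 6 (.const 1)) <|
      .seq (.setI 7 (.var 3)) (.setI 8 (.var 3))) .skip

def singleLoop : SProg := .rep 3 singleStep

/-- Chooses the best polygon. -/
def choosePolygon : SProg :=
  .seq (.setR 0 (.const 0)) <| .seq (.setI 6 (.const 0)) <| .seq singleLoop polygonLoop

/-- The table has a finite entry for `i`, `j`, `k`. -/
def State.Valid (s : State) (b : Bool) (n i j k : ℕ) : Prop :=
  i < j ∧ j ≤ k ∧ s.iarr (fl b) ((i * n + j) * n + k) = 1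

/-- The value of the entry for `i`, `j`, `k`. -/
def State.val (s : State) (b : Bool) (n i j k : ℕ) : ℝ := s.rarr (va b) ((i * n + j) * n + k)

theorem Frame.valid {c : SProg} {s s' : State} (h : Frame c s s') {b : Bool}
    (hb : c.wIA (fl b) = false) {n i j k : ℕ} : s'.Valid b n i j k ↔ s.Valid b n i j k := by
  rw [State.Valid, State.Valid, h.iarr _ hb]

theorem Frame.val {c : SProg} {s s' : State} (h : Frame c s s') {b : Bool}
    (hb : c.wRA (va b) = false) {n i j k : ℕ} : s'.val b n i j k = s.val b n i j k := by
  rw [State.val, State.val, h.rarr _ hb]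

theorem bestEdgeStep_spec (b : Bool) (s : State) {n i k m : ℕ} (hn : s.ivar 0 = n)
    (hi : s.ivar 3 = i) (hk : s.ivar 4 = k) (hm : s.ivar 5 = m) :
    (s.Valid b n i m k ∧ (s.ivar (fo b) = 1 → s.rvar (vo b) < s.val b n i m k) ∧
      ((bestEdgeStep b).run s).ivar (fo b) = 1 ∧ ((bestEdgeStep b).run s).ivar (jo b) = m ∧
      ((bestEdgeStep b).run s).rvar (vo b) = s.val b n i m k) ∨
    (¬ (s.Valid b n i m k ∧ (s.ivar (fo b) = 1 → s.rvar (vo b) < s.val b n i m k)) ∧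
      (bestEdgeStep b).run s = s) := by
  classical
  rw [bestEdgeStep, SProg.run_cond_iff (p := s.Valid b n i m k ∧ (s.ivar (fo b) = 1 →
    s.rvar (vo b) < s.val b n i m k)) (by
      simp [isBetter, BExp.Holds, IExp.eval, RExp.eval, State.Valid, State.val, hn, hi, hk, hm,
        and_assoc])]
  split_ifs with h
  · refine Or.inl ⟨h.1, h.2, ?_⟩
    cases b <;> simp [SProg.run, IExp.eval, RExp.eval, fo, vo, jo, hn, hi, hk, hm, State.val]
  · exact Or.inr ⟨h, rfl⟩

theorem bestEdge_spec (b : Bool) (s : State) {n i k : ℕ} (hn : s.ivar 0 = n) (hi : s.ivar 3 = i)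
    (hk : s.ivar 4 = k) (hkn : k < n) :
    (((bestEdge b).run s).ivar (fo b) = 1 ∧ s.Valid b n i (((bestEdge b).run s).ivar (jo b)) k ∧
      ((bestEdge b).run s).rvar (vo b) = s.val b n i (((bestEdge b).run s).ivar (jo b)) k ∧
      ∀ j, s.Valid b n i j k → s.val b n i j k ≤ ((bestEdge b).run s).rvar (vo b)) ∨
    (((bestEdge b).run s).ivar (fo b) = 0 ∧ ∀ j, ¬ s.Valid b n i j k) := by
  have := SProg.run_rep_set 5 (bestEdgeStep b) (s.setI (fo b) 0) (fun D s' =>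
    (s'.ivar (fo b) = 1 ∧ s.Valid b n i (s'.ivar (jo b)) k ∧
      s'.rvar (vo b) = s.val b n i (s'.ivar (jo b)) k ∧
      ∀ j ∈ D, s.Valid b n i j k → s.val b n i j k ≤ s'.rvar (vo b)) ∨
    (s'.ivar (fo b) = 0 ∧ ∀ j ∈ D, ¬ s.Valid b n i j k)) ?_ ?_ ?_
  · have h0 : (s.setI (fo b) 0).ivar 0 = n := by cases b <;> simp [fo, hn]
    rw [h0] at this
    refine this.imp (fun h => ⟨h.1, h.2.1, h.2.2.1, fun j hj => h.2.2.2 j ?_ hj⟩)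
      (fun h => ⟨h.1, fun j hj => h.2 j ?_ hj⟩)
    · exact hj.2.1.trans_lt hkn
    · exact hj.2.1.trans_lt hkn
  · intro D s' m h
    have h₁ : fo b ≠ 5 := by cases b <;> decide
    have h₂ : jo b ≠ 5 := by cases b <;> decide
    simpa [h₁, h₂] using h
  · right; simp
  · intro m hm s' D hf h5 hD h
    have hval : ∀ j, s'.val b n i j k = s.val b n i j k := fun j => by
      rw [hf.val (by cases b <;> rfl)]; rfl
    have hvalid : ∀ j, s'.Valid b n i j k ↔ s.Valid b n i j k := fun j => by
      rw [hf.valid (by cases b <;> rfl)]; rfl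
    have hspec := bestEdgeStep_spec b s' (n := n) (i := i) (k := k) (m := m)
      (by rw [hf.ivar 0 (by cases b <;> rfl)]; cases b <;> simp [fo, hn])
      (by rw [hf.ivar 3 (by cases b <;> rfl)]; cases b <;> simp [fo, hi])
      (by rw [hf.ivar 4 (by cases b <;> rfl)]; cases b <;> simp [fo, hk]) h5
    rw [hval, hvalid] at hspec
    rcases hspec with ⟨h₁, h₂, h₃, h₄, h₅⟩ | ⟨h₁, h₂⟩
    · rw [h₃, h₄, h₅]
      refine Or.inl ⟨rfl, h₁, rfl, fun j hj hv => ?_⟩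
      rcases Set.mem_insert_iff.1 hj with rfl | hj
      · exact le_rfl
      · rcases h with ⟨h₆, -, -, h₇⟩ | ⟨-, h₇⟩
        · exact (h₇ j hj hv).trans (h₂ h₆).le
        · exact absurd hv (h₇ j hj)
    · rw [h₂]
      rcases h with ⟨h₆, h₇, h₈, h₉⟩ | ⟨h₆, h₇⟩
      · refine Or.inl ⟨h₆, h₇, h₈, fun j hj hv => ?_⟩
        rcases Set.mem_insert_iff.1 hj with rfl | hj
        · exact not_lt.1 fun h => h₁ ⟨hv, fun _ => h⟩
        · exact h₉ j hj hv
      · refine Or.inr ⟨h₆, fun j hj hv => ?_⟩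
        rcases Set.mem_insert_iff.1 hj with rfl | hj
        · exact h₁ ⟨hv, fun h => by omega⟩
        · exact h₇ j hj hv

/-- The memory `s` records a choice with value `s.rvar 0`, relative to the tables in `s₀`. -/
def Chosen (n : ℕ) (s₀ s : State) : Prop :=
  (s.ivar 6 = 0 ∧ s.rvar 0 = 0) ∨
  (s.ivar 6 = 1 ∧ s.ivar 7 < n ∧ s.ivar 8 = s.ivar 7 ∧ s.rvar 0 = s₀.rarr 7 (s.ivar 7)) ∨
  (s.ivar 6 = 1 ∧ s.ivar 7 < s.ivar 8 ∧ s.ivar 8 < n ∧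
    s₀.Valid true n (s.ivar 7) (s.ivar 9) (s.ivar 8) ∧
    s₀.Valid false n (s.ivar 7) (s.ivar 10) (s.ivar 8) ∧
    s.rvar 0 = s₀.val true n (s.ivar 7) (s.ivar 9) (s.ivar 8) +
      s₀.val false n (s.ivar 7) (s.ivar 10) (s.ivar 8))

theorem improve_spec (s : State) :
    (s.ivar 11 = 1 ∧ s.ivar 12 = 1 ∧ s.rvar 0 < s.rvar 3 + s.rvar 4 ∧
      (improve.run s).rvar 0 = s.rvar 3 + s.rvar 4 ∧ (improve.run s).ivar 6 = 1 ∧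
      (improve.run s).ivar 7 = s.ivar 3 ∧ (improve.run s).ivar 8 = s.ivar 4 ∧
      (improve.run s).ivar 9 = s.ivar 13 ∧ (improve.run s).ivar 10 = s.ivar 14) ∨
    (¬ (s.ivar 11 = 1 ∧ s.ivar 12 = 1 ∧ s.rvar 0 < s.rvar 3 + s.rvar 4) ∧ improve.run s = s) := by
  rw [improve, SProg.run_cond_iff (p := s.ivar 11 = 1 ∧ s.ivar 12 = 1 ∧
    s.rvar 0 < s.rvar 3 + s.rvar 4) (by simp [BExp.Holds, IExp.eval, RExp.eval, and_assoc])]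
  split_ifs with h
  · exact Or.inl ⟨h.1, h.2.1, h.2.2, by simp [SProg.run, IExp.eval, RExp.eval]⟩
  · exact Or.inr ⟨h, rfl⟩

/-- The two first edges are maximized independently, and the sum of the maxima bounds the sum for
every pair. -/
theorem polygonStep_spec (s₀ s : State) {n i k : ℕ} (hn : s.ivar 0 = n) (hi : s.ivar 3 = i)
    (hk : s.ivar 4 = k) (hik : i < k) (hkn : k < n)
    (hvalid : ∀ b i j k, s.Valid b n i j k ↔ s₀.Valid b n i j k)
    (hval : ∀ b i j k, s.val b n i j k = s₀.val b n i j k) (h : Chosen n s₀ s) :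
    Chosen n s₀ (polygonStep.run s) ∧ s.rvar 0 ≤ (polygonStep.run s).rvar 0 ∧
    ∀ j j', s₀.Valid true n i j k → s₀.Valid false n i j' k →
      s₀.val true n i j k + s₀.val false n i j' k ≤ (polygonStep.run s).rvar 0 := by
  have hrun : polygonStep.run s = improve.run ((bestEdge false).run ((bestEdge true).run s)) := by
    rw [polygonStep, SProg.run_cond_iff (p := i < k) (by simp [BExp.Holds, IExp.eval, hi, hk]),
      if_pos hik]
    rfl
  have hf₁ := SProg.frame_run (bestEdge true) s
  have h₁ := bestEdge_spec true s hn hi hk hkn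
  set s₁ := (bestEdge true).run s
  have hf₂ := SProg.frame_run (bestEdge false) s₁
  have h₂ := bestEdge_spec false s₁ (n := n) (i := i) (k := k) (by rw [hf₁.ivar 0 rfl, hn])
    (by rw [hf₁.ivar 3 rfl, hi]) (by rw [hf₁.ivar 4 rfl, hk]) hkn
  simp only [hf₁.valid (b := false) rfl, hf₁.val (b := false) rfl] at h₂
  set s₂ := (bestEdge false).run s₁
  simp only [hvalid, hval] at h₁ h₂
  rw [← hf₂.ivar (fo true) rfl, ← hf₂.ivar (jo true) rfl, ← hf₂.rvar (vo true) rfl] at h₁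
  have hch : Chosen n s₀ s₂ := by
    simpa only [Chosen, hf₂.ivar 6 rfl, hf₂.ivar 7 rfl, hf₂.ivar 8 rfl, hf₂.ivar 9 rfl,
      hf₂.ivar 10 rfl, hf₂.rvar 0 rfl, hf₁.ivar 6 rfl, hf₁.ivar 7 rfl, hf₁.ivar 8 rfl,
      hf₁.ivar 9 rfl, hf₁.ivar 10 rfl, hf₁.rvar 0 rfl] using h
  have a0 : s₂.rvar 0 = s.rvar 0 := by rw [hf₂.rvar 0 rfl, hf₁.rvar 0 rfl]
  have a3 : s₂.ivar 3 = i := by rw [hf₂.ivar 3 rfl, hf₁.ivar 3 rfl, hi]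
  have a4 : s₂.ivar 4 = k := by rw [hf₂.ivar 4 rfl, hf₁.ivar 4 rfl, hk]
  rw [hrun, ← a0]
  simp only [fo, jo, vo, cond_true, cond_false] at h₁ h₂
  rcases improve_spec s₂ with ⟨c₁, c₂, c₃, c₄, c₅, c₆, c₇, c₈, c₉⟩ | ⟨c₁, c₂⟩
  · rcases h₁ with ⟨-, d₁, d₂, d₃⟩ | ⟨d, -⟩
    · rcases h₂ with ⟨-, e₁, e₂, e₃⟩ | ⟨d, -⟩
      · rw [c₄]
        refine ⟨Or.inr (Or.inr ?_), c₃.le, fun j j' hj hj' => add_le_add (d₃ j hj) (e₃ j' hj')⟩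
        rw [c₄, c₅, c₆, c₇, c₈, c₉, a3, a4]
        exact ⟨rfl, hik, hkn, d₁, e₁, by rw [d₂, e₂]⟩
      · omega
    · omega
  · rw [c₂]
    refine ⟨hch, le_rfl, fun j j' hj hj' => ?_⟩
    rcases h₁ with ⟨d₀, d₁, d₂, d₃⟩ | ⟨-, d⟩
    · rcases h₂ with ⟨e₀, e₁, e₂, e₃⟩ | ⟨-, d⟩
      · exact (add_le_add (d₃ j hj) (e₃ j' hj')).trans (not_lt.1 fun h => c₁ ⟨d₀, e₀, h⟩)
      · exact absurd hj' (d _)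
    · exact absurd hj (d _)

theorem polygonLoop_spec (s : State) {n : ℕ} (hn : s.ivar 0 = n) (h : Chosen n s s) :
    Chosen n s (polygonLoop.run s) ∧ s.rvar 0 ≤ (polygonLoop.run s).rvar 0 ∧
    ∀ i k, i < k → k < n → ∀ j j', s.Valid true n i j k → s.Valid false n i j' k →
      s.val true n i j k + s.val false n i j' k ≤ (polygonLoop.run s).rvar 0 := by
  have := SProg.run_rep_rep_set 3 4 (by decide) polygonStep rfl rfl s (fun D s' =>
    Chosen n s s' ∧ s.rvar 0 ≤ s'.rvar 0 ∧
    ∀ z ∈ D, z.1 < z.2 → ∀ j j', s.Valid true n z.1 j z.2 → s.Valid false n z.1 j' z.2 →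
      s.val true n z.1 j z.2 + s.val false n z.1 j' z.2 ≤ s'.rvar 0)
    (fun D s' m h => h) (fun D s' m h => h) ⟨h, le_rfl, by simp⟩ ?_
  · exact ⟨this.1, this.2.1, fun i k hik hkn => this.2.2 (i, k) ⟨by simp only; omega,
      by simp only; omega⟩ hik⟩
  · intro i hi k hk s' D hf h3 h4 ⟨h₁, h₂, h₃⟩
    have h0 : s'.ivar 0 = n := by rw [hf.ivar 0 rfl, hn]
    by_cases hik : i < k
    · obtain ⟨c₁, c₂, c₃⟩ := polygonStep_spec s s' h0 h3 h4 hik (by omega)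
        (fun b i j k => hf.valid (by cases b <;> rfl)) (fun b i j k => hf.val (by cases b <;> rfl))
        h₁
      refine ⟨c₁, h₂.trans c₂, fun z hz hlt j j' hj hj' => ?_⟩
      rcases Set.mem_insert_iff.1 hz with rfl | hz
      · exact c₃ j j' hj hj'
      · exact (h₃ z hz hlt j j' hj hj').trans c₂
    · have hrun : polygonStep.run s' = s' := by
        rw [polygonStep, SProg.run_cond_iff (p := i < k) (by
          simp [BExp.Holds, IExp.eval, h3, h4]), if_neg hik]
        rfl
      rw [hrun]
      refine ⟨h₁, h₂, fun z hz hlt => ?_⟩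
      rcases Set.mem_insert_iff.1 hz with rfl | hz
      · exact absurd hlt hik
      · exact h₃ z hz hlt

theorem singleLoop_spec (s : State) {n : ℕ} (hn : s.ivar 0 = n) (h0 : s.rvar 0 = 0)
    (h6 : s.ivar 6 = 0) : Chosen n s (singleLoop.run s) ∧ 0 ≤ (singleLoop.run s).rvar 0 ∧
      ∀ i < n, s.rarr 7 i ≤ (singleLoop.run s).rvar 0 := by
  have := SProg.run_rep_set 3 singleStep s (fun D s' => Chosen n s s' ∧ 0 ≤ s'.rvar 0 ∧
      ∀ i ∈ D, s.rarr 7 i ≤ s'.rvar 0) (fun D s' m h => h)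
      ⟨Or.inl ⟨h6, h0⟩, h0.ge, by simp⟩ ?_
  · exact ⟨this.1, this.2.1, fun i hi => this.2.2 i (by simpa [hn] using hi)⟩
  · intro m hm s' D hf h3 hD ⟨h₁, h₂, h₃⟩
    have h7 : s'.rarr 7 = s.rarr 7 := hf.rarr 7 rfl
    rw [singleStep, SProg.run_cond_iff (p := s'.rvar 0 < s.rarr 7 m) (by
      simp [BExp.Holds, IExp.eval, RExp.eval, h3, h7])]
    split_ifs with hlt
    · have e : (SProg.run (.seq (.setR 0 (.get 7 (.var 3))) <| .seq (.setI 6 (.const 1)) <|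
          .seq (.setI 7 (.var 3)) (.setI 8 (.var 3))) s').rvar 0 = s.rarr 7 m := by
        simp [SProg.run, IExp.eval, RExp.eval, h3, h7]
      rw [e]
      refine ⟨Or.inr (Or.inl ?_), h₂.trans hlt.le, fun i hi => ?_⟩
      · rw [e]
        simp [SProg.run, IExp.eval, RExp.eval, h3]
        omega
      · rcases Set.mem_insert_iff.1 hi with rfl | hi
        · exact le_rfl
        · exact (h₃ i hi).trans hlt.le
    · rw [SProg.run]
      refine ⟨h₁, h₂, fun i hi => ?_⟩
      rcases Set.mem_insert_iff.1 hi with rfl | hi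
      · exact not_lt.1 hlt
      · exact h₃ i hi

theorem choosePolygon_spec (s : State) {n : ℕ} (hn : s.ivar 0 = n) :
    Chosen n s (choosePolygon.run s) ∧ 0 ≤ (choosePolygon.run s).rvar 0 ∧
    (∀ i < n, s.rarr 7 i ≤ (choosePolygon.run s).rvar 0) ∧
    ∀ i k, i < k → k < n → ∀ j j', s.Valid true n i j k → s.Valid false n i j' k →
      s.val true n i j k + s.val false n i j' k ≤ (choosePolygon.run s).rvar 0 := by
  obtain ⟨s₁, hs₁⟩ : ∃ s₁, s₁ = (s.setR 0 ((0 : ℤ) : ℝ)).setI 6 0 := ⟨_, rfl⟩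
  have hrun : choosePolygon.run s = polygonLoop.run (singleLoop.run s₁) := by rw [hs₁]; rfl
  obtain ⟨h₁, h₂, h₃⟩ := singleLoop_spec s₁ (n := n) (by simp [hs₁, hn]) (by simp [hs₁])
    (by simp [hs₁])
  have hf := SProg.frame_run singleLoop s₁
  have ei : ∀ a, s₁.iarr a = s.iarr a := by simp [hs₁]
  have er : ∀ a, s₁.rarr a = s.rarr a := by simp [hs₁]
  have e₁ : ∀ b i j k, (singleLoop.run s₁).Valid b n i j k ↔ s.Valid b n i j k := by
    intro b i j k
    rw [hf.valid rfl, State.Valid, ei]; rfl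
  have e₂ : ∀ b i j k, (singleLoop.run s₁).val b n i j k = s.val b n i j k := by
    intro b i j k
    rw [hf.val rfl, State.val, er]; rfl
  have e₃ : (singleLoop.run s₁).rarr 7 = s.rarr 7 := by rw [hf.rarr 7 rfl, er]
  have hch : ∀ s', Chosen n (singleLoop.run s₁) s' ↔ Chosen n s s' := by
    intro s'
    simp only [Chosen, e₁, e₂, e₃]
  have hch' : ∀ s', Chosen n s₁ s' ↔ Chosen n s s' := by
    intro s'
    simp only [Chosen, State.Valid, State.val, ei, er]
  obtain ⟨h₄, h₅, h₆⟩ := polygonLoop_spec (singleLoop.run s₁) (n := n)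
    (by rw [hf.ivar 0 rfl]; simp [hs₁, hn]) ((hch _).2 ((hch' _).1 h₁))
  rw [hrun]
  simp only [e₁, e₂, er, hch] at h₄ h₆ h₃
  exact ⟨h₄, h₂.trans h₅, fun i hi => (h₃ i hi).trans h₅, h₆⟩


/-! ## Output of the best polygon -/

/-- Appends an input point, given by its number in the sorted order, to the output. -/
def push (e : IExp) : SProg :=
  .seq (.putI 0 (.var 1) (.get 1 e)) (.setI 1 (.add (.var 1) (.const 1)))

/-- The word variable of the best first edge. -/
def jb (b : Bool) : ℕ := bif b then 9 else 10

/-- No back pointers are stored: a continuation is recognized by concavity and by exact equality in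
the recurrence, which real arithmetic can test. -/
def nextTest (b : Bool) : BExp :=
  .conj (.conj (.conj (.ilt (.var 4) (.var 12)) (.neg (.ilt (.var 8) (.var 12))))
      (.ieq (.get (fl b) (addr3 4 12 8)) (.const 1)))
    (.conj (.neg (.rlt (crossExp (ya b) (.var 3) (.var 4) (.var 12)) (.const 0)))
      (.req (.add (.get (ea b) (addr2 3 4)) (.get (va b) (addr3 4 12 8)))
        (.get (va b) (addr3 3 4 8))))

/-- Finds the next vertex of an optimal path. -/
def findNext (b : Bool) : SProg := .rep 12 (.cond (nextTest b) (.setI 13 (.var 12)) .skip)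

def advance (b : Bool) : SProg :=
  .seq (findNext b) (.seq (.setI 3 (.var 4)) (.setI 4 (.var 13)))

/-- Every loop runs `n` rounds; word variable `5` records that the end has been reached and makes
the remaining rounds idle. -/
def traceStep (b : Bool) : SProg :=
  .cond (.ieq (.var 5) (.const 0))
    (.seq (push (.var 4)) (.cond (.ieq (.var 4) (.var 8)) (.setI 5 (.const 1)) (advance b))) .skip

def traceLoop (b : Bool) : SProg := .rep 11 (traceStep b)

/-- Appends the vertices of an optimal path to the output. -/
def trace (b : Bool) : SProg :=
  .seq (.setI 3 (.var 7)) <| .seq (.setI 4 (.var (jb b))) <| .seq (.setI 5 (.const 0)) <|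
  .seq (push (.var 3)) (traceLoop b)

/-- Outputs the vertices of the chosen polygon. -/
def output : SProg :=
  .seq (.setI 1 (.const 0))
    (.cond (.ieq (.var 6) (.const 1))
      (.cond (.ieq (.var 7) (.var 8)) (push (.var 7)) (.seq (trace true) (trace false))) .skip)

/-- The numbers in the output. -/
def State.outputs (s : State) : Set ℕ := {v | ∃ u < s.ivar 1, s.iarr 0 u = v}

theorem push_outputs (e : IExp) (s : State) :
    ((push e).run s).outputs = insert (s.iarr 1 (e.eval s)) s.outputs := by
  ext v
  simp only [State.outputs, push, SProg.run, IExp.eval, State.setI_ivar, State.putI_ivar,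
    State.setI_iarr, State.putI_iarr, if_true, Set.mem_insert_iff, Set.mem_ofPred_eq]
  constructor
  · rintro ⟨u, hu, rfl⟩
    rcases (Nat.lt_succ_iff.1 hu).eq_or_lt with rfl | hu
    · simp
    · exact Or.inr ⟨u, hu, by simp [hu.ne]⟩
  · rintro (rfl | ⟨u, hu, rfl⟩)
    · exact ⟨s.ivar 1, by simp, by simp⟩
    · exact ⟨u, by omega, by simp [hu.ne]⟩

theorem Frame.outputs {c : SProg} {s s' : State} (h : Frame c s s') (h1 : c.wI 1 = false)
    (h0 : c.wIA 0 = false) : s'.outputs = s.outputs := by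
  rw [State.outputs, State.outputs, h.ivar 1 h1, h.iarr 0 h0]

/-- An optimal path to `k` whose first edge is from `i` to `j` may continue with `t`. -/
def State.Next (s : State) (b : Bool) (n k i j t : ℕ) : Prop :=
  s.Valid b n j t k ∧ 0 ≤ cross (s.pt (ya b) t - s.pt (ya b) i) (s.pt (ya b) j - s.pt (ya b) i) ∧
    s.rarr (ea b) (i * n + j) + s.val b n j t k = s.val b n i j k

theorem Frame.next {c : SProg} {s s' : State} (h : Frame c s s') {b : Bool}
    (hf : c.wIA (fl b) = false) (hv : c.wRA (va b) = false) (h5 : c.wRA 5 = false)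
    (hy : c.wRA (ya b) = false) (he : c.wRA (ea b) = false) {n k i j t : ℕ} :
    s'.Next b n k i j t ↔ s.Next b n k i j t := by
  rw [State.Next, State.Next, h.valid hf, h.val hv, h.val hv, h.pt h5 hy, h.rarr _ he]

/-- The loop keeps the last candidate that passes; the existence of one guarantees that word
variable `13` has been overwritten. -/
theorem findNext_spec (b : Bool) (s : State) {n k i j t : ℕ} (hn : s.ivar 0 = n)
    (hi : s.ivar 3 = i) (hj : s.ivar 4 = j) (hk : s.ivar 8 = k) (ht : t < n)
    (h : s.Next b n k i j t) : s.Next b n k i j (((findNext b).run s).ivar 13) := by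
  classical
  have := SProg.run_rep_set 12 (.cond (nextTest b) (.setI 13 (.var 12)) .skip) s
    (fun D s' => t ∈ D → s.Next b n k i j (s'.ivar 13)) (fun D s' m h => by simpa using h)
    (by simp) ?_
  · exact this (by rw [Set.mem_ofPred_eq, hn]; exact ht)
  · intro m hm s' D hf h12 hD hnext
    have hfn : s'.Next b n k i j m ↔ s.Next b n k i j m :=
      hf.next (by cases b <;> rfl) (by cases b <;> rfl) (by cases b <;> rfl)
        (by cases b <;> rfl) (by cases b <;> rfl)
    rw [SProg.run_cond_iff (p := s'.Next b n k i j m) (by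
      simp [nextTest, State.Next, State.Valid, State.val, BExp.Holds, IExp.eval, RExp.eval,
        crossExp_eval, h12, hf.ivar 0 rfl, hf.ivar 3 rfl, hf.ivar 4 rfl, hf.ivar 8 rfl, hn, hi, hj,
        hk, and_assoc])]
    split_ifs with hm
    · intro _
      simpa [SProg.run, IExp.eval, h12] using hfn.1 hm
    · intro ht
      rcases Set.mem_insert_iff.1 ht with rfl | ht
      · exact absurd (hfn.2 h) hm
      · exact hnext ht

/-- Lists that start with `i`, `j`, and end with `k`, in which every vertex is a possible next vertex
after the preceding two. -/
inductive Traced (N : ℕ → ℕ → ℕ → Prop) (k : ℕ) : List ℕ → Prop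
  | last (i : ℕ) : i < k → Traced N k [i, k]
  | cons (i j t : ℕ) (l : List ℕ) : i < j → N i j t → Traced N k (j :: t :: l) →
      Traced N k (i :: j :: t :: l)

/-- The path from `i₀`, `j₀` is traced to the edge from word variable `3` to word variable `4`, or
to the end. -/
def TraceInv (N : ℕ → ℕ → ℕ → Prop) (V : ℕ → ℕ → Prop) (k i₀ j₀ : ℕ) (σ : ℕ → ℕ) (O : Set ℕ)
    (m : ℕ) (s : State) : Prop :=
  -- The bound `m < s.ivar 4` is the progress measure. `P` collects the vertices already passed, and
  -- the quantifier over `l` says that every traced continuation of the current edge extends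
  -- backwards to a traced list from `i₀`, `j₀`.
  (s.ivar 5 = 0 ∧ m < s.ivar 4 ∧ s.ivar 3 < s.ivar 4 ∧ s.ivar 4 ≤ k ∧ V (s.ivar 3) (s.ivar 4) ∧
    ∃ P : Set ℕ, s.outputs = O ∪ σ '' insert (s.ivar 3) P ∧
      ∀ l, Traced N k (s.ivar 3 :: s.ivar 4 :: l) → ∃ l', Traced N k (i₀ :: j₀ :: l') ∧
        {t | t ∈ i₀ :: j₀ :: l'} = P ∪ {t | t ∈ s.ivar 3 :: s.ivar 4 :: l}) ∨
  (s.ivar 5 = 1 ∧ ∃ l, Traced N k (i₀ :: j₀ :: l) ∧ s.outputs = O ∪ σ '' {t | t ∈ i₀ :: j₀ :: l})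

theorem traceStep_spec (b : Bool) (s : State) {n k i₀ j₀ m : ℕ} {σ : ℕ → ℕ} {O : Set ℕ}
    (hn : s.ivar 0 = n) (hk : s.ivar 8 = k) (hkn : k < n) (hσ : s.iarr 1 = σ)
    (hex : ∀ i j, j < k → s.Valid b n i j k → ∃ t, s.Next b n k i j t)
    (h : TraceInv (s.Next b n k) (fun i j => s.Valid b n i j k) k i₀ j₀ σ O m s) :
    TraceInv (s.Next b n k) (fun i j => s.Valid b n i j k) k i₀ j₀ σ O (m + 1)
      ((traceStep b).run s) := by
  rw [traceStep, SProg.run_cond_iff (p := s.ivar 5 = 0) (by simp [BExp.Holds, IExp.eval])]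
  rcases h with ⟨h5, hm, h34, h4k, hv, P, hP, hP'⟩ | ⟨h5, h⟩
  · rw [if_pos h5, SProg.run]
    obtain ⟨i, hi⟩ : ∃ i, s.ivar 3 = i := ⟨_, rfl⟩
    obtain ⟨j, hj⟩ : ∃ j, s.ivar 4 = j := ⟨_, rfl⟩
    rw [hj] at hm h4k
    rw [hi, hj] at h34 hv
    simp only [hi, hj] at hP hP'
    have hf₁ := SProg.frame_run (push (.var 4)) s
    have ho := push_outputs (.var 4) s
    rw [IExp.eval, hj, hP, hσ] at ho
    set s₁ := (push (.var 4)).run s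
    have e3 : s₁.ivar 3 = i := by rw [hf₁.ivar 3 rfl, hi]
    have e4 : s₁.ivar 4 = j := by rw [hf₁.ivar 4 rfl, hj]
    have e8 : s₁.ivar 8 = k := by rw [hf₁.ivar 8 rfl, hk]
    have e0 : s₁.ivar 0 = n := by rw [hf₁.ivar 0 rfl, hn]
    rw [SProg.run_cond_iff (p := j = k) (by simp [BExp.Holds, IExp.eval, e4, e8])]
    split_ifs with hjk
    · subst hjk
      -- At the end the invariant is instantiated with the empty continuation.
      obtain ⟨l, hl, hl'⟩ := hP' [] (.last i h34)
      refine Or.inr ⟨by simp [SProg.run, IExp.eval], l, hl, ?_⟩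
      change s₁.outputs = _
      rw [ho, hl']
      ext v
      simp only [Set.mem_insert_iff, Set.mem_union, Set.mem_image, Set.mem_ofPred_eq,
        List.mem_cons, List.not_mem_nil, or_false]
      aesop
    · obtain ⟨t, ht⟩ := hex i j (by omega) hv
      have hnx : ∀ t, s₁.Next b n k i j t ↔ s.Next b n k i j t := fun t =>
        hf₁.next (by cases b <;> rfl) (by cases b <;> rfl) (by cases b <;> rfl)
          (by cases b <;> rfl) (by cases b <;> rfl)
      have hspec := findNext_spec b s₁ e0 e3 e4 e8 (ht.1.2.1.trans_lt hkn) ((hnx t).2 ht)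
      rw [hnx] at hspec
      have hf₂ := SProg.frame_run (findNext b) s₁
      obtain ⟨u, hu⟩ : ∃ u, ((findNext b).run s₁).ivar 13 = u := ⟨_, rfl⟩
      rw [hu] at hspec
      have a3 : ((advance b).run s₁).ivar 3 = j := by
        simp [advance, SProg.run, IExp.eval, hf₂.ivar 4 rfl, e4]
      have a4 : ((advance b).run s₁).ivar 4 = u := by
        simp [advance, SProg.run, IExp.eval, hu]
      have hf₃ := SProg.frame_run (advance b) s₁
      refine Or.inl ⟨?_, ?_⟩
      · rw [hf₃.ivar 5 rfl, hf₁.ivar 5 rfl, h5]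
      rw [a3, a4, hf₃.outputs rfl rfl, ho]
      have hju : j < u := hspec.1.1
      refine ⟨by omega, hju, hspec.1.2.1, hspec.1, insert i P, ?_, fun l hl => ?_⟩
      · simp only [Set.image_insert_eq, Set.union_insert]
      · obtain ⟨l', h₁, h₂⟩ := hP' (u :: l) (.cons i j u l h34 hspec hl)
        refine ⟨l', h₁, h₂.trans ?_⟩
        ext v
        simp only [Set.mem_insert_iff, Set.mem_union, Set.mem_ofPred_eq, List.mem_cons]
        tauto
  · rw [if_neg (by omega), SProg.run]
    exact Or.inr ⟨h5, h⟩

theorem trace_spec (b : Bool) (s : State) {n k i₀ j₀ : ℕ} {σ : ℕ → ℕ}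
    (hn : s.ivar 0 = n) (hi : s.ivar 7 = i₀) (hj : s.ivar (jb b) = j₀) (hk : s.ivar 8 = k)
    (hkn : k < n) (hσ : s.iarr 1 = σ)
    (hex : ∀ i j, j < k → s.Valid b n i j k → ∃ t, s.Next b n k i j t)
    (hv : s.Valid b n i₀ j₀ k) :
    ∃ l, Traced (s.Next b n k) k (i₀ :: j₀ :: l) ∧
      ((trace b).run s).outputs = s.outputs ∪ σ '' {t | t ∈ i₀ :: j₀ :: l} := by
  obtain ⟨s₁, hs₁⟩ : ∃ s₁, s₁ = ((s.setI 3 i₀).setI 4 j₀).setI 5 0 := ⟨_, rfl⟩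
  have hrun : (trace b).run s = (traceLoop b).run ((push (.var 3)).run s₁) := by
    have hjb : jb b ≠ 3 := by cases b <;> decide
    simp [trace, SProg.run, IExp.eval, hi, hs₁, hjb, hj]
  have ho : ((push (.var 3)).run s₁).outputs = insert (σ i₀) s.outputs := by
    rw [push_outputs]
    simp [hs₁, IExp.eval, hσ, State.outputs]
  have hf := SProg.frame_run (push (.var 3)) s₁
  have e3 : s₁.ivar 3 = i₀ := by simp [hs₁]
  have e4 : s₁.ivar 4 = j₀ := by simp [hs₁]
  have e5 : s₁.ivar 5 = 0 := by simp [hs₁]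
  have hV : ∀ i j, ((push (.var 3)).run s₁).Valid b n i j k ↔ s.Valid b n i j k := fun i j => by
    rw [hf.valid (by cases b <;> rfl), hs₁]; rfl
  have hN : ∀ i j t, ((push (.var 3)).run s₁).Next b n k i j t ↔ s.Next b n k i j t :=
    fun i j t => by
      rw [hf.next (by cases b <;> rfl) (by cases b <;> rfl) (by cases b <;> rfl)
          (by cases b <;> rfl) (by cases b <;> rfl), hs₁]; rfl
  rw [hrun]
  rw [← hf.ivar 3 rfl] at e3
  rw [← hf.ivar 4 rfl] at e4
  rw [← hf.ivar 5 rfl] at e5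
  have e0 : ((push (.var 3)).run s₁).ivar 0 = n := by rw [hf.ivar 0 rfl]; simp [hs₁, hn]
  have e8 : ((push (.var 3)).run s₁).ivar 8 = k := by rw [hf.ivar 8 rfl]; simp [hs₁, hk]
  have e1 : ((push (.var 3)).run s₁).iarr 1 = σ := by rw [hf.iarr 1 rfl]; simp [hs₁, hσ]
  generalize (push (.var 3)).run s₁ = s₂ at *
  have := SProg.run_rep 11 (traceStep b) s₂ (fun m s' =>
    TraceInv (s.Next b n k) (fun i j => s.Valid b n i j k) k i₀ j₀ σ s.outputs m s') ?_ ?_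
  -- After `n` rounds an unfinished trace would be at a vertex of index above `n`, yet at most `k`.
  · rcases this with ⟨-, h₁, -, h₂, -⟩ | ⟨-, l, h₁, h₂⟩
    · rw [e0] at h₁
      omega
    · exact ⟨l, h₁, h₂⟩
  · refine Or.inl ?_
    simp only [State.setI_ivar]
    norm_num
    rw [e3, e4, e5]
    refine ⟨rfl, by have := hv.1; omega, hv.1, hv.2.1, hv, ∅, ?_, fun l hl => ⟨l, hl, by simp⟩⟩
    change s₂.outputs = _
    rw [ho]; simp
  · intro m hm s' hf' _ h
    have hV' : ∀ i j, s'.Valid b n i j k ↔ s.Valid b n i j k := fun i j => by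
      rw [hf'.valid (by cases b <;> rfl), hV]
    have hN' : s'.Next b n k = s.Next b n k := by
      funext i j t
      rw [hf'.next (by cases b <;> rfl) (by cases b <;> rfl) (by cases b <;> rfl)
          (by cases b <;> rfl) (by cases b <;> rfl), hN]
    have := traceStep_spec b s' (n := n) (k := k) (i₀ := i₀) (j₀ := j₀) (m := m) (σ := σ)
      (O := s.outputs) (by rw [hf'.ivar 0 (by cases b <;> rfl), e0])
      (by rw [hf'.ivar 8 (by cases b <;> rfl), e8]) hkn
      (by rw [hf'.iarr 1 (by cases b <;> rfl), e1])
      (by simpa only [hV', hN'] using hex) (by simpa only [hV', hN'] using h)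
    simp only [hV', hN'] at this
    simpa [TraceInv, State.outputs] using this

/-- The two traces both output the common ends; this is harmless since the output is read as a set.
-/
theorem output_spec (s : State) {n : ℕ} {σ : ℕ → ℕ} (hn : s.ivar 0 = n) (hσ : s.iarr 1 = σ)
    (hex : ∀ b i j k, j < k → k < n → s.Valid b n i j k → ∃ t, s.Next b n k i j t)
    (h : Chosen n s s) :
    ((output.run s).outputs = ∅ ∧ s.rvar 0 = 0) ∨
    (∃ i < n, (output.run s).outputs = {σ i} ∧ s.rvar 0 = s.rarr 7 i) ∨
    ∃ i j j' k l l', i < k ∧ k < n ∧ Traced (s.Next true n k) k (i :: j :: l) ∧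
      Traced (s.Next false n k) k (i :: j' :: l') ∧
      (output.run s).outputs = σ '' {t | t ∈ i :: j :: l ∨ t ∈ i :: j' :: l'} ∧
      s.rvar 0 = s.val true n i j k + s.val false n i j' k := by
  obtain ⟨s₁, hs₁⟩ : ∃ s₁, s₁ = s.setI 1 0 := ⟨_, rfl⟩
  have ho : s₁.outputs = ∅ := by simp [State.outputs, hs₁]
  have hrun : output.run s = SProg.run (.cond (.ieq (.var 6) (.const 1))
      (.cond (.ieq (.var 7) (.var 8)) (push (.var 7)) (.seq (trace true) (trace false))) .skip) s₁ := by
    rw [output, SProg.run, hs₁]; rfl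
  have e6 : s₁.ivar 6 = s.ivar 6 := by simp [hs₁]
  have e7 : s₁.ivar 7 = s.ivar 7 := by simp [hs₁]
  have e8 : s₁.ivar 8 = s.ivar 8 := by simp [hs₁]
  rw [hrun, SProg.run_cond_iff (p := s.ivar 6 = 1) (by simp [BExp.Holds, IExp.eval, e6])]
  have hinner : SProg.run (.cond (.ieq (.var 7) (.var 8)) (push (.var 7))
      (.seq (trace true) (trace false))) s₁ = if s.ivar 7 = s.ivar 8 then (push (.var 7)).run s₁
        else (trace false).run ((trace true).run s₁) := by
    rw [SProg.run_cond_iff (p := s.ivar 7 = s.ivar 8) (by simp [BExp.Holds, IExp.eval, e7, e8])]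
    rfl
  rcases h with ⟨h6, h0⟩ | ⟨h6, h7, h8, h0⟩ | ⟨h6, h78, h8, hC, hV, h0⟩
  · rw [if_neg (by omega), SProg.run]
    exact Or.inl ⟨ho, h0⟩
  · rw [if_pos h6, hinner, if_pos h8.symm, push_outputs, ho, IExp.eval, e7]
    exact Or.inr (Or.inl ⟨s.ivar 7, h7, by simp [hs₁, hσ], h0⟩)
  · rw [if_pos h6, hinner, if_neg h78.ne]
    have hV₁ : ∀ b i j k, s₁.Valid b n i j k ↔ s.Valid b n i j k := fun b i j k => by rw [hs₁]; rfl
    have hN₁ : ∀ b k, s₁.Next b n k = s.Next b n k := fun b k => by rw [hs₁]; rfl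
    have hf := SProg.frame_run (trace true) s₁
    obtain ⟨l, hl, hl'⟩ := trace_spec true s₁ (n := n) (σ := σ) (by simp [hs₁, hn]) e7
      (j₀ := s.ivar 9) (by simp [hs₁, jb]) e8 h8 (by simp [hs₁, hσ])
      (fun i j hj hv => by rw [hN₁]; exact hex _ _ _ _ hj h8 ((hV₁ _ _ _ _).1 hv))
      ((hV₁ _ _ _ _).2 hC)
    have hV₂ : ∀ b i j k, ((trace true).run s₁).Valid b n i j k ↔ s.Valid b n i j k :=
      fun b i j k => by rw [hf.valid (by cases b <;> rfl), hV₁]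
    have hN₂ : ∀ b k, ((trace true).run s₁).Next b n k = s.Next b n k := fun b k => by
      funext i j t
      rw [hf.next (by cases b <;> rfl) (by cases b <;> rfl) (by cases b <;> rfl)
          (by cases b <;> rfl) (by cases b <;> rfl), hN₁]
    obtain ⟨l', hm, hm'⟩ := trace_spec false ((trace true).run s₁) (n := n) (σ := σ)
      (by rw [hf.ivar 0 rfl]; simp [hs₁, hn]) (by rw [hf.ivar 7 rfl, e7])
      (j₀ := s.ivar 10) (by rw [hf.ivar (jb false) rfl]; simp [hs₁, jb]) (by rw [hf.ivar 8 rfl, e8])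
      h8 (by rw [hf.iarr 1 rfl]; simp [hs₁, hσ])
      (fun i j hj hv => by rw [hN₂]; exact hex _ _ _ _ hj h8 ((hV₂ _ _ _ _).1 hv))
      ((hV₂ _ _ _ _).2 hV)
    rw [hN₁] at hl
    rw [hN₂] at hm
    refine Or.inr (Or.inr ⟨_, _, _, _, l, l', h78, h8, hl, hm, ?_, h0⟩)
    rw [hm', hl', ho, Set.empty_union, ← Set.image_union]
    rfl


/-! ## From the memory to the tables -/

section Memory

variable {n : ℕ} (q : Fin n → ℝ × ℝ) (w : Fin n → ℝ)

/-- The points, reflected for the lower paths. -/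
def side (b : Bool) : Fin n → ℝ × ℝ := bif b then q else fun t => flip (q t)

/-- The contribution of an edge to the value of a path. -/
noncomputable def edgeValue (b : Bool) : Fin n → Fin n → ℝ :=
  bif b then fun i j => upperEdge q w i j + w i else fun i j => -lowerEdge q w i j

/-- The contribution of the last vertex to the value of a path. -/
def lastValue (b : Bool) : Fin n → ℝ := bif b then w else fun _ => 0

/-- The values of the upper paths, and the negated values of the lower paths. -/
def values (b : Bool) : Fin n → Fin n → Fin n → Set ℝ :=
  pathValues (ConcaveTriple (side q b)) (edgeValue q w b) (lastValue w b)

/-- The memory holds the sorted points and the edge weights. -/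
structure Prepared (s : State) : Prop where
  size : s.ivar 0 = n
  pt : ∀ (b) (t : Fin n), s.pt (ya b) t = side q b t
  weight : ∀ t : Fin n, s.rarr 7 t = w t
  edge : ∀ (b) (i j : Fin n), s.rarr (ea b) (i * n + j) = edgeValue q w b i j
  last : ∀ (b) (k : Fin n), s.rarr (fa b) k = lastValue w b k

/-- The memory holds a table. -/
def Filled (b : Bool) (s : State) : Prop := ∀ i j k : Fin n, i < j → j ≤ k →
  Entry (s.iarr (fl b) ((i * n + j) * n + k)) (s.rarr (va b) ((i * n + j) * n + k))
    (values q w b i j k)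

variable {q w}

theorem Prepared.frame {c : SProg} {s s' : State} (h : Prepared q w s) (hf : Frame c s s')
    (h0 : c.wI 0 = false) (hc : ∀ a ∈ [5, 6, 7, 8, 9, 10, 11], c.wRA a = false) :
    Prepared q w s' where
  size := by rw [hf.ivar 0 h0, h.size]
  pt b t := by rw [hf.pt (hc 5 (by simp)) (hc _ (by cases b <;> simp [ya])), h.pt]
  weight t := by rw [hf.rarr 7 (hc 7 (by simp)), h.weight]
  edge b i j := by rw [hf.rarr _ (hc _ (by cases b <;> simp [ea])), h.edge]
  last b k := by rw [hf.rarr _ (hc _ (by cases b <;> simp [fa])), h.last]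

theorem Filled.frame {c : SProg} {s s' : State} {b : Bool} (h : Filled q w b s) (hf : Frame c s s')
    (hi : c.wIA (fl b) = false) (hr : c.wRA (va b) = false) : Filled q w b s' := by
  intro i j k hij hjk
  rw [hf.iarr _ hi, hf.rarr _ hr]
  exact h i j k hij hjk

theorem side_strictMono (hx : StrictMono fun t => (q t).1) (b : Bool) :
    StrictMono fun t => (side q b t).1 := by
  cases b <;> exact hx

theorem Prepared.concaveTriple_iff {s : State} (h : Prepared q w s) {b : Bool} {i j t : Fin n} :
    ConcaveTriple (side q b) i j t ↔
      0 ≤ cross (s.pt (ya b) t - s.pt (ya b) i) (s.pt (ya b) j - s.pt (ya b) i) := by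
  rw [ConcaveTriple, h.pt, h.pt, h.pt]

theorem dynProg_filled (hx : StrictMono fun t => (q t).1) {b : Bool} {s : State}
    (h : Prepared q w s) : Filled q w b ((dynProg b).run s) := by
  -- The program works with natural numbers as indices; the value sets are extended by the empty set
  -- outside the range.
  obtain ⟨S, hS⟩ : ∃ S : ℕ → ℕ → ℕ → Set ℝ, S = fun i j k =>
    {x | ∃ (hi : i < n) (hj : j < n) (hk : k < n), x ∈ values q w b ⟨i, hi⟩ ⟨j, hj⟩ ⟨k, hk⟩} :=
    ⟨_, rfl⟩
  have hSv : ∀ i j k (hi : i < n) (hj : j < n) (hk : k < n),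
      S i j k = values q w b ⟨i, hi⟩ ⟨j, hj⟩ ⟨k, hk⟩ := by
    intro i j k hi hj hk
    rw [hS]
    ext x
    exact ⟨fun ⟨_, _, _, h⟩ => h, fun h => ⟨hi, hj, hk, h⟩⟩
  have hT : IsTable n (s.pt (ya b)) (fun i j => s.rarr (ea b) (i * n + j)) (s.rarr (fa b)) S := by
    constructor
    · intro i k hik hk
      have hi : i < n := by omega
      rw [hSv i k k hi hk hk, values, pathValues_self (show (⟨i, hi⟩ : Fin n) < ⟨k, hk⟩ from hik),
        ← h.edge, ← h.last]
    · intro i j k hij hjk hk x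
      have hi : i < n := by omega
      have hj : j < n := by omega
      rw [hSv i j k hi hj hk, values, mem_pathValues_iff (show (⟨i, hi⟩ : Fin n) < ⟨j, hj⟩ from hij)
        (show (⟨j, hj⟩ : Fin n) < ⟨k, hk⟩ from hjk), ← h.edge]
      constructor
      · rintro ⟨t, h₁, h₂, h₃, y, hy, rfl⟩
        refine ⟨t, h₁, h₂, h.concaveTriple_iff.1 h₃, y, ?_, rfl⟩
        rw [hSv j t k hj t.2 hk]
        exact hy
      · rintro ⟨t, h₁, h₂, h₃, y, hy, rfl⟩
        have ht : t < n := by omega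
        rw [hSv j t k hj ht hk] at hy
        exact ⟨⟨t, ht⟩, h₁, h₂, h.concaveTriple_iff.2 h₃, y, hy, rfl⟩
  intro i j k hij hjk
  have := dynProg_spec s hT h.size rfl (fun a c hac hc => ?_) (fun i _ j _ => rfl) (fun k _ => rfl)
    i j k hij hjk k.2
  · rwa [State.HasEntry, hSv i j k i.2 j.2 k.2] at this
  · have ha : a < n := by omega
    have := h.pt b ⟨a, ha⟩
    have := h.pt b ⟨c, hc⟩
    simp only at *
    rw [‹s.pt (ya b) a = _›, this]
    exact side_strictMono hx b (show (⟨a, ha⟩ : Fin n) < ⟨c, hc⟩ from hac)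

theorem Filled.isGreatest {b : Bool} {s : State} (h : Filled q w b s) {i j k : Fin n}
    (hv : s.Valid b n i j k) : IsGreatest (values q w b i j k) (s.val b n i j k) := by
  rcases h i j k hv.1 hv.2.1 with h | h
  · exact h.2
  · have := hv.2.2
    omega

theorem Filled.valid {b : Bool} {s : State} (h : Filled q w b s) {i j k : Fin n} (hij : i < j)
    (hjk : j ≤ k) {x : ℝ} (hx : x ∈ values q w b i j k) :
    s.Valid b n i j k ∧ x ≤ s.val b n i j k := by
  rcases h i j k hij hjk with ⟨h₁, h₂⟩ | ⟨-, h⟩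
  · exact ⟨⟨hij, hjk, h₁⟩, h₂.2 hx⟩
  · rw [h] at hx
    exact hx.elim

/-- An optimal path has some next vertex `t`. Its remainder is worth at most the entry for `j`, `t`,
`k`, and exchanging it for an optimal remainder cannot beat the optimum, so the recurrence is an
equality at `t`. -/
theorem exists_next {b : Bool} {s : State} (hp : Prepared q w s) (h : Filled q w b s)
    {i j k : ℕ} (hjk : j < k) (hk : k < n) (hv : s.Valid b n i j k) :
    ∃ t, s.Next b n k i j t := by
  have hij := hv.1
  lift k to Fin n using hk
  lift j to Fin n using by omega
  lift i to Fin n using by omega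
  have hg := h.isGreatest hv
  obtain ⟨t, h₁, h₂, h₃, y, hy, he⟩ := (mem_pathValues_iff hij hjk).1 hg.1
  obtain ⟨h₄, h₅⟩ := h.valid h₁ h₂ hy
  refine ⟨t, h₄, hp.concaveTriple_iff.1 h₃, ?_⟩
  have := hg.2 ((mem_pathValues_iff hij hjk).2
    ⟨t, h₁, h₂, h₃, s.val b n j t k, (h.isGreatest h₄).1, rfl⟩)
  rw [hp.edge]
  linarith

/-- A traced list is an optimal path. -/
theorem exists_path_of_traced {b : Bool} {s : State} (hp : Prepared q w s) (h : Filled q w b s)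
    {k : Fin n} {L : List ℕ} (hL : Traced (s.Next b n k) k L) :
    ∃ (i j : Fin n) (l : List (Fin n)), L = (i :: j :: l).map Fin.val ∧
      IsPath i k (i :: j :: l) ∧ Chain3 (ConcaveTriple (side q b)) (i :: j :: l) ∧
      edgeSum (edgeValue q w b) (i :: j :: l) + lastValue w b k = s.val b n i j k := by
  induction hL with
  | last i hi =>
    lift i to Fin n using by omega
    have hik : i < k := hi
    have hmem : edgeValue q w b i k + lastValue w b k ∈ values q w b i k k := by
      rw [values, pathValues_self hik]; rfl
    refine ⟨i, k, [], rfl, ⟨rfl, rfl, by simpa using hik⟩, trivial, ?_⟩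
    have := (h.isGreatest (h.valid hik le_rfl hmem).1).1
    rw [values, pathValues_self hik] at this
    rw [this, edgeSum, edgeSum, add_zero]
    simp
  | cons i j t l hij hN hl ih =>
    obtain ⟨j', t', l', h₁, h₂, h₃, h₄⟩ := ih
    simp only [List.map_cons, List.cons.injEq] at h₁
    obtain ⟨rfl, rfl, rfl⟩ := h₁
    lift i to Fin n using by omega
    refine ⟨i, j', t' :: l', rfl, h₂.cons hij, ⟨hp.concaveTriple_iff.2 hN.2.1, h₃⟩, ?_⟩
    rw [edgeSum, add_assoc, h₄, ← hN.2.2, hp.edge]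

theorem chain3_upper {c : List (Fin n)} :
    Chain3 (ConcaveTriple (side q true)) c ↔ IsConcave q c := isConcave_iff_chain3.symm

theorem concaveTriple_side_false : ConcaveTriple (side q false) = ConvexTriple q := by
  funext a b d
  exact propext convexTriple_iff_flip.symm

theorem chain3_lower {c : List (Fin n)} :
    Chain3 (ConcaveTriple (side q false)) c ↔ IsConvex q c := by
  rw [concaveTriple_side_false]; exact isConvex_iff_chain3.symm

theorem value_upper {c : List (Fin n)} {i k : Fin n} (hp : IsPath i k c) :
    edgeSum (edgeValue q w true) c + lastValue w true k = pathWeight q w c :=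
  edgeSum_add_eq _ hp

theorem value_lower {c : List (Fin n)} {k : Fin n} :
    edgeSum (edgeValue q w false) c + lastValue w false k = -pathSubweight q w c := by
  rw [pathSubweight, ← edgeSum_neg]; exact add_zero _

theorem Filled.tableC {s : State} (h : Filled q w true s) {i j k : Fin n} (hij : i < j)
    (hjk : j ≤ k) :
    (s.iarr 2 ((i * n + j) * n + k) = 1 ∧
      tableC q w i j k = (s.rarr 3 ((i * n + j) * n + k) : ℝ)) ∨
    (s.iarr 2 ((i * n + j) * n + k) = 0 ∧ tableC q w i j k = ⊥) := by
  rw [tableC_eq_best]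
  exact (h i j k hij hjk).imp (fun h => ⟨h.1, best_of_isGreatest h.2⟩)
    fun h => ⟨h.1, best_of_empty h.2⟩

theorem Filled.tableV {s : State} (h : Filled q w false s) {i j k : Fin n} (hij : i < j)
    (hjk : j ≤ k) :
    (s.iarr 3 ((i * n + j) * n + k) = 1 ∧
      tableV q w i j k = (-s.rarr 12 ((i * n + j) * n + k) : ℝ)) ∨
    (s.iarr 3 ((i * n + j) * n + k) = 0 ∧ tableV q w i j k = ⊤) := by
  rw [tableV_eq_best, ← concaveTriple_side_false]
  refine (h i j k hij hjk).imp (fun h => ⟨h.1, ?_⟩) fun h => ⟨h.1, ?_⟩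
  · rw [EReal.coe_neg, neg_inj]
    exact best_of_isGreatest h.2
  · rw [EReal.neg_eq_top_iff]
    exact best_of_empty h.2

theorem output_optimal (hx : StrictMono fun t => (q t).1) {s : State} {σ : ℕ → ℕ}
    (hp : Prepared q w s) (h : ∀ b, Filled q w b s) (hσ : s.iarr 1 = σ) (hc : Chosen n s s) :
    ∃ A : Set (Fin n), (output.run s).outputs = (fun t : Fin n => σ t) '' A ∧
      weight q w (hull q A) = s.rvar 0 := by
  rcases output_spec s hp.size hσ (fun b i j k hjk hk hv => exists_next hp (h b) hjk hk hv) hc with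
    ⟨h₁, h₂⟩ | ⟨i, hi, h₁, h₂⟩ | ⟨i, j, j', k, l, l', hik, hk, h₁, h₂, h₃, h₄⟩
  · exact ⟨∅, by simpa using h₁, by rw [h₂, weight_empty]⟩
  · refine ⟨{⟨i, hi⟩}, by simpa using h₁, ?_⟩
    rw [h₂, weight_hull_singleton hx, ← hp.weight]
  · lift k to Fin n using hk
    obtain ⟨a, c, m, e₁, e₂, e₃, e₄⟩ := exists_path_of_traced hp (h true) h₁
    obtain ⟨a', c', m', f₁, f₂, f₃, f₄⟩ := exists_path_of_traced hp (h false) h₂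
    rw [e₁, f₁] at h₃
    simp only [List.map_cons, List.cons.injEq] at e₁ f₁
    obtain ⟨rfl, rfl, rfl⟩ := e₁
    obtain ⟨hai, rfl, rfl⟩ := f₁
    obtain rfl := Fin.ext hai
    refine ⟨{t | t ∈ a :: c :: m ∨ t ∈ a :: c' :: m'}, ?_, ?_⟩
    · rw [h₃]
      ext v
      simp only [List.mem_map, Set.mem_image, Set.mem_ofPred_eq]
      constructor
      · rintro ⟨u, ⟨t, ht, rfl⟩ | ⟨t, ht, rfl⟩, rfl⟩
        exacts [⟨t, Or.inl ht, rfl⟩, ⟨t, Or.inr ht, rfl⟩]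
      · rintro ⟨t, ht | ht, rfl⟩
        exacts [⟨t, Or.inl ⟨t, ht, rfl⟩, rfl⟩, ⟨t, Or.inr ⟨t, ht, rfl⟩, rfl⟩]
    · rw [weight_hull_eq hx hik e₂ (chain3_upper.1 e₃) f₂ (chain3_lower.1 f₃), h₄, ← e₄, ← f₄,
        value_upper e₂, value_lower]
      ring

/-- A polytope has weight zero, or the weight of a single point, or that of a polygon with distinct
ends; the three bounds on `r` match these cases. -/
theorem weight_le_of_bounds (hx : StrictMono fun t => (q t).1) {s : State} {r : ℝ}
    (h : ∀ b, Filled q w b s) (h0 : 0 ≤ r) (h1 : ∀ i : Fin n, w i ≤ r)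
    (h2 : ∀ i k, i < k → k < n → ∀ j j', s.Valid true n i j k → s.Valid false n i j' k →
      s.val true n i j k + s.val false n i j' k ≤ r) {P : Set (ℝ × ℝ)} (hP : IsPolytope P) :
    weight q w P ≤ r := by
  rcases weight_eq_zero_or (q := q) (w := w) hP with hw | ⟨i, k, hik, A, hA, hw⟩
  · rwa [hw]
  · rw [hw]
    rcases hik.eq_or_lt with rfl | hik
    · rw [spans_self.1 hA, Finset.coe_singleton, weight_hull_singleton hx]
      exact h1 i
    · obtain ⟨c, v, hp, hc, hp', hv, hcv⟩ := weight_hull_le (w := w) hx hik hA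
      obtain ⟨j, l, rfl⟩ := hp.exists_cons_cons hik
      obtain ⟨j', l', rfl⟩ := hp'.exists_cons_cons hik
      have hij : i < j := hp.2.2.rel
      have hij' : i < j' := hp'.2.2.rel
      obtain ⟨h₁, h₂⟩ := (h true).valid hij (hp.mem_le (by simp)).2
        ⟨l, hp, chain3_upper.2 hc, (value_upper hp).symm⟩
      obtain ⟨h₃, h₄⟩ := (h false).valid hij' (hp'.mem_le (by simp)).2
        ⟨l', hp', chain3_lower.2 hv, value_lower.symm⟩
      have := h2 i k hik k.2 j j' h₁ h₃
      rw [hcv]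
      linarith

end Memory


/-! ## Rotating the axes -/

section Rotate

variable {a b : ℝ}

theorem isLinearMap_rotate (a b : ℝ) : IsLinearMap ℝ (rotate a b) where
  map_add x y := by simp only [rotate, Prod.fst_add, Prod.snd_add, Prod.mk_add_mk]; congr 1 <;> ring
  map_smul c x := by
    simp only [rotate, Prod.smul_fst, Prod.smul_snd, Prod.smul_mk, smul_eq_mul]; congr 1 <;> ring

theorem rotate_injective (h : (a, b) ≠ (0, 0)) : Function.Injective (rotate a b) := by
  intro x y hxy
  simp only [rotate, Prod.mk.injEq] at hxy
  have hab : a ^ 2 + b ^ 2 ≠ 0 := by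
    intro h0
    exact h (Prod.ext (by simp only; nlinarith) (by simp only; nlinarith))
  refine Prod.ext (mul_left_cancel₀ hab ?_) (mul_left_cancel₀ hab ?_)
  · linear_combination a * hxy.1 - b * hxy.2
  · linear_combination b * hxy.1 + a * hxy.2

variable {n : ℕ} {p : Fin n → ℝ × ℝ} {w : Fin n → ℝ} {σ : Equiv.Perm (Fin n)}

theorem isPolytope_rotate {P : Set (ℝ × ℝ)} (hP : IsPolytope P) : IsPolytope (rotate a b '' P) := by
  classical
  obtain ⟨A, rfl⟩ := hP
  exact ⟨A.image (rotate a b), by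
    rw [(isLinearMap_rotate a b).image_convexHull, Finset.coe_image]⟩

/-- An injective linear map preserves which points lie in the polytope, and sorting only permutes
the summands; so the problem may be solved in the rotated axes. -/
theorem weight_rotate (h : (a, b) ≠ (0, 0)) (P : Set (ℝ × ℝ)) :
    weight (fun t => rotate a b (p (σ t))) (fun t => w (σ t)) (rotate a b '' P) = weight p w P := by
  classical
  simp only [weight, Finset.sum_filter, (rotate_injective h).mem_set_image]
  exact Equiv.sum_comp σ fun t => if p t ∈ P then w t else 0

theorem hull_rotate (A : Set (Fin n)) :
    hull (fun t => rotate a b (p (σ t))) A = rotate a b '' hull p (σ '' A) := by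
  rw [hull, hull, (isLinearMap_rotate a b).image_convexHull, Set.image_image, Set.image_image]

end Rotate

/-! ## The program -/

section Main

variable {n : ℕ}

theorem toArray_fin (f : Fin n → ℝ) (t : Fin n) : toArray f t = f t := by simp [toArray]

/-- An array that holds every index at its rank is a permutation that sorts the keys. -/
theorem exists_sorting_perm {X : ℕ → ℝ} {g : ℕ → ℕ}
    (hg : ∀ i < n, g (Nat.count (fun j => X j < X i) n) = i) :
    ∃ σ : Equiv.Perm (Fin n), (∀ t : Fin n, g t = σ t) ∧ StrictMono fun t => X (σ t) := by
  have hlt : ∀ i < n, Nat.count (fun j => X j < X i) n < n := by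
    intro i hi
    rw [Nat.count_eq_card_filter_range]
    calc _ < (Finset.range n).card := Finset.card_lt_card (Finset.filter_ssubset.2
          ⟨i, by simpa using hi, lt_irrefl (X i)⟩)
      _ = n := Finset.card_range n
  obtain ⟨ρ, hρ⟩ : ∃ ρ : Fin n → Fin n,
      ρ = fun i => ⟨Nat.count (fun j => X j < X i) n, hlt i i.2⟩ := ⟨_, rfl⟩
  have hgρ : ∀ i : Fin n, g (ρ i) = i := fun i => by rw [hρ]; exact hg i i.2
  have hρi : Function.Injective ρ := fun i j h => Fin.ext (by rw [← hgρ i, h, hgρ j])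
  obtain ⟨τ, hτ⟩ : ∃ τ : Equiv.Perm (Fin n), ∀ i, τ i = ρ i :=
    ⟨Equiv.ofBijective ρ (Finite.injective_iff_bijective.1 hρi), fun i => rfl⟩
  refine ⟨τ.symm, fun t => ?_, fun s t hst => ?_⟩
  · have := hgρ (τ.symm t)
    rwa [← hτ, Equiv.apply_symm_apply] at this
  · by_contra h
    have hle : ρ (τ.symm t) ≤ ρ (τ.symm s) := by
      rw [hρ, Fin.mk_le_mk, Nat.count_eq_card_filter_range, Nat.count_eq_card_filter_range]
      refine Finset.card_le_card fun u hu => ?_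
      rw [Finset.mem_filter] at hu ⊢
      exact ⟨hu.1, hu.2.trans_le (not_lt.1 h)⟩
    rw [← hτ, ← hτ, Equiv.apply_symm_apply, Equiv.apply_symm_apply] at hle
    exact hle.not_gt hst

/-- Sorts the points and computes the weights of the edges. -/
def prepare : SProg := .seq chooseAxes (.seq sortPoints (.seq copyPoints edges))

theorem upperSum_eq {q' : ℕ → ℝ × ℝ} {w' : ℕ → ℝ} {q : Fin n → ℝ × ℝ} {w : Fin n → ℝ}
    (hq : ∀ t : Fin n, q' t = q t) (hw : ∀ t : Fin n, w' t = w t) (i j : Fin n) :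
    upperSum n q' w' i j = upperEdge q w i j + w i := by
  classical
  rw [upperSum, upperEdge, hw, add_comm, Finset.sum_range, Finset.sum_filter]
  congr 1
  simp only [hq, hw]
  rw [← Finset.sum_filter, ← Finset.sum_filter]
  refine Finset.sum_congr ?_ fun _ _ => rfl
  ext t
  simp [and_assoc]

theorem lowerSum_eq {q' : ℕ → ℝ × ℝ} {w' : ℕ → ℝ} {q : Fin n → ℝ × ℝ} {w : Fin n → ℝ}
    (hq : ∀ t : Fin n, q' t = q t) (hw : ∀ t : Fin n, w' t = w t) (i j : Fin n) :
    lowerSum n q' w' i j = -lowerEdge q w i j := by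
  classical
  rw [lowerSum, lowerEdge, Finset.sum_range]
  congr 1
  simp only [hq, hw]
  rw [← Finset.sum_filter]
  refine Finset.sum_congr ?_ fun _ _ => rfl
  ext t
  simp [and_assoc]

theorem prepare_spec {p : Fin n → ℝ × ℝ} (w : Fin n → ℝ) (hp : Function.Injective p) {a b : ℝ}
    (ha : (prepare.run (input p w)).rvar 1 = a) (hb : (prepare.run (input p w)).rvar 2 = b) :
    (a, b) ≠ (0, 0) ∧ ((∀ i j, i ≠ j → (p i).1 ≠ (p j).1) → (a, b) = (1, 0)) ∧
    ∃ σ : Equiv.Perm (Fin n), (∀ t : Fin n, (prepare.run (input p w)).iarr 1 t = σ t) ∧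
      StrictMono (fun t => (rotate a b (p (σ t))).1) ∧
      Prepared (fun t => rotate a b (p (σ t))) (fun t => w (σ t)) (prepare.run (input p w)) := by
  obtain ⟨s₀, hs₀⟩ : ∃ s₀, s₀ = input p w := ⟨_, rfl⟩
  rw [← hs₀] at ha hb ⊢
  have i0 : s₀.ivar 0 = n := by simp [hs₀, input]
  have r0 : ∀ t : Fin n, s₀.rarr 0 t = (p t).1 := by simp [hs₀, input, toArray_fin]
  have r1 : ∀ t : Fin n, s₀.rarr 1 t = (p t).2 := by simp [hs₀, input, toArray_fin]
  have r2 : ∀ t : Fin n, s₀.rarr 2 t = w t := by simp [hs₀, input, toArray_fin]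
  have r11 : ∀ t, s₀.rarr 11 t = 0 := by simp [hs₀, input]
  have hF : Frame prepare s₀ (prepare.run s₀) := SProg.frame_run _ _
  have f₁ := SProg.frame_run chooseAxes s₀
  have f₂ := SProg.frame_run sortPoints (chooseAxes.run s₀)
  have f₃ := SProg.frame_run copyPoints (sortPoints.run (chooseAxes.run s₀))
  have f₄ := SProg.frame_run edges (copyPoints.run (sortPoints.run (chooseAxes.run s₀)))
  have hrun : prepare.run s₀ = edges.run (copyPoints.run (sortPoints.run (chooseAxes.run s₀))) := rfl
  rw [hrun] at ha hb hF ⊢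
  have ha₁ : (chooseAxes.run s₀).rvar 1 = a := by
    rw [← ha, f₄.rvar 1 rfl, f₃.rvar 1 rfl, f₂.rvar 1 rfl]
  have hb₁ : (chooseAxes.run s₀).rvar 2 = b := by
    rw [← hb, f₄.rvar 2 rfl, f₃.rvar 2 rfl, f₂.rvar 2 rfl]
  obtain ⟨X, hX⟩ : ∃ X : ℕ → ℝ, X = fun t => a * s₀.rarr 0 t + b * s₀.rarr 1 t := ⟨_, rfl⟩
  have hax := chooseAxes_spec s₀ i0 rfl rfl ha₁ hb₁
  have hne : (a, b) ≠ (0, 0) := by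
    rcases hax with ⟨-, rfl, -⟩ | ⟨-, h, -⟩
    · simp
    · simp [h.ne']
  have hdir : (∀ i j, i ≠ j → (p i).1 ≠ (p j).1) → (a, b) = (1, 0) := by
    intro h
    rcases hax with ⟨-, rfl, rfl⟩ | ⟨⟨i, hi, j, hj, hij, he⟩, -⟩
    · rfl
    · lift i to Fin n using hi
      lift j to Fin n using hj
      rw [r0, r0] at he
      exact absurd he (h i j fun h => hij (by rw [h]))
  -- Without ties the axis is the old one. Otherwise different abscissas stay strictly ordered, and
  -- equal ones force equal ordinates because `b ≠ 0`, hence equal points.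
  have hinj : ∀ i < n, ∀ j < n, X i = X j → i = j := by
    intro i hi j hj he
    rw [hX] at he
    simp only at he
    rcases hax with ⟨h, rfl, rfl⟩ | ⟨-, h₁, h₂, h₃⟩
    · by_contra hij
      exact h i hi j hj hij (by linarith)
    · rcases lt_trichotomy (s₀.rarr 0 i) (s₀.rarr 0 j) with h | h | h
      · have := h₃ j hj i hi h; linarith
      · have hy : s₀.rarr 1 i = s₀.rarr 1 j := by
          rw [h] at he
          exact mul_left_cancel₀ h₂.ne' (by linarith)
        lift i to Fin n using hi
        lift j to Fin n using hj
        rw [r0, r0] at h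
        rw [r1, r1] at hy
        exact congrArg Fin.val (hp (Prod.ext h hy))
      · have := h₃ i hi j hj h; linarith
  have hsort := sortPoints_spec (chooseAxes.run s₀) (n := n) (by rw [f₁.ivar 0 rfl, i0]) (X := X)
    (fun t => by rw [ha₁, hb₁, f₁.rarr 0 rfl, f₁.rarr 1 rfl, hX]) hinj
  obtain ⟨σ, hσ, hmono⟩ := exists_sorting_perm hsort
  have hcopy := copyPoints_spec (sortPoints.run (chooseAxes.run s₀)) (n := n)
    (by rw [f₂.ivar 0 rfl, f₁.ivar 0 rfl, i0]) rfl
  rw [f₂.rvar 1 rfl, f₂.rvar 2 rfl, ha₁, hb₁, f₂.rarr 0 rfl, f₂.rarr 1 rfl, f₂.rarr 2 rfl,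
    f₁.rarr 0 rfl, f₁.rarr 1 rfl, f₁.rarr 2 rfl] at hcopy
  have hcopy' := fun t : Fin n => hcopy t t.2
  simp only [hσ, r0, r1, r2] at hcopy'
  have hpt : ∀ (c) (t : Fin n), (copyPoints.run (sortPoints.run (chooseAxes.run s₀))).pt (ya c) t =
      side (fun t => rotate a b (p (σ t))) c t := by
    intro c t
    obtain ⟨h₁, h₂, -, h₃⟩ := hcopy' t
    cases c
    · exact Prod.ext h₁ h₃
    · exact Prod.ext h₁ h₂
  refine ⟨hne, hdir, σ, fun t => ?_, ?_, ?_⟩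
  · rw [f₄.iarr 1 rfl, f₃.iarr 1 rfl, hσ]
  · intro s t hst
    have := hmono hst
    simp only [hX, r0, r1] at this
    exact this
  · have hedge := edges_spec (copyPoints.run (sortPoints.run (chooseAxes.run s₀))) (n := n)
      (by rw [f₃.ivar 0 rfl, f₂.ivar 0 rfl, f₁.ivar 0 rfl, i0])
    refine ⟨by rw [hF.ivar 0 rfl, i0], fun c t => ?_, fun t => ?_, fun c i j => ?_, fun c k => ?_⟩
    · rw [f₄.pt rfl (by cases c <;> rfl), hpt]
    · rw [f₄.rarr 7 rfl, (hcopy' t).2.2.1]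
    · obtain ⟨h₁, h₂⟩ := hedge i i.2 j j.2
      cases c
      · exact h₂.trans (lowerSum_eq (hpt true) (fun t => (hcopy' t).2.2.1) i j)
      · exact h₁.trans (upperSum_eq (hpt true) (fun t => (hcopy' t).2.2.1) i j)
    · cases c
      -- Array `11` is never written and keeps its initial zeros, the value of the last vertex of a
      -- lower path.
      · exact (congrFun (hF.rarr 11 rfl) k).trans (r11 k)
      · exact (congrFun (f₄.rarr 7 rfl) k).trans (hcopy' k).2.2.1

/-- Computes the tables. -/
def fillTables : SProg := .seq (dynProg true) (.seq (dynProg false) negateTable)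

/-- The program for the maximum weight convex polytope problem. -/
def program : SProg := .seq prepare (.seq fillTables (.seq choosePolygon output))

theorem fillTables_spec {q : Fin n → ℝ × ℝ} {w : Fin n → ℝ} (hx : StrictMono fun t => (q t).1)
    {s : State} (h : Prepared q w s) :
    Prepared q w (fillTables.run s) ∧ (∀ b, Filled q w b (fillTables.run s)) ∧
    ∀ i j k : Fin n, (fillTables.run s).rarr 4 ((i * n + j) * n + k) =
      -(fillTables.run s).rarr 12 ((i * n + j) * n + k) := by
  have hrun : fillTables.run s =
    negateTable.run ((dynProg false).run ((dynProg true).run s)) := rfl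
  have f₁ := SProg.frame_run (dynProg true) s
  have f₂ := SProg.frame_run (dynProg false) ((dynProg true).run s)
  have f₃ := SProg.frame_run negateTable ((dynProg false).run ((dynProg true).run s))
  have h₁ := h.frame f₁ rfl (by decide)
  have h₂ := h₁.frame f₂ rfl (by decide)
  refine ⟨h.frame (SProg.frame_run fillTables s) rfl (by decide), fun b => ?_, fun i j k => ?_⟩
  · rw [hrun]
    cases b
    · exact (dynProg_filled hx h₁).frame f₃ rfl rfl
    · exact ((dynProg_filled hx h).frame f₂ rfl rfl).frame f₃ rfl rfl
  · rw [hrun, negateTable_spec _ h₂.size i i.2 j j.2 k k.2, f₃.rarr 12 rfl]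

theorem program_spec {p : Fin n → ℝ × ℝ} (w : Fin n → ℝ) (hp : Function.Injective p) :
    SolvesMWCP p w (program.run (input p w)) ∧ HoldsTables p w (program.run (input p w)) := by
  obtain ⟨hne, hdir, σ, hσ, hx, hprep⟩ := prepare_spec w hp rfl rfl
  have hrun : program.run (input p w) =
    output.run (choosePolygon.run (fillTables.run (prepare.run (input p w)))) := rfl
  have f₁ := SProg.frame_run fillTables (prepare.run (input p w))
  rw [hrun]
  generalize prepare.run (input p w) = s₁ at *
  obtain ⟨a, ha⟩ : ∃ a, s₁.rvar 1 = a := ⟨_, rfl⟩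
  obtain ⟨b, hb⟩ : ∃ b, s₁.rvar 2 = b := ⟨_, rfl⟩
  rw [ha, hb] at hne hdir hx hprep
  obtain ⟨hprep₂, hfill, hneg⟩ := fillTables_spec hx hprep
  have f₂ := SProg.frame_run choosePolygon (fillTables.run s₁)
  obtain ⟨hch, h0, h1, h2⟩ := choosePolygon_spec (fillTables.run s₁) hprep₂.size
  have hσ₂ : ∀ t : Fin n, (choosePolygon.run (fillTables.run s₁)).iarr 1 t = σ t := fun t => by
    rw [f₂.iarr 1 rfl, f₁.iarr 1 rfl, hσ]
  have ha₂ : (choosePolygon.run (fillTables.run s₁)).rvar 1 = a := by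
    rw [f₂.rvar 1 rfl, f₁.rvar 1 rfl, ha]
  have hb₂ : (choosePolygon.run (fillTables.run s₁)).rvar 2 = b := by
    rw [f₂.rvar 2 rfl, f₁.rvar 2 rfl, hb]
  generalize hs₂ : fillTables.run s₁ = s₂ at *
  have hprep₃ := hprep₂.frame f₂ rfl (by decide)
  have hfill₃ : ∀ b, Filled _ _ b (choosePolygon.run s₂) := fun b =>
    (hfill b).frame f₂ (by cases b <;> rfl) (by cases b <;> rfl)
  have hneg₃ : ∀ i j k : Fin n, (choosePolygon.run s₂).rarr 4 ((i * n + j) * n + k) =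
      -(choosePolygon.run s₂).rarr 12 ((i * n + j) * n + k) := fun i j k => by
    rw [f₂.rarr 4 rfl, f₂.rarr 12 rfl, hneg]
  have hbound : ∀ P, IsPolytope P →
      weight (fun t => rotate a b (p (σ t))) (fun t => w (σ t)) P ≤ (choosePolygon.run s₂).rvar 0 :=
    fun P hP => weight_le_of_bounds hx hfill h0
      (fun i => by have := h1 i i.2; rwa [hprep₂.weight] at this) h2 hP
  have hch₃ : Chosen n (choosePolygon.run s₂) (choosePolygon.run s₂) := by
    have hv : ∀ b i j k, (choosePolygon.run s₂).Valid b n i j k ↔ s₂.Valid b n i j k :=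
      fun b i j k => f₂.valid (by cases b <;> rfl)
    have hl : ∀ b i j k, (choosePolygon.run s₂).val b n i j k = s₂.val b n i j k :=
      fun b i j k => f₂.val (by cases b <;> rfl)
    rw [Chosen, hv, hv, hl, hl, f₂.rarr 7 rfl]
    exact hch
  obtain ⟨A, hA, hAw⟩ := output_optimal hx hprep₃ hfill₃ rfl hch₃
  generalize choosePolygon.run s₂ = s₃ at *
  have f₃ := SProg.frame_run output s₃
  generalize output.run s₃ = s₄ at *
  have hout : {i : Fin n | ∃ t < s₄.ivar 1, s₄.iarr 0 t = i} = σ '' A := by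
    ext i
    have : (∃ t < s₄.ivar 1, s₄.iarr 0 t = i) ↔ (i : ℕ) ∈ s₄.outputs := Iff.rfl
    rw [Set.mem_ofPred_eq, this, hA]
    simp only [Set.mem_image, hσ₂, Fin.val_inj]
  refine ⟨⟨fun t ht => ?_, ?_, fun P hP => ?_⟩, ?_, ?_, σ, fun t => ?_, ?_, fun i j k hij hjk => ⟨?_, ?_⟩⟩
  · have : s₄.iarr 0 t ∈ s₄.outputs := ⟨t, ht, rfl⟩
    rw [hA] at this
    obtain ⟨u, -, hu⟩ := this
    rw [← hu]
    simp only [hσ₂]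
    exact (σ u).2
  · rw [hout, f₃.rvar 0 rfl, ← hAw, hull_rotate, weight_rotate hne]
  · rw [f₃.rvar 0 rfl, ← weight_rotate (σ := σ) hne]
    exact hbound _ (isPolytope_rotate hP)
  · rwa [f₃.rvar 1 rfl, f₃.rvar 2 rfl, ha₂, hb₂]
  · rwa [f₃.rvar 1 rfl, f₃.rvar 2 rfl, ha₂, hb₂]
  · rw [f₃.iarr 1 rfl, hσ₂]
  · rwa [f₃.rvar 1 rfl, f₃.rvar 2 rfl, ha₂, hb₂]
  · rw [f₃.rvar 1 rfl, f₃.rvar 2 rfl, ha₂, hb₂, f₃.iarr 2 rfl, f₃.rarr 3 rfl]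
    exact (hfill₃ true).tableC hij hjk
  · rw [f₃.rvar 1 rfl, f₃.rvar 2 rfl, ha₂, hb₂, f₃.iarr 3 rfl, f₃.rarr 4 rfl, hneg₃]
    exact (hfill₃ false).tableV hij hjk

theorem program_wf : program.wf = true := by decide

/-- The cubic bound is a syntactic fact about a closed term: no more than three loops are nested
anywhere. -/
theorem program_depth : program.depth ≤ 3 := by decide

theorem input_words (p : Fin n → ℝ × ℝ) (w : Fin n → ℝ) : (input p w).Words n := by
  constructor
  · intro x
    simp only [input]
    split_ifs <;> omega
  · intro a i
    exact Nat.zero_le _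

end Main

end MWCP


/-! ### Assembly of the theorem -/

theorem mainTheorem4 :
    -- the running time: one program for all inputs, `O(n ^ 3)` steps, words of `O(log n)` bits
    (∃ (prog : MWCP.Prog) (K e : ℕ), ∀ (n : ℕ) (p : Fin n → ℝ × ℝ) (w : Fin n → ℝ),
      Function.Injective p →
      ∃ (t : ℕ) (s : MWCP.State),
        MWCP.Exec (K * (n + 1) ^ e) prog (MWCP.input p w) t s ∧ t ≤ K * (n + 1) ^ 3 ∧
        MWCP.SolvesMWCP p w s ∧ MWCP.HoldsTables p w s) ∧
    -- the dynamic program, for points `q 0, q 1, …` sorted from left to right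
    (∀ (n : ℕ) (q : Fin n → ℝ × ℝ) (w : Fin n → ℝ), StrictMono (fun t => (q t).1) →
      -- a polygon is bounded by a concave path and a convex path through its vertices
      (∀ (i k : Fin n) (A : Finset (Fin n)), i < k → MWCP.Spans i k A →
        ∃ c v : List (Fin n), MWCP.IsPath i k c ∧ MWCP.IsConcave q c ∧
          MWCP.IsPath i k v ∧ MWCP.IsConvex q v ∧
          MWCP.hull q A = {z | MWCP.Under q c z ∧ MWCP.Above q v z} ∧
          (MWCP.hull q A).extremePoints ℝ = q '' {t | t ∈ c ∨ t ∈ v}) ∧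
      -- two such paths bound a polygon, whose weight is the difference of weight and sub-weight
      (∀ (i k : Fin n) (c v : List (Fin n)), i < k →
        MWCP.IsPath i k c → MWCP.IsConcave q c → MWCP.IsPath i k v → MWCP.IsConvex q v →
        MWCP.hull q {t | t ∈ c ∨ t ∈ v} = {z | MWCP.Under q c z ∧ MWCP.Above q v z} ∧
        MWCP.weight q w (MWCP.hull q {t | t ∈ c ∨ t ∈ v}) =
          MWCP.pathWeight q w c - MWCP.pathSubweight q w v) ∧
      -- the maximum weight of a polygon from the tables
      (∀ k : Fin n, MWCP.tableM q w k k = (w k : ℝ)) ∧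
      (∀ i k : Fin n, i < k → MWCP.tableM q w i k =
        (⨆ j ∈ Finset.Ioc i k, MWCP.tableC q w i j k) -
          ⨅ j ∈ Finset.Ioc i k, MWCP.tableV q w i j k) ∧
      IsGreatest {x : EReal | ∃ P, MWCP.IsPolytope P ∧ x = (MWCP.weight q w P : ℝ)}
        (max 0 (⨆ (i : Fin n) (k : Fin n) (_ : i ≤ k), MWCP.tableM q w i k)) ∧
      ((∃ t, 0 < w t) →
        IsGreatest {x : EReal | ∃ P, MWCP.IsPolytope P ∧ x = (MWCP.weight q w P : ℝ)}
          (⨆ (i : Fin n) (k : Fin n) (_ : i ≤ k), MWCP.tableM q w i k)) ∧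
      -- base cases
      (∀ i k : Fin n, i < k →
        MWCP.tableC q w i k k = (MWCP.upperEdge q w i k + w i + w k : ℝ) ∧
        MWCP.tableV q w i k k = (MWCP.lowerEdge q w i k : ℝ)) ∧
      (∀ i j k : Fin n, i < j → j < k →
        (MWCP.cross (q k - q i) (q j - q i) < 0 → MWCP.tableC q w i j k = ⊥) ∧
        (0 < MWCP.cross (q k - q i) (q j - q i) → MWCP.tableV q w i j k = ⊤)) ∧
      -- recurrences
      (∀ i j k : Fin n, i < j → j < k →
        MWCP.tableC q w i j k =
          (⨆ j' ∈ {j' | j < j' ∧ j' ≤ k ∧ MWCP.ConcaveTriple q i j j'},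
            ((MWCP.upperEdge q w i j + w i : ℝ) : EReal) + MWCP.tableC q w j j' k) ∧
        MWCP.tableV q w i j k =
          (⨅ j' ∈ {j' | j < j' ∧ j' ≤ k ∧ MWCP.ConvexTriple q i j j'},
            (MWCP.lowerEdge q w i j : EReal) + MWCP.tableV q w j j' k)) ∧
      -- angularly sorted lists: compatible points form a suffix, which gives the table entries,
      -- and the first compatible position is monotone (upper paths)
      (∀ (j : Fin n) (L R : List (Fin n)), MWCP.ClockwiseList q j {t | t < j} L →
        MWCP.ClockwiseList q j {t | j < t} R →
        (∀ i < j, ∀ j' : Fin n, j < j' →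
          (MWCP.ConcaveTriple q i j j' ↔ j' ∈ R.drop (MWCP.fcConcave q i j R))) ∧
        (∀ i k : Fin n, i < j → j < k → MWCP.tableC q w i j k =
          ((MWCP.upperEdge q w i j + w i : ℝ) : EReal) +
            MWCP.suffixMaxC q w R j (MWCP.fcConcave q i j R) k) ∧
        (L.map (fun i => MWCP.fcConcave q i j R)).Pairwise (· ≤ ·)) ∧
      -- the same for lower paths, with the reversed (counterclockwise) lists
      (∀ (j : Fin n) (L R : List (Fin n)), MWCP.ClockwiseList q j {t | t < j} L.reverse →
        MWCP.ClockwiseList q j {t | j < t} R.reverse →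
        (∀ i < j, ∀ j' : Fin n, j < j' →
          (MWCP.ConvexTriple q i j j' ↔ j' ∈ R.drop (MWCP.fcConvex q i j R))) ∧
        (∀ i k : Fin n, i < j → j < k → MWCP.tableV q w i j k =
          (MWCP.lowerEdge q w i j : EReal) +
            MWCP.suffixMinV q w R j (MWCP.fcConvex q i j R) k) ∧
        (L.map (fun i => MWCP.fcConvex q i j R)).Pairwise (· ≤ ·))) := by
  refine ⟨?_, fun n q w hx => ⟨fun i k A hik hA => MWCP.exists_decomposition hx hik hA,
    fun i k c v hik hp hc hp' hv => ⟨MWCP.hull_eq_region hx hik hp hc hp' hv,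
      MWCP.weight_hull_eq hx hik hp hc hp' hv⟩,
    fun k => MWCP.tableM_self hx k, fun i k hik => MWCP.tableM_eq hx hik, MWCP.isGreatest_weight,
    fun h => MWCP.isGreatest_weight_of_pos hx h,
    fun i k hik => ⟨MWCP.tableC_self hik, MWCP.tableV_self hik⟩,
    fun i j k hij hjk => ⟨fun h => ?_, fun h => ?_⟩,
    fun i j k hij hjk => ⟨MWCP.tableC_eq_iSup hij hjk, MWCP.tableV_eq_iInf hij hjk⟩,
    fun j L R hL hR => ⟨fun i hij j' hj => MWCP.concaveTriple_iff_mem_drop hx hR hij hj,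
      fun i k hij hjk => MWCP.tableC_eq_suffixMaxC hx hR hij hjk, MWCP.fcConcave_mono hx hL hR⟩,
    fun j L R hL hR => ⟨fun i hij j' hj => MWCP.convexTriple_iff_mem_drop hx hR hij hj,
      fun i k hij hjk => MWCP.tableV_eq_suffixMinV hx hR hij hjk, MWCP.fcConvex_mono hx hL hR⟩⟩⟩
  · obtain ⟨K, e, h⟩ := MWCP.program.exec_of_depth_le MWCP.program_wf MWCP.program_depth
    refine ⟨MWCP.program.compile, K, e, fun n p w hp => ?_⟩
    obtain ⟨t, h₁, h₂⟩ := h n (MWCP.input p w) rfl (MWCP.input_words p w)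
    exact ⟨t, _, h₁, h₂, MWCP.program_spec w hp⟩
  · exact MWCP.tableC_eq_bot hx h
  · exact MWCP.tableV_eq_top hx h
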